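/- Let $n\ge 1$, $p\ge 0$, $N\ge n+1$, and let $A\in\mathbb{R}^{n\times n}$ be the shift matrix (ones on the first superdiagonal, zeros elsewhere), $B=(0,\dots,0,1)^T$, $C=(1,0,\dots,0)$. Consider the plant $$\dot x=Ax+Bf(x,u),\qquad y=Cx+\nu(t),$$ with state $x\in\mathbb{R}^n$, input $u\in\mathbb{R}$, noisy output $y\in\mathbb{R}$, and the state-feedback controller $u=g(x,\theta)$, $\dot\theta=h(x,\theta)$ with $\theta\in\mathbb{R}^p$. Let $D\subseteq\mathbb{R}^n$ and $\Theta\subseteq\mathbb{R}^p$ be open (the domain of interest). Assume that $f$ is locally Lipschitz on $D\times\mathbb{R}$, that $g,h$ are locally Lipschitz on $\mathbb{R}^n\times\Theta$, and that $g,h$ are globally bounded in $x$, i.e. bounded on $\mathbb{R}^n\times K$ for every compact $K\subseteq\Theta$. Assume that for the state-feedback closed loop $$\dot x=Ax+Bf(x,g(x,\theta)),\qquad \dot\theta=h(x,\theta)$$ on $D\times\Theta$ a nonempty compact set $\Sigma\subseteq D\times\Theta$ is positively invariant and uniformly asymptotically stable, and let $\mathcal R$ be its region of attraction. In the output-feedback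 loop the controller is fed the combined estimate $\hat x_o$ of $N$ high-gain observers: $$\dot x=Ax+Bf(x,g(\hat x_o,\theta)),\quad \dot\theta=h(\hat x_o,\theta),\quad \dot{\hat x}_i=A\hat x_i+H(y-C\hat x_i)\ (1\le i\le N),\quad \hat x_o=\sum_{i=1}^N\hat\beta_i\hat x_i,$$ where $H=(\kappa_1/\epsilon,\dots,\kappa_n/\epsilon^n)^T$, all roots of $s^n+\kappa_1s^{n-1}+\dots+\kappa_n$ have negative real part, $\hat\beta_N=1-\sum_{i<N}\hat\beta_i$, and $\hat{\bar\beta}=(\hat\beta_1,\dots,\hat\beta_{N-1})^T$ is given by the recursive least-squares law $$\dot{\hat{\bar\beta}}=-PE^TC^T\big(y-C\hat x_N+CE\hat{\bar\beta}\big),\qquad \dot P=-PE^TC^TCEP,\quad P(0)=\gamma I,$$ with $\gamma>0$ and $E$ the $n\times(N-1)$ matrix with columns $\hat x_N-\hat x_i$. Then for every compact set $\mathcal S_1\subseteq\mathcal R$ and every compact set $\mathcal S_2\subseteq\mathbb{R}^n$ there are constants $\bar\nu^*>0$ and $0<\epsilon_1^*<\epsilon_2^*\le 1$ such that, for every $\epsilon\in[\epsilon_1^*,\epsilon_2^*]$,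 every measurable noise with $|\nu(t)|\le\bar\nu^*$ for all $t\ge 0$, and all initial values $x(0),\theta(0),\hat x_i(0),\hat{\bar\beta}(0)$ with $(x(0),\theta(0))\in\mathcal S_1$ and $\hat x_o(0)\in\mathcal S_2$, the output-feedback loop has a unique solution, it exists for all $t\ge0$ with $(x(t),\theta(t))\in D\times\Theta$, and $x$, $\theta$, $\hat x_o$, all the weights $\hat\beta_i$ and all the observer states $\hat x_i$ are bounded on $[0,\infty)$. -/

import Mathlib

open Set Filter Topology MeasureTheory
open scoped Matrix

noncomputable section

/-! ### Autonomous differential equations on an open domain and stability of a set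

Vectors are elements of `Fin n → ℝ`. All the notions below (compactness, local Lipschitz
continuity, boundedness, asymptotic stability of a compact set) do not change if the norm is
replaced by an equivalent one, for instance by the Euclidean norm. -/

namespace MHGO

section Stability

variable {X : Type*} [NormedAddCommGroup X] [NormedSpace ℝ X]

/-- `z` is a solution of `ż = F z` with values in `Ω` on the time interval `J`. -/
def IsSolution (Ω : Set X) (F : X → X) (J : Set ℝ) (z : ℝ → X) : Prop :=
  IsIntegralCurveOn z (fun _ => F) J ∧ ∀ t ∈ J, z t ∈ Ω

/-- Every solution on an interval `[0, T)` that starts in `A` remains in `A`. -/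
def PositivelyInvariant (Ω : Set X) (F : X → X) (A : Set X) : Prop :=
  ∀ T : ℝ, 0 < T → ∀ z : ℝ → X, IsSolution Ω F (Ico 0 T) z → z 0 ∈ A → ∀ t ∈ Ico 0 T, z t ∈ A

/-- Uniform asymptotic stability of the set `A` for `ż = F z`: stability, and attraction that is
uniform over the initial states in some neighbourhood of `A`. -/
structure UniformlyAsymptoticallyStable (Ω : Set X) (F : X → X) (A : Set X) : Prop where
  stable : ∀ ρ : ℝ, 0 < ρ → ∃ δ : ℝ, 0 < δ ∧ ∀ T : ℝ, 0 < T → ∀ z : ℝ → X,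
    IsSolution Ω F (Ico 0 T) z → Metric.infDist (z 0) A < δ →
      ∀ t ∈ Ico 0 T, Metric.infDist (z t) A < ρ
  attractive : ∃ r : ℝ, 0 < r ∧ ∀ ρ : ℝ, 0 < ρ → ∃ τ : ℝ, 0 ≤ τ ∧ ∀ T : ℝ, 0 < T → ∀ z : ℝ → X,
    IsSolution Ω F (Ico 0 T) z → Metric.infDist (z 0) A < r →
      ∀ t ∈ Ico 0 T, τ ≤ t → Metric.infDist (z t) A < ρ

/-- The region of attraction of `A`: the initial states whose solution exists in `Ω` for all
`t ≥ 0` and converges to `A`. -/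
def regionOfAttraction (Ω : Set X) (F : X → X) (A : Set X) : Set X :=
  {z₀ | ∃ z : ℝ → X, IsSolution Ω F (Ici 0) z ∧ z 0 = z₀ ∧
    Tendsto (fun t => Metric.infDist (z t) A) atTop (𝓝 0)}

/-- `z` is a solution in the sense of Carathéodory, on the time interval `J` starting at `0`, of
`ż(t) = v(t)`, where `v(t)` is the right-hand side evaluated along the trajectory. -/
def SolvesOn (J : Set ℝ) (z v : ℝ → X) : Prop :=
  ∀ t ∈ J, IntervalIntegrable v volume 0 t ∧ z t = z 0 + ∫ s in (0 : ℝ)..t, v s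

/-- `z` is bounded on `[0, ∞)`. -/
def BoundedForward (z : ℝ → X) : Prop := ∃ R : ℝ, ∀ t : ℝ, 0 ≤ t → ‖z t‖ ≤ R

end Stability

/-! ### The plant and the state feedback loop -/

/-- The shift matrix `A`, with ones on the first superdiagonal. -/
def Amat (n : ℕ) : Matrix (Fin n) (Fin n) ℝ :=
  Matrix.of fun i j => if (j : ℕ) = (i : ℕ) + 1 then 1 else 0

/-- The column `B = (0, …, 0, 1)ᵀ`. -/
def Bvec (n : ℕ) : Fin n → ℝ := fun i => if (i : ℕ) + 1 = n then 1 else 0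

/-- The row `C = (1, 0, …, 0)`. -/
def Cvec (n : ℕ) : Fin n → ℝ := fun i => if (i : ℕ) = 0 then 1 else 0

/-- The closed loop under state feedback, with state `(x, θ)`:
`ẋ = A x + B f(x, g(x, θ))`, `θ̇ = h(x, θ)`. -/
def stateFeedbackField {n p : ℕ} (f : (Fin n → ℝ) → ℝ → ℝ) (g : (Fin n → ℝ) → (Fin p → ℝ) → ℝ)
    (h : (Fin n → ℝ) → (Fin p → ℝ) → (Fin p → ℝ)) :
    (Fin n → ℝ) × (Fin p → ℝ) → (Fin n → ℝ) × (Fin p → ℝ) :=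
  fun q => (Amat n *ᵥ q.1 + f q.1 (g q.1 q.2) • Bvec n, h q.1 q.2)

/-! ### The bank of high-gain observers with weights from recursive least squares -/

/-- All roots of `sⁿ + κ₁ sⁿ⁻¹ + ⋯ + κₙ` lie in the open left half-plane (`κ i` is `κᵢ₊₁`). -/
def HurwitzCoefficients {n : ℕ} (κ : Fin n → ℝ) : Prop :=
  ∀ s : ℂ, s ^ n + ∑ i : Fin n, (κ i : ℂ) * s ^ (n - 1 - (i : ℕ)) = 0 → s.re < 0

/-- The observer gain `H = (κ₁ / ε, κ₂ / ε², …, κₙ / εⁿ)ᵀ`. -/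
def gainH {n : ℕ} (κ : Fin n → ℝ) (ε : ℝ) : Fin n → ℝ := fun i => κ i / ε ^ ((i : ℕ) + 1)

/-- A state of the output feedback loop with `N = M + 1` observers: the plant state `x`, the
controller state `θ`, the observer states `x̂₁, …, x̂_N`, the vector `(β̂₁, …, β̂_{N-1})` of the first
`N - 1` weights, and the matrix `P` of the least-squares law. -/
@[ext]
structure LoopState (n p M : ℕ) where
  x : Fin n → ℝ
  θ : Fin p → ℝ
  xhat : Fin (M + 1) → Fin n → ℝ
  βbar : Fin M → ℝ
  P : Matrix (Fin M) (Fin M) ℝ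

namespace LoopState

variable {n p M : ℕ} (z : LoopState n p M)

/-- All `N` weights; the last one is `β̂_N = 1 - ∑_{i < N} β̂ᵢ`. -/
def weights : Fin (M + 1) → ℝ := Fin.snoc (α := fun _ => ℝ) z.βbar (1 - ∑ i, z.βbar i)

/-- The combined estimate `x̂ₒ = ∑ᵢ β̂ᵢ x̂ᵢ`. -/
def estimate : Fin n → ℝ := ∑ i, z.weights i • z.xhat i

/-- The matrix `E`, whose `i`-th column is `x̂_N - x̂ᵢ`. -/
def Emat : Matrix (Fin n) (Fin M) ℝ :=
  Matrix.of fun k i => z.xhat (Fin.last M) k - z.xhat i.castSucc k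

/-- The row `C E` (as a vector, so that it is also `Eᵀ Cᵀ`). -/
def CE : Fin M → ℝ := Cvec n ᵥ* z.Emat

end LoopState

/-- `z` is, on the time interval `J`, a solution of the output feedback loop with measurement noise
`ν`, that is, with `y = C x + ν(t)`,
* `ẋ = A x + B f(x, u)` with `u = g(x̂ₒ, θ)`, and `θ̇ = h(x̂ₒ, θ)`,
* `x̂ᵢ' = A x̂ᵢ + H (y - C x̂ᵢ)` for every observer,
* `β̄' = -P Eᵀ Cᵀ (ỹ_N + C E β̄)` with `ỹ_N = y - C x̂_N`, and `P' = -P Eᵀ Cᵀ C E P`,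
where `(x, θ)` stays in the domain `D × Θ`. -/
structure IsLoopSolution {n p M : ℕ} (D : Set (Fin n → ℝ)) (Θ : Set (Fin p → ℝ))
    (f : (Fin n → ℝ) → ℝ → ℝ) (g : (Fin n → ℝ) → (Fin p → ℝ) → ℝ)
    (h : (Fin n → ℝ) → (Fin p → ℝ) → (Fin p → ℝ))
    (κ : Fin n → ℝ) (ε : ℝ) (ν : ℝ → ℝ) (J : Set ℝ) (z : ℝ → LoopState n p M) : Prop where
  mem_domain : ∀ t ∈ J, (z t).x ∈ D ∧ (z t).θ ∈ Θ
  plant : SolvesOn J (fun t => (z t).x) fun t =>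
    Amat n *ᵥ (z t).x + f (z t).x (g (z t).estimate (z t).θ) • Bvec n
  controller : SolvesOn J (fun t => (z t).θ) fun t => h (z t).estimate (z t).θ
  observers : ∀ i, SolvesOn J (fun t => (z t).xhat i) fun t =>
    Amat n *ᵥ (z t).xhat i
      + ((Cvec n ⬝ᵥ (z t).x + ν t) - Cvec n ⬝ᵥ (z t).xhat i) • gainH κ ε
  weights : SolvesOn J (fun t => (z t).βbar) fun t =>
    -((((Cvec n ⬝ᵥ (z t).x + ν t) - Cvec n ⬝ᵥ (z t).xhat (Fin.last M))
        + (z t).CE ⬝ᵥ (z t).βbar) • ((z t).P *ᵥ (z t).CE))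
  covariance : ∀ i j, SolvesOn J (fun t => (z t).P i j) fun t =>
    -((z t).P * Matrix.vecMulVec (z t).CE (z t).CE * (z t).P) i j

end MHGO

end

noncomputable section

namespace MHGO

/-! ### An integral Grönwall inequality -/

/-! Along the output-feedback loop, `q = (x, θ)` obeys the state-feedback equation plus the
perturbation `feedbackField f g h (q, x̂ₒ) - stateFeedbackField f g h q`. The proof combines
robustness of attraction with an estimate of `x - x̂ₒ`.

Robustness (`exists_compact_robust`): trajectories from `S₁` stay in a compact `Q` whenever the
perturbation has small integral over every window of length at most `T`. Grönwall keeps such a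
trajectory close to an unperturbed one for the time in which attraction pulls the latter well inside
a neighbourhood of the attractor, and this step is iterated. Since only integrals count, the
perturbation may be large for a short time. Boundedness of `g` and `h` caps it during the peaking of
the observers, and afterwards it is small because `x̂ₒ` is accurate.

Accuracy (`IsLoopSolution.norm_error_estimate_le`): differences of observers solve the homogeneous
error equation, so `E(t) = Φ(t) E(0)` and `x - x̂ₒ = Φ(t) (x(0) - x̂ₒ(0) + u)` plus a forced part,
where `u = E(0) (β̄(t) - β̄(0))`. The forced part is of order `ε + νs / ε ^ (n - 1)`. As `E(0)` is
arbitrary, `u` must be bounded without it. The inverse of `P` is `γ⁻¹ I + ∫ e eᵀ`, and the resulting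
energy estimate bounds `∫ (C Φ u)²` by a multiple of `ε ‖balance ε u‖`; observability bounds the
same integral below by a multiple of `ε ‖balance ε u‖²`. Dividing bounds `balance ε u` through the
initial combined error, the bound on `f` and the noise alone.

The accuracy estimate presupposes a bound on `f` along the trajectory, hence confinement, which in
turn rests on accuracy; continuous induction (`forall_mem_of_trapped`) resolves the circle. Small
`ε` beats the peaking factor, and a lower limit on `ε` caps the amplification of noise. -/

theorem gronwall_integral {u : ℝ → ℝ} {T c L : ℝ} (hu : ContinuousOn u (Icc 0 T)) (hL : 0 ≤ L)
    (h : ∀ t ∈ Icc 0 T, u t ≤ c + L * ∫ s in (0 : ℝ)..t, u s) :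
    ∀ t ∈ Icc 0 T, u t ≤ c * Real.exp (L * t) := by
  intro t ht
  have hT : 0 ≤ T := ht.1.trans ht.2
  have hint : IntervalIntegrable u volume 0 T := by
    apply ContinuousOn.intervalIntegrable
    rwa [uIcc_of_le hT]
  have hUc : ContinuousOn (fun t => ∫ s in (0 : ℝ)..t, u s) (Icc 0 T) := by
    have := intervalIntegral.continuousOn_primitive_interval' hint (left_mem_uIcc)
    rwa [uIcc_of_le hT] at this
  have hder : ∀ x ∈ Ioo 0 T, HasDerivAt
      (fun t => Real.exp (-(L * t)) * (c + L * ∫ s in (0 : ℝ)..t, u s))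
      (Real.exp (-(L * x)) * (-(L * 1)) * (c + L * ∫ s in (0 : ℝ)..x, u s)
        + Real.exp (-(L * x)) * (L * u x)) x := by
    intro x hx
    have h1 : HasDerivAt (fun t => ∫ s in (0 : ℝ)..t, u s) (u x) x := by
      apply intervalIntegral.integral_hasDerivAt_right
      · apply hint.mono_set
        rw [uIcc_of_le hT, uIcc_of_le hx.1.le]
        exact Icc_subset_Icc_right hx.2.le
      · exact ContinuousOn.stronglyMeasurableAtFilter isOpen_Ioo
          (hu.mono Ioo_subset_Icc_self) x hx
      · exact hu.continuousAt (Icc_mem_nhds hx.1 hx.2)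
    exact (((hasDerivAt_id x).const_mul L).neg.exp).mul ((h1.const_mul L).const_add c)
  -- The discounted right-hand side is nonincreasing; neither `c` nor `u` needs a sign.
  have hanti : AntitoneOn (fun t => Real.exp (-(L * t)) * (c + L * ∫ s in (0 : ℝ)..t, u s))
      (Icc 0 T) := by
    apply antitoneOn_of_deriv_nonpos (convex_Icc 0 T)
    · fun_prop
    · rw [interior_Icc]
      exact fun x hx => (hder x hx).differentiableAt.differentiableWithinAt
    · rw [interior_Icc]
      intro x hx
      rw [(hder x hx).deriv]
      have h2 := h x (Ioo_subset_Icc_self hx)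
      have h3 : Real.exp (-(L * x)) * (-(L * 1)) * (c + L * ∫ s in (0 : ℝ)..x, u s)
        + Real.exp (-(L * x)) * (L * u x)
        = - (Real.exp (-(L * x)) * (L * ((c + L * ∫ s in (0 : ℝ)..x, u s) - u x))) := by ring
      rw [h3, neg_nonpos]
      exact mul_nonneg (Real.exp_pos _).le (mul_nonneg hL (sub_nonneg.2 h2))
  have h0 := hanti (left_mem_Icc.2 hT) ht ht.1
  simp only [mul_zero, neg_zero, Real.exp_zero, intervalIntegral.integral_same, add_zero,
    one_mul] at h0
  refine (h t ht).trans ?_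
  have h4 : (c + L * ∫ s in (0 : ℝ)..t, u s)
      = Real.exp (L * t) * (Real.exp (-(L * t)) * (c + L * ∫ s in (0 : ℝ)..t, u s)) := by
    rw [← mul_assoc, ← Real.exp_add]; simp
  rw [h4, mul_comm c]
  exact mul_le_mul_of_nonneg_left h0 (Real.exp_pos _).le

theorem integral_exp_mul_le {l t : ℝ} (hl : 0 < l) :
    ∫ s in (0 : ℝ)..t, Real.exp (l * s) ≤ Real.exp (l * t) / l := by
  have h : ∫ s in (0 : ℝ)..t, Real.exp (l * s) = Real.exp (l * t) / l - Real.exp (l * 0) / l := by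
    apply intervalIntegral.integral_eq_sub_of_hasDerivAt
    · intro x _
      have := ((hasDerivAt_id x).const_mul l).exp.div_const l
      simp only [id, mul_one, mul_div_cancel_right₀ _ hl.ne'] at this
      exact this
    · exact (by fun_prop : Continuous fun s : ℝ => Real.exp (l * s)).intervalIntegrable _ _
  rw [h]
  have : 0 < Real.exp (l * 0) / l := by positivity
  linarith

theorem norm_integral_le_exp {X : Type*} [NormedAddCommGroup X] [NormedSpace ℝ X] {v : ℝ → X}
    {l t C : ℝ} (hl : 0 < l) (ht : 0 ≤ t) (hC : 0 ≤ C)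
    (hv : ∀ s ∈ Icc 0 t, ‖v s‖ ≤ C * Real.exp (l * s)) :
    ‖∫ s in (0 : ℝ)..t, v s‖ ≤ C / l * Real.exp (l * t) := by
  have h1 : ‖∫ s in (0 : ℝ)..t, v s‖ ≤ ∫ s in (0 : ℝ)..t, C * Real.exp (l * s) := by
    apply intervalIntegral.norm_integral_le_of_norm_le ht
    · exact Eventually.of_forall fun s hs => hv s ⟨hs.1.le, hs.2⟩
    · exact (by fun_prop : Continuous fun s : ℝ => C * Real.exp (l * s)).intervalIntegrable _ _
  refine h1.trans ?_
  rw [intervalIntegral.integral_const_mul, div_mul_eq_mul_div, mul_div_assoc]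
  exact mul_le_mul_of_nonneg_left (integral_exp_mul_le hl) hC

/-! ### Calculus of Carathéodory solutions -/

section SolvesOn

variable {X : Type*} [NormedAddCommGroup X] [NormedSpace ℝ X] {J J' : Set ℝ} {z v : ℝ → X}

theorem SolvesOn.mono (h : SolvesOn J z v) (hJ : J' ⊆ J) : SolvesOn J' z v :=
  fun t ht => h t (hJ ht)

theorem SolvesOn.congr {z' v' : ℝ → X} (h : SolvesOn J z v) (h0 : (0 : ℝ) ∈ J) (hJ : J.OrdConnected)
    (hz : ∀ t ∈ J, z t = z' t) (hv : ∀ t ∈ J, v t = v' t) : SolvesOn J z' v' := by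
  intro t ht
  have hsub : uIcc 0 t ⊆ J := hJ.uIcc_subset h0 ht
  have heq : EqOn v v' (uIcc 0 t) := fun s hs => hv s (hsub hs)
  refine ⟨(h t ht).1.congr fun s hs => heq (uIoc_subset_uIcc hs), ?_⟩
  rw [← hz t ht, ← hz 0 h0, (h t ht).2]
  congr 1
  exact intervalIntegral.integral_congr heq

theorem SolvesOn.integral_eq_sub (h : SolvesOn J z v) {a b : ℝ} (ha : a ∈ J) (hb : b ∈ J) :
    ∫ s in a..b, v s = z b - z a := by
  rw [(h a ha).2, (h b hb).2, ← intervalIntegral.integral_interval_sub_left (h b hb).1 (h a ha).1]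
  abel

theorem SolvesOn.intervalIntegrable (h : SolvesOn J z v) {a b : ℝ} (ha : a ∈ J) (hb : b ∈ J) :
    IntervalIntegrable v volume a b :=
  (h a ha).1.symm.trans (h b hb).1

theorem SolvesOn.continuousOn_Icc {T : ℝ} (h : SolvesOn (Icc 0 T) z v) :
    ContinuousOn z (Icc 0 T) := by
  rcases lt_or_ge T 0 with hT | hT
  · simp [Icc_eq_empty_of_lt hT]
  have h1 := intervalIntegral.continuousOn_primitive_interval' (h T ⟨hT, le_rfl⟩).1 left_mem_uIcc
  rw [uIcc_of_le hT] at h1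
  exact (continuousOn_const (c := z 0)|>.add h1).congr fun t ht => (h t ht).2

theorem SolvesOn.continuousOn_Ico {T : ℝ} (h : SolvesOn (Ico 0 T) z v) :
    ContinuousOn z (Ico 0 T) := by
  intro t ht
  obtain ⟨T', h1, h2⟩ := exists_between ht.2
  have := (h.mono (Icc_subset_Ico_right h2)).continuousOn_Icc t ⟨ht.1, h1.le⟩
  apply this.mono_of_mem_nhdsWithin
  rw [mem_nhdsWithin]
  exact ⟨Iio T', isOpen_Iio, h1, fun s hs => ⟨hs.2.1, hs.1.le⟩⟩

theorem SolvesOn.add {z' v' : ℝ → X} (h : SolvesOn J z v) (h' : SolvesOn J z' v') :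
    SolvesOn J (fun t => z t + z' t) (fun t => v t + v' t) := by
  intro t ht
  refine ⟨(h t ht).1.add (h' t ht).1, ?_⟩
  change z t + z' t = z 0 + z' 0 + ∫ s in (0 : ℝ)..t, v s + v' s
  rw [intervalIntegral.integral_add (h t ht).1 (h' t ht).1, (h t ht).2, (h' t ht).2]
  abel

theorem SolvesOn.clm [CompleteSpace X] {Z : Type*} [NormedAddCommGroup Z] [NormedSpace ℝ Z]
    [CompleteSpace Z] (h : SolvesOn J z v) (L : X →L[ℝ] Z) :
    SolvesOn J (fun t => L (z t)) (fun t => L (v t)) := by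
  intro t ht
  refine ⟨⟨L.integrable_comp (h t ht).1.1, L.integrable_comp (h t ht).1.2⟩, ?_⟩
  rw [L.intervalIntegral_comp_comm (h t ht).1, ← map_add, ← (h t ht).2]

theorem SolvesOn.neg [CompleteSpace X] (h : SolvesOn J z v) :
    SolvesOn J (fun t => -z t) (fun t => -v t) :=
  h.clm (-ContinuousLinearMap.id ℝ X)

theorem SolvesOn.sub [CompleteSpace X] {z' v' : ℝ → X} (h : SolvesOn J z v)
    (h' : SolvesOn J z' v') : SolvesOn J (fun t => z t - z' t) (fun t => v t - v' t) := by
  simpa only [sub_eq_add_neg] using h.add h'.neg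

theorem SolvesOn.prodMk [CompleteSpace X] {Z : Type*} [NormedAddCommGroup Z] [NormedSpace ℝ Z]
    [CompleteSpace Z] {y w : ℝ → Z} (h : SolvesOn J z v) (h' : SolvesOn J y w) :
    SolvesOn J (fun t => (z t, y t)) (fun t => (v t, w t)) := by
  intro t ht
  have hi : IntervalIntegrable (fun t => (v t, w t)) volume 0 t :=
    ⟨(h t ht).1.1.prodMk (h' t ht).1.1, (h t ht).1.2.prodMk (h' t ht).1.2⟩
  refine ⟨hi, ?_⟩
  have h1 := (ContinuousLinearMap.fst ℝ X Z).intervalIntegral_comp_comm hi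
  have h2 := (ContinuousLinearMap.snd ℝ X Z).intervalIntegral_comp_comm hi
  simp only [ContinuousLinearMap.coe_fst', ContinuousLinearMap.coe_snd'] at h1 h2
  ext1
  · rw [Prod.fst_add, ← h1]; exact (h t ht).2
  · rw [Prod.snd_add, ← h2]; exact (h' t ht).2

theorem solvesOn_pi {ι : Type*} [Fintype ι] [CompleteSpace X] {z v : ℝ → ι → X}
    (h : ∀ i, SolvesOn J (fun t => z t i) (fun t => v t i)) : SolvesOn J z v := by
  intro t ht
  have hi : IntervalIntegrable v volume 0 t :=
    ⟨Integrable.of_eval fun i => (h i t ht).1.1, Integrable.of_eval fun i => (h i t ht).1.2⟩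
  refine ⟨hi, ?_⟩
  ext1 i
  have h1 := (ContinuousLinearMap.proj (R := ℝ) (φ := fun _ : ι => X) i).intervalIntegral_comp_comm
    hi
  simp only [ContinuousLinearMap.proj_apply] at h1
  rw [Pi.add_apply, ← h1]
  exact (h i t ht).2

theorem SolvesOn.apply {ι : Type*} [Fintype ι] [CompleteSpace X] {z v : ℝ → ι → X}
    (h : SolvesOn J z v) (i : ι) : SolvesOn J (fun t => z t i) (fun t => v t i) :=
  h.clm (ContinuousLinearMap.proj (R := ℝ) (φ := fun _ : ι => X) i)

theorem SolvesOn.sum {ι : Type*} (s : Finset ι) {z v : ι → ℝ → X}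
    (h : ∀ i ∈ s, SolvesOn J (z i) (v i)) :
    SolvesOn J (fun t => ∑ i ∈ s, z i t) (fun t => ∑ i ∈ s, v i t) := by
  classical
  induction s using Finset.induction_on with
  | empty => intro t _; simp
  | insert a s ha ih =>
    simp only [Finset.sum_insert ha]
    exact (h a (Finset.mem_insert_self a s)).add
      (ih fun i hi => h i (Finset.mem_insert_of_mem hi))

theorem solvesOn_of_hasDerivWithinAt [CompleteSpace X] {T : ℝ}
    (hd : ∀ t ∈ Ico 0 T, HasDerivWithinAt z (v t) (Ico 0 T) t) (hv : ContinuousOn v (Ico 0 T)) :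
    SolvesOn (Ico 0 T) z v := by
  intro t ht
  have hsub : Icc 0 t ⊆ Ico 0 T := Icc_subset_Ico_right ht.2
  have hi : IntervalIntegrable v volume 0 t := by
    apply ContinuousOn.intervalIntegrable
    rw [uIcc_of_le ht.1]
    exact hv.mono hsub
  refine ⟨hi, ?_⟩
  rw [intervalIntegral.integral_eq_sub_of_hasDerivAt_of_le ht.1 (f := z)]
  · abel
  · exact fun s hs => (hd s (hsub hs)).continuousWithinAt.mono hsub
  · exact fun s hs => (hd s (hsub (Ioo_subset_Icc_self hs))).hasDerivAt
      (Ico_mem_nhds hs.1 (hs.2.trans ht.2))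
  · exact hi

theorem solvesOn_of_hasDerivAt [CompleteSpace X] (hd : ∀ t, HasDerivAt z (v t) t)
    (hv : Continuous v) : SolvesOn J z v := by
  intro t _
  refine ⟨hv.intervalIntegrable _ _, ?_⟩
  rw [intervalIntegral.integral_eq_sub_of_hasDerivAt (fun s _ => hd s) (hv.intervalIntegrable _ _)]
  abel

theorem SolvesOn.hasDerivWithinAt [CompleteSpace X] {T : ℝ} (h : SolvesOn (Ico 0 T) z v)
    (hv : ContinuousOn v (Ico 0 T)) {t : ℝ} (ht : t ∈ Ico 0 T) :
    HasDerivWithinAt z (v t) (Ico 0 T) t := by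
  have hkey : HasDerivWithinAt (fun t => z 0 + ∫ s in (0 : ℝ)..t, v s) (v t) (Ico 0 T) t := by
    apply HasDerivWithinAt.const_add
    rcases eq_or_lt_of_le ht.1 with h0 | h0
    · subst h0
      have h1 : HasDerivWithinAt (fun t => ∫ s in (0 : ℝ)..t, v s) (v 0) (Ici 0) 0 := by
        apply intervalIntegral.integral_hasDerivWithinAt_right (t := Ioi 0) (h 0 ht).1
        · refine ⟨Ioo 0 T, Ioo_mem_nhdsGT ht.2, ?_⟩
          exact (hv.mono Ioo_subset_Ico_self).aestronglyMeasurable measurableSet_Ioo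
        · have := (hv 0 ht)
          apply this.mono_of_mem_nhdsWithin
          exact mem_of_superset (Ioo_mem_nhdsGT ht.2) Ioo_subset_Ico_self
      exact h1.mono Ico_subset_Ici_self
    · apply HasDerivAt.hasDerivWithinAt
      apply intervalIntegral.integral_hasDerivAt_right (h t ht).1
      · exact ContinuousOn.stronglyMeasurableAtFilter isOpen_Ioo
          (hv.mono Ioo_subset_Ico_self) t ⟨h0, ht.2⟩
      · exact hv.continuousAt (Ico_mem_nhds h0 ht.2)
  exact hkey.congr (fun s hs => (h s hs).2) (h t ht).2

/-- The product rule for absolutely continuous functions. -/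
theorem SolvesOn.mul {a α b β : ℝ → ℝ} {T : ℝ} (ha : SolvesOn (Icc 0 T) a α)
    (hb : SolvesOn (Icc 0 T) b β) :
    SolvesOn (Icc 0 T) (fun t => a t * b t) (fun t => α t * b t + a t * β t) := by
  intro t ht
  have hsub : uIcc 0 t ⊆ Icc 0 T := by
    rw [uIcc_of_le ht.1]; exact Icc_subset_Icc_right ht.2
  have hac := ha.continuousOn_Icc.mono hsub
  have hbc := hb.continuousOn_Icc.mono hsub
  refine ⟨((ha t ht).1.mul_continuousOn hbc).add ((hb t ht).1.continuousOn_mul hac), ?_⟩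
  have hconst : ∀ c : ℝ, AbsolutelyContinuousOnInterval (fun _ => c) 0 t := fun c =>
    (LipschitzWith.const c).lipschitzOnWith.absolutelyContinuousOnInterval
  have h1 := (hconst (a 0)).fun_add
    ((ha t ht).1.absolutelyContinuousOnInterval_intervalIntegral left_mem_uIcc)
  have h2 := (hconst (b 0)).fun_add
    ((hb t ht).1.absolutelyContinuousOnInterval_intervalIntegral left_mem_uIcc)
  -- Integration by parts for absolutely continuous functions; the almost everywhere derivatives of
  -- the primitives are then identified by Lebesgue differentiation.
  have h3 := h1.integral_deriv_mul_eq_sub h2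
  simp only [intervalIntegral.integral_same, add_zero] at h3
  rw [← (ha t ht).2, ← (hb t ht).2] at h3
  rw [← sub_eq_iff_eq_add', ← h3]
  apply intervalIntegral.integral_congr_ae
  filter_upwards [(ha t ht).1.ae_hasDerivAt_integral, (hb t ht).1.ae_hasDerivAt_integral]
    with s hs1 hs2 hs
  have hs' := uIoc_subset_uIcc hs
  rw [((hs1 hs' 0 left_mem_uIcc).const_add (a 0)).deriv,
    ((hs2 hs' 0 left_mem_uIcc).const_add (b 0)).deriv, ← (ha s (hsub hs')).2,
    ← (hb s (hsub hs')).2]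

end SolvesOn

/-! ### Uniqueness, global existence and continuation -/

section CaratheodoryODE

variable {X : Type*} [NormedAddCommGroup X] [NormedSpace ℝ X]

/-- Grönwall in a form that serves both uniqueness (`c = 0`) and perturbed solutions (`c` absorbs
the integrated perturbation). Integrability of `w` is not needed, because `k * ‖y‖` is an integrable
majorant. -/
theorem norm_le_of_integral_bound {y w : ℝ → X} {T c k : ℝ} (hk : 0 ≤ k)
    (hy : ContinuousOn y (Icc 0 T))
    (h : ∀ t ∈ Icc 0 T, ‖y t‖ ≤ c + ‖∫ s in (0 : ℝ)..t, w s‖)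
    (hw : ∀ t ∈ Icc 0 T, ‖w t‖ ≤ k * ‖y t‖) :
    ∀ t ∈ Icc 0 T, ‖y t‖ ≤ c * Real.exp (k * t) := by
  apply gronwall_integral hy.norm hk
  intro t ht
  refine (h t ht).trans (add_le_add le_rfl ?_)
  rw [← intervalIntegral.integral_const_mul]
  apply intervalIntegral.norm_integral_le_of_norm_le ht.1
  · exact Eventually.of_forall fun s hs => hw s ⟨hs.1.le, hs.2.trans ht.2⟩
  · apply ContinuousOn.intervalIntegrable
    rw [uIcc_of_le ht.1]
    exact (hy.norm.mono (Icc_subset_Icc_right ht.2)).const_mul k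

theorem SolvesOn.eq_zero {y w : ℝ → X} {T k : ℝ} (hk : 0 ≤ k) (h : SolvesOn (Icc 0 T) y w)
    (h0 : y 0 = 0) (hw : ∀ t ∈ Icc 0 T, ‖w t‖ ≤ k * ‖y t‖) : ∀ t ∈ Icc 0 T, y t = 0 := by
  intro t ht
  have := norm_le_of_integral_bound hk h.continuousOn_Icc (c := 0)
    (fun t ht => by rw [(h t ht).2, h0, zero_add, zero_add]) hw t ht
  rw [zero_mul] at this
  exact norm_le_zero_iff.1 this

/-- Uniqueness for `ż = G z + ν(t) b z` with `G`, `b` locally Lipschitz on `Ω` and `ν` bounded. -/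
theorem SolvesOn.eqOn_of_locallyLipschitzOn [CompleteSpace X] {Ω : Set X} {G b : X → X} {ν : ℝ → ℝ}
    {T c : ℝ}
    (hG : LocallyLipschitzOn Ω G) (hb : LocallyLipschitzOn Ω b)
    (hν : ∀ t, 0 ≤ t → |ν t| ≤ c) {z z' : ℝ → X}
    (hz : SolvesOn (Ico 0 T) z fun t => G (z t) + ν t • b (z t))
    (hz' : SolvesOn (Ico 0 T) z' fun t => G (z' t) + ν t • b (z' t))
    (hzΩ : ∀ t ∈ Ico 0 T, z t ∈ Ω) (hzΩ' : ∀ t ∈ Ico 0 T, z' t ∈ Ω) (h0 : z 0 = z' 0) :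
    ∀ t ∈ Ico 0 T, z t = z' t := by
  intro t ht
  have hsub : Icc 0 t ⊆ Ico 0 T := Icc_subset_Ico_right ht.2
  have hz1 := hz.mono hsub
  have hz1' := hz'.mono hsub
  set K := z '' Icc 0 t ∪ z' '' Icc 0 t with hK
  have hKc : IsCompact K := (isCompact_Icc.image_of_continuousOn hz1.continuousOn_Icc).union
    (isCompact_Icc.image_of_continuousOn hz1'.continuousOn_Icc)
  have hKΩ : K ⊆ Ω := by
    rintro _ (⟨s, hs, rfl⟩ | ⟨s, hs, rfl⟩)
    exacts [hzΩ s (hsub hs), hzΩ' s (hsub hs)]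
  obtain ⟨L, hL⟩ := (hG.mono hKΩ).exists_lipschitzOnWith_of_compact hKc
  obtain ⟨L', hL'⟩ := (hb.mono hKΩ).exists_lipschitzOnWith_of_compact hKc
  have hc : 0 ≤ c := (abs_nonneg _).trans (hν 0 le_rfl)
  have := (hz1.sub hz1').eq_zero (k := L + c * L') (by positivity) (by rw [h0, sub_self]) ?_
    t ⟨ht.1, le_rfl⟩
  · exact sub_eq_zero.1 this
  · intro s hs
    have hm : z s ∈ K := Or.inl ⟨s, hs, rfl⟩
    have hm' : z' s ∈ K := Or.inr ⟨s, hs, rfl⟩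
    have e : G (z s) + ν s • b (z s) - (G (z' s) + ν s • b (z' s))
      = (G (z s) - G (z' s)) + ν s • (b (z s) - b (z' s)) := by rw [smul_sub]; abel
    rw [e]
    refine (norm_add_le _ _).trans ?_
    rw [add_mul, norm_smul, mul_assoc]
    gcongr
    · exact hL.norm_sub_le hm hm'
    · exact hν s hs.1
    · exact hL'.norm_sub_le hm hm'

/-- Global existence for `ż = G z + ν(t) b z` with `G`, `b` Lipschitz and `ν` measurable and
bounded. -/
theorem exists_solvesOn_of_lipschitzWith [CompleteSpace X] [SecondCountableTopology X] {G b : X → X}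
    {K K' : NNReal} (hG : LipschitzWith K G) (hb : LipschitzWith K' b) {ν : ℝ → ℝ}
    (hν : Measurable ν) {c : ℝ} (hc : ∀ t, |ν t| ≤ c) (z₀ : X) :
    ∃ z : ℝ → X, z 0 = z₀ ∧ Continuous z ∧
      SolvesOn (Ici 0) z fun t => G (z t) + ν t • b (z t) := by
  have hc0 : 0 ≤ c := (abs_nonneg _).trans (hc 0)
  set F : ℝ → X → X := fun s x => G x + ν s • b x with hF
  set L : ℝ := K + c * K' with hL
  have hL0 : 0 ≤ L := by positivity
  have hFL : ∀ s x x', ‖F s x - F s x'‖ ≤ L * ‖x - x'‖ := by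
    intro s x x'
    have e : F s x - F s x' = (G x - G x') + ν s • (b x - b x') := by
      rw [hF, smul_sub]; simp only; abel
    rw [e]
    refine (norm_add_le _ _).trans ?_
    rw [add_mul, norm_smul, mul_assoc]
    gcongr
    · exact hG.norm_sub_le _ _
    · exact hc s
    · exact hb.norm_sub_le _ _
  set M : ℝ := ‖G z₀‖ + c * ‖b z₀‖ with hM
  have hFM : ∀ s, ‖F s z₀‖ ≤ M := by
    intro s
    refine (norm_add_le _ _).trans ?_
    rw [norm_smul]
    exact add_le_add le_rfl (mul_le_mul_of_nonneg_right (hc s) (norm_nonneg _))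
  have hFb : ∀ s x, ‖F s x‖ ≤ M + L * ‖x - z₀‖ := by
    intro s x
    have : F s x = F s z₀ + (F s x - F s z₀) := by abel
    rw [this]
    exact (norm_add_le _ _).trans (add_le_add (hFM s) (hFL s _ _))
  have hFm : ∀ x : ℝ → X, Continuous x → ∀ a b', IntervalIntegrable (fun s => F s (x s)) volume a b' := by
    intro x hx a b'
    have hcont : Continuous fun s => M + L * ‖x s - z₀‖ := by fun_prop
    refine (hcont.intervalIntegrable a b').mono_fun ?_ ?_
    · exact ((hG.continuous.comp hx).aestronglyMeasurable).add
        (hν.aestronglyMeasurable.smul (hb.continuous.comp hx).aestronglyMeasurable)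
    · refine Eventually.of_forall fun s => ?_
      exact (hFb s (x s)).trans (le_abs_self _)
  -- Exponentially weighted norm: for curves `z₀ + exp (l s) • y s` with `y` bounded, the Picard
  -- operator has Lipschitz constant `L / l < 1 / 2`, so one contraction covers all positive times.
  -- Below, `max t 0` freezes the operator at negative times.
  set l : ℝ := 2 * L + 1 with hl
  have hl0 : 0 < l := by positivity
  let cur : BoundedContinuousFunction ℝ X → ℝ → X := fun y s => z₀ + Real.exp (l * s) • y s
  have hcur : ∀ y, Continuous (cur y) := fun y => by
    have := y.continuous
    fun_prop
  let Φ : BoundedContinuousFunction ℝ X → ℝ → X := fun y t =>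
    Real.exp (-(l * max t 0)) • ∫ s in (0 : ℝ)..max t 0, F s (cur y s)
  have hΦc : ∀ y, Continuous (Φ y) := fun y => by
    have h1 : Continuous fun r : ℝ => ∫ s in (0 : ℝ)..r, F s (cur y s) :=
      intervalIntegral.continuous_primitive (hFm _ (hcur y)) 0
    have h2 : Continuous fun t : ℝ => max t 0 := by fun_prop
    exact (by fun_prop : Continuous fun t : ℝ => Real.exp (-(l * max t 0))).smul (h1.comp h2)
  have hexp : ∀ s, 0 ≤ s → 1 ≤ Real.exp (l * s) := fun s hs => Real.one_le_exp (by positivity)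
  have hcancel : ∀ t C : ℝ, Real.exp (-(l * t)) * (C / l * Real.exp (l * t)) = C / l := by
    intro t C
    rw [mul_comm, mul_assoc, ← Real.exp_add]; simp
  have hΦb : ∀ y t, ‖Φ y t‖ ≤ (M + L * ‖y‖) / l := by
    intro y t
    have h1 := norm_integral_le_exp (v := fun s => F s (cur y s)) hl0 (le_max_right t 0)
      (C := M + L * ‖y‖) (by positivity) (by
        intro s hs
        refine (hFb s _).trans ?_
        have : ‖cur y s - z₀‖ ≤ Real.exp (l * s) * ‖y‖ := by
          simp only [cur, add_sub_cancel_left, norm_smul, Real.norm_eq_abs, Real.abs_exp]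
          gcongr
          exact y.norm_coe_le_norm s
        have h2 := mul_le_mul_of_nonneg_left this hL0
        have h3 : M ≤ M * Real.exp (l * s) := le_mul_of_one_le_right (by positivity) (hexp s hs.1)
        linarith)
    simp only [Φ, norm_smul, Real.norm_eq_abs, Real.abs_exp]
    refine (mul_le_mul_of_nonneg_left h1 (Real.exp_pos _).le).trans (hcancel _ _).le
  let Ψ : BoundedContinuousFunction ℝ X → BoundedContinuousFunction ℝ X := fun y =>
    BoundedContinuousFunction.ofNormedAddCommGroup (Φ y) (hΦc y) _ (hΦb y)
  have hΨ : ContractingWith (1 / 2) Ψ := by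
    refine ⟨by rw [← NNReal.coe_lt_coe]; norm_num, LipschitzWith.of_dist_le_mul fun y y' => ?_⟩
    rw [BoundedContinuousFunction.dist_le (by positivity)]
    intro t
    have h1 := norm_integral_le_exp (v := fun s => F s (cur y s) - F s (cur y' s)) hl0
      (le_max_right t 0) (C := L * dist y y') (by positivity) (by
        intro s hs
        refine (hFL s _ _).trans ?_
        have : ‖cur y s - cur y' s‖ ≤ Real.exp (l * s) * dist y y' := by
          simp only [cur, add_sub_add_left_eq_sub, ← smul_sub, norm_smul, Real.norm_eq_abs,
            Real.abs_exp]
          gcongr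
          rw [← dist_eq_norm]
          exact BoundedContinuousFunction.dist_coe_le_dist s
        have h2 := mul_le_mul_of_nonneg_left this hL0
        linarith)
    have h2 : Ψ y t - Ψ y' t = Real.exp (-(l * max t 0)) •
        ∫ s in (0 : ℝ)..max t 0, (F s (cur y s) - F s (cur y' s)) := by
      rw [intervalIntegral.integral_sub (hFm _ (hcur y) _ _) (hFm _ (hcur y') _ _), smul_sub]
      rfl
    rw [dist_eq_norm, h2, norm_smul, Real.norm_eq_abs, Real.abs_exp]
    refine (mul_le_mul_of_nonneg_left h1 (Real.exp_pos _).le).trans ((hcancel _ _).le.trans ?_)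
    rw [div_le_iff₀ hl0]
    have : ((1 / 2 : NNReal) : ℝ) = 1 / 2 := by norm_num
    rw [this, hl]
    nlinarith [dist_nonneg (x := y) (y := y')]
  set y := ContractingWith.fixedPoint Ψ hΨ with hy
  have hfix : Ψ y = y := hΨ.fixedPoint_isFixedPt
  have hyt : ∀ t, 0 ≤ t → cur y t = z₀ + ∫ s in (0 : ℝ)..t, F s (cur y s) := by
    intro t ht
    have h1 : y t = Φ y t := by
      conv_lhs => rw [← hfix]
      rfl
    have h2 : cur y t = z₀ + Real.exp (l * t) • y t := rfl
    rw [h2, h1]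
    simp only [Φ, max_eq_left ht, smul_smul, ← Real.exp_add]
    simp
  have hz0 : cur y 0 = z₀ := by rw [hyt 0 le_rfl]; simp
  exact ⟨cur y, hz0, hcur y, fun t ht => ⟨hFm _ (hcur y) _ _, by rw [hz0]; exact hyt t ht⟩⟩

/-- Continuous induction: a curve that cannot leave `Q` as long as it is in a neighbourhood `N` of
`Q` stays in `Q`. -/
theorem forall_mem_of_trapped {Y : Type*} [TopologicalSpace Y] {z : ℝ → Y} {s : ℝ} {Q N : Set Y}
    (hz : ContinuousOn z (Ico 0 s)) (hQ : IsClosed Q) (hN : IsOpen N) (hQN : Q ⊆ N) (h0 : z 0 ∈ Q)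
    (h : ∀ t ∈ Ico 0 s, (∀ r ∈ Icc 0 t, z r ∈ N) → ∀ r ∈ Icc 0 t, z r ∈ Q) :
    ∀ t ∈ Ico 0 s, z t ∈ Q := by
  intro T hT
  have hsub : Icc 0 T ⊆ Ico 0 s := Icc_subset_Ico_right hT.2
  have hzT := hz.mono hsub
  set A : Set ℝ := {t | ∀ r ∈ Icc 0 t, r ≤ T → z r ∈ Q} with hA
  have hcl : IsClosed (A ∩ Icc 0 T) := by
    have hpre : IsClosed (Icc 0 T ∩ z ⁻¹' Q) := hzT.preimage_isClosed_of_isClosed isClosed_Icc hQ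
    rw [← isSeqClosed_iff_isClosed]
    intro u x hu hx
    have hxT : x ∈ Icc 0 T := isClosed_Icc.mem_of_tendsto hx (Eventually.of_forall fun n => (hu n).2)
    refine ⟨fun r hr hrT => ?_, hxT⟩
    rcases eq_or_lt_of_le hr.2 with h1 | h1
    · have : x ∈ Icc 0 T ∩ z ⁻¹' Q := hpre.mem_of_tendsto hx (Eventually.of_forall fun n =>
        ⟨(hu n).2, (hu n).1 (u n) ⟨(hu n).2.1, le_rfl⟩ (hu n).2.2⟩)
      rw [h1]; exact this.2
    · obtain ⟨n, hn⟩ := (hx.eventually (lt_mem_nhds h1)).exists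
      exact (hu n).1 r ⟨hr.1, hn.le⟩ hrT
  have hsubset : Icc 0 T ⊆ A := by
    apply hcl.Icc_subset_of_forall_exists_gt
    · intro r hr _
      rw [le_antisymm hr.2 hr.1]; exact h0
    · intro x hx y hy
      -- Openness of `N` carries the curve slightly past `x` inside `N`, and `h` upgrades this to
      -- `Q`.
      have hzx : z x ∈ N := hQN (hx.1 x ⟨hx.2.1, le_rfl⟩ hx.2.2.le)
      have hnear : ∀ᶠ r in 𝓝[≥] x, z r ∈ N := by
        have hcw : ContinuousWithinAt z (Ici x) x :=
          (hzT x ⟨hx.2.1, hx.2.2.le⟩).mono_of_mem_nhdsWithin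
            (mem_of_superset (Icc_mem_nhdsGE hx.2.2) (Icc_subset_Icc_left hx.2.1))
        exact hcw (hN.mem_nhds hzx)
      obtain ⟨w, hw, hw'⟩ := (mem_nhdsGE_iff_exists_Ico_subset' (show x < min y T from
        lt_min hy hx.2.2)).1 hnear
      obtain ⟨q, hq1, hq2⟩ := exists_between (lt_min (lt_min hy hx.2.2) hw)
      have hqT : q ≤ T := (hq2.le.trans (min_le_left _ _)).trans (min_le_right _ _)
      refine ⟨q, ?_, hq1, (hq2.le.trans (min_le_left _ _)).trans (min_le_left _ _)⟩
      intro r hr _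
      refine h q (hsub ⟨hx.2.1.trans hq1.le, hqT⟩) (fun r' hr' => ?_) r hr
      rcases le_or_gt r' x with h1 | h1
      · exact hQN (hx.1 r' ⟨hr'.1, h1⟩ (hr'.2.trans hqT))
      · exact hw' ⟨h1.le, hr'.2.trans_lt (hq2.trans_le (min_le_right _ _))⟩
  exact hsubset ⟨hT.1, le_rfl⟩ T ⟨hT.1, le_rfl⟩ le_rfl

/-- Continuation: a solution that is confined to a compact subset of the domain is global. -/
theorem exists_solvesOn_of_confined [FiniteDimensional ℝ X] {Ω Q : Set X} (hΩ : IsOpen Ω)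
    {G b : X → X} (hG : LocallyLipschitzOn Ω G) (hb : LocallyLipschitzOn Ω b) {ν : ℝ → ℝ}
    (hν : Measurable ν) {c : ℝ} (hc : ∀ t, 0 ≤ t → |ν t| ≤ c) (hQ : IsCompact Q) (hQΩ : Q ⊆ Ω)
    {z₀ : X} (hz₀ : z₀ ∈ Q)
    (h : ∀ s : ℝ, 0 < s → ∀ z : ℝ → X, z 0 = z₀ →
      SolvesOn (Ico 0 s) z (fun t => G (z t) + ν t • b (z t)) → (∀ t ∈ Ico 0 s, z t ∈ Ω) →
        ∀ t ∈ Ico 0 s, z t ∈ Q) :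
    ∃ z : ℝ → X, z 0 = z₀ ∧ Continuous z ∧
      SolvesOn (Ici 0) z (fun t => G (z t) + ν t • b (z t)) ∧ ∀ t, 0 ≤ t → z t ∈ Q := by
  have : CompleteSpace X := FiniteDimensional.complete ℝ X
  have : ProperSpace X := FiniteDimensional.proper ℝ X
  have hc0 : 0 ≤ c := (abs_nonneg _).trans (hc 0 le_rfl)
  -- Extending the fields from a compact neighbourhood `Q'` of `Q` to globally Lipschitz ones gives
  -- a global curve at once, without maximal solutions. It solves the original equation while it is
  -- in `Q'`, and `h` with continuous induction confines it to `Q`.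
  obtain ⟨Q', hQ', hQQ', hQ'Ω⟩ := exists_compact_between hQ hΩ hQΩ
  obtain ⟨L, hL⟩ := (hG.mono hQ'Ω).exists_lipschitzOnWith_of_compact hQ'
  obtain ⟨L', hL'⟩ := (hb.mono hQ'Ω).exists_lipschitzOnWith_of_compact hQ'
  obtain ⟨G', hG', hGG'⟩ := hL.extend_finite_dimension
  obtain ⟨b', hb', hbb'⟩ := hL'.extend_finite_dimension
  obtain ⟨z, hz0, hzc, hz⟩ := exists_solvesOn_of_lipschitzWith hG' hb'
    (hν.indicator measurableSet_Ici) (ν := (Ici 0).indicator ν) (c := c) (by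
      intro t
      by_cases ht : t ∈ Ici (0 : ℝ)
      · rw [indicator_of_mem ht]; exact hc t ht
      · rw [indicator_of_notMem ht, abs_zero]; exact hc0) z₀
  have hcongr : ∀ J : Set ℝ, (0 : ℝ) ∈ J → J.OrdConnected → J ⊆ Ici 0 → (∀ t ∈ J, z t ∈ Q') →
      SolvesOn J z (fun t => G (z t) + ν t • b (z t)) := by
    intro J h0 hJ hJ0 hJQ
    refine (hz.mono hJ0).congr h0 hJ (fun _ _ => rfl) fun t ht => ?_
    rw [← hGG' (hJQ t ht), ← hbb' (hJQ t ht), indicator_of_mem (hJ0 ht)]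
  have hzQ : ∀ t, 0 ≤ t → z t ∈ Q := by
    intro t ht
    refine forall_mem_of_trapped (s := t + 1) hzc.continuousOn hQ.isClosed isOpen_interior hQQ'
      (hz0 ▸ hz₀) ?_ t ⟨ht, by linarith⟩
    intro r hr hrQ
    rcases eq_or_lt_of_le hr.1 with h0 | h0
    · intro r' hr'
      have : r' = 0 := le_antisymm (h0 ▸ hr'.2) hr'.1
      rw [this, hz0]; exact hz₀
    have hmain : ∀ r' ∈ Ico 0 r, z r' ∈ Q := by
      refine h r h0 z hz0 (hcongr _ ⟨le_rfl, h0⟩ ordConnected_Ico Ico_subset_Ici_self ?_) ?_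
      · exact fun r' hr' => interior_subset (hrQ r' (Ico_subset_Icc_self hr'))
      · exact fun r' hr' => hQ'Ω (interior_subset (hrQ r' (Ico_subset_Icc_self hr')))
    intro r' hr'
    have hcl : IsClosed (z ⁻¹' Q) := hQ.isClosed.preimage hzc
    have : closure (Ico 0 r) ⊆ z ⁻¹' Q := closure_minimal hmain hcl
    rw [closure_Ico h0.ne] at this
    exact this hr'
  refine ⟨z, hz0, hzc, hcongr _ self_mem_Ici ordConnected_Ici le_rfl fun t ht =>
    interior_subset (hQQ' (hzQ t ht)), hzQ⟩

/-- Bridge between the classical solutions in the stability hypotheses and the integral equation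
used elsewhere. -/
theorem isSolution_iff_solvesOn [CompleteSpace X] {Ω : Set X} {F : X → X}
    (hF : ContinuousOn F Ω) {T : ℝ} {z : ℝ → X} (hz : ∀ t ∈ Ico 0 T, z t ∈ Ω) :
    IsSolution Ω F (Ico 0 T) z ↔ SolvesOn (Ico 0 T) z (fun t => F (z t)) := by
  constructor
  · intro h
    exact solvesOn_of_hasDerivWithinAt h.1 (hF.comp h.1.continuousOn hz)
  · intro h
    exact ⟨fun t ht => h.hasDerivWithinAt (hF.comp h.continuousOn_Ico hz) ht, hz⟩

end CaratheodoryODE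

/-! ### Robustness of the region of attraction -/

section Robustness

variable {X : Type*} [NormedAddCommGroup X] [NormedSpace ℝ X]

theorem SolvesOn.shift {z v : ℝ → X} {s a : ℝ} (h : SolvesOn (Ico 0 s) z v) (ha : 0 ≤ a) :
    SolvesOn (Ico 0 (s - a)) (fun t => z (a + t)) (fun t => v (a + t)) := by
  intro t ht
  have h1 : a ∈ Ico 0 s := ⟨ha, by linarith [ht.1, ht.2]⟩
  have h2 : a + t ∈ Ico 0 s := ⟨by linarith [ht.1], by linarith [ht.2]⟩
  constructor
  · have := (h.intervalIntegrable h1 h2).comp_add_left (c := a)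
    simpa using this
  · have := h.integral_eq_sub h1 h2
    simp only [intervalIntegral.integral_comp_add_left, add_zero, this]
    abel

/-- While `z` is within `r` of `w`, both lie where `F` is Lipschitz, and Grönwall sees the
perturbation `v - F z` only through its integral. The resulting bound `ρ` is below `r`, so the tube
is never left. -/
theorem tube_bound [CompleteSpace X] {Ω K : Set X} {F : X → X} {L : NNReal} {r ρ η s : ℝ}
    (hFΩ : ContinuousOn F Ω) (hL : LipschitzOnWith L F (Metric.cthickening r K))
    {z v w : ℝ → X} (hz : SolvesOn (Ico 0 s) z v) (hzΩ : ∀ t ∈ Ico 0 s, z t ∈ Ω)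
    (hw : SolvesOn (Ico 0 s) w fun t => F (w t)) (hwK : ∀ t ∈ Ico 0 s, w t ∈ K)
    (hη0 : 0 ≤ η) (hη : ∀ t ∈ Ico 0 s, ‖∫ q in (0 : ℝ)..t, (v q - F (z q))‖ ≤ η)
    (hρ : (‖z 0 - w 0‖ + η) * Real.exp (L * s) ≤ ρ) (hρr : ρ < r) :
    ∀ t ∈ Ico 0 s, ‖z t - w t‖ ≤ ρ := by
  intro t ht
  have hs : 0 < s := ht.1.trans_lt ht.2
  have h1 : ‖z 0 - w 0‖ + η ≤ ρ :=
    (le_mul_of_one_le_right (by positivity) (Real.one_le_exp (by positivity))).trans hρ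
  have hzc := hz.continuousOn_Ico
  have hwc := hw.continuousOn_Ico
  have hmem := forall_mem_of_trapped (z := fun t => z t - w t) (s := s)
    (Q := Metric.closedBall (0 : X) ρ) (N := Metric.ball 0 r)
    (hzc.sub hwc) Metric.isClosed_closedBall Metric.isOpen_ball
    (Metric.closedBall_subset_ball hρr)
    (by rw [mem_closedBall_zero_iff]; linarith [norm_nonneg (z 0 - w 0)]) ?_ t ht
  · rwa [mem_closedBall_zero_iff] at hmem
  intro T hT hN
  have hsub : Icc 0 T ⊆ Ico 0 s := Icc_subset_Ico_right hT.2
  have hzth : ∀ q ∈ Icc 0 T, z q ∈ Metric.cthickening r K := by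
    intro q hq
    apply Metric.mem_cthickening_of_dist_le _ (w q) r K (hwK q (hsub hq))
    rw [dist_eq_norm]
    exact (mem_ball_zero_iff.1 (hN q hq)).le
  have hr0 : 0 ≤ r := by linarith [norm_nonneg (z 0 - w 0)]
  have hwth : ∀ q ∈ Icc 0 T, w q ∈ Metric.cthickening r K := fun q hq =>
    Metric.self_subset_cthickening K (hwK q (hsub hq))
  have hFz : ContinuousOn (fun q => F (z q)) (Ico 0 s) := hFΩ.comp hzc hzΩ
  have hb := norm_le_of_integral_bound (y := fun t => z t - w t)
    (w := fun q => F (z q) - F (w q)) (k := L) (c := ‖z 0 - w 0‖ + η) L.coe_nonneg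
    ((hzc.sub hwc).mono hsub) ?_ ?_
  · intro q hq
    rw [mem_closedBall_zero_iff]
    refine (hb q hq).trans (le_trans ?_ hρ)
    gcongr
    exact (hsub hq).2.le
  · intro q hq
    have hq' := hsub hq
    have hFzi : IntervalIntegrable (fun q => F (z q)) volume 0 q := by
      apply ContinuousOn.intervalIntegrable
      rw [uIcc_of_le hq.1]
      exact hFz.mono (Icc_subset_Ico_right hq'.2)
    have e : z q - w q = (z 0 - w 0) + (∫ p in (0 : ℝ)..q, (v p - F (z p)))
        + ∫ p in (0 : ℝ)..q, (F (z p) - F (w p)) := by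
      rw [intervalIntegral.integral_sub (hz q hq').1 hFzi,
        intervalIntegral.integral_sub hFzi (hw q hq').1, (hz q hq').2, (hw q hq').2]
      abel
    rw [e]
    refine (norm_add_le _ _).trans (add_le_add ((norm_add_le _ _).trans ?_) le_rfl)
    exact add_le_add le_rfl (hη q hq')
  · intro q hq
    exact hL.norm_sub_le (hzth q hq) (hwth q hq)

/-- Solutions with a small integrated perturbation shadow the unperturbed solutions that remain in
a given compact set, uniformly on bounded time intervals. -/
theorem exists_shadowing_constants [FiniteDimensional ℝ X] {Ω K : Set X} (hΩ : IsOpen Ω) {F : X → X}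
    (hF : LocallyLipschitzOn Ω F) (hK : IsCompact K) (hKΩ : K ⊆ Ω) (T : ℝ) {ρ : ℝ} (hρ : 0 < ρ) :
    ∃ d > 0, ∃ Q, IsCompact Q ∧ Q ⊆ Ω ∧ ∀ s : ℝ, ∀ z v w : ℝ → X,
      SolvesOn (Ico 0 s) z v → (∀ t ∈ Ico 0 s, z t ∈ Ω) →
      SolvesOn (Ico 0 T) w (fun t => F (w t)) → (∀ t ∈ Ico 0 T, w t ∈ K) →
      (∀ t ∈ Ico 0 s, t < T → ‖∫ q in (0 : ℝ)..t, (v q - F (z q))‖ ≤ d) → ‖z 0 - w 0‖ ≤ d →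
      ∀ t ∈ Ico 0 s, t < T → z t ∈ Q ∧ ‖z t - w t‖ ≤ ρ := by
  have : CompleteSpace X := FiniteDimensional.complete ℝ X
  have : ProperSpace X := FiniteDimensional.proper ℝ X
  obtain ⟨r, hr, hrΩ⟩ := hK.exists_cthickening_subset_open hΩ hKΩ
  have hQc : IsCompact (Metric.cthickening r K) := hK.cthickening
  obtain ⟨L, hL⟩ := (hF.mono hrΩ).exists_lipschitzOnWith_of_compact hQc
  set E := Real.exp (L * T) with hE
  have hE0 : 0 < E := Real.exp_pos _
  set ρ' := min ρ (r / 2) with hρ'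
  have hρ'0 : 0 < ρ' := lt_min hρ (by positivity)
  -- The initial gap and the integrated perturbation contribute half each of `ρ' / E`, and Grönwall
  -- multiplies their sum by at most `E`.
  refine ⟨ρ' / (2 * E), by positivity, _, hQc, hrΩ, ?_⟩
  intro s z v w hz hzΩ hw hwK hd h0 t ht htT
  have htm : t ∈ Ico 0 (min s T) := ⟨ht.1, lt_min ht.2 htT⟩
  have hb := tube_bound (s := min s T) (ρ := ρ') (η := ρ' / (2 * E)) hF.continuousOn hL
    (hz.mono (Ico_subset_Ico_right (min_le_left _ _)))
    (fun t ht => hzΩ t (Ico_subset_Ico_right (min_le_left _ _) ht))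
    (hw.mono (Ico_subset_Ico_right (min_le_right _ _)))
    (fun t ht => hwK t (Ico_subset_Ico_right (min_le_right _ _) ht)) (by positivity)
    (fun t ht => hd t (Ico_subset_Ico_right (min_le_left _ _) ht)
      (ht.2.trans_le (min_le_right _ _))) ?_
      ((min_le_right _ _).trans_lt (by linarith)) t htm
  · refine ⟨?_, hb.trans (min_le_left _ _)⟩
    apply Metric.mem_cthickening_of_dist_le _ (w t) r K (hwK t ⟨ht.1, htT⟩)
    rw [dist_eq_norm]
    exact hb.trans ((min_le_right _ _).trans (by linarith))
  · calc (‖z 0 - w 0‖ + ρ' / (2 * E)) * Real.exp (L * min s T)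
        ≤ (ρ' / (2 * E) + ρ' / (2 * E)) * E := by
          refine mul_le_mul (by linarith) (Real.exp_le_exp.2 ?_) (Real.exp_pos _).le (by positivity)
          exact mul_le_mul_of_nonneg_left (min_le_right _ _) L.coe_nonneg
      _ = ρ' := by field_simp; ring

variable {Ω A : Set X} {F : X → X}

theorem exists_solvesOn_of_confined_autonomous [FiniteDimensional ℝ X] (hΩ : IsOpen Ω)
    (hF : LocallyLipschitzOn Ω F) {Q : Set X} (hQ : IsCompact Q) (hQΩ : Q ⊆ Ω) {z₀ : X}
    (hz₀ : z₀ ∈ Q)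
    (h : ∀ s : ℝ, 0 < s → ∀ z : ℝ → X, z 0 = z₀ → IsSolution Ω F (Ico 0 s) z →
      ∀ t ∈ Ico 0 s, z t ∈ Q) :
    ∃ z : ℝ → X, z 0 = z₀ ∧ SolvesOn (Ici 0) z (fun t => F (z t)) ∧ ∀ t, 0 ≤ t → z t ∈ Q := by
  have : CompleteSpace X := FiniteDimensional.complete ℝ X
  obtain ⟨z, hz0, -, hz, hzQ⟩ := exists_solvesOn_of_confined hΩ hF
    (b := fun _ => 0) (ν := fun _ => 0) (c := 0)
    (LipschitzWith.const (0 : X)).locallyLipschitz.locallyLipschitzOn measurable_const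
    (by simp) hQ hQΩ hz₀ (by
      intro s hs z hz0 hz hzΩ
      simp only [smul_zero, add_zero] at hz
      exact h s hs z hz0 ((isSolution_iff_solvesOn hF.continuousOn hzΩ).2 hz))
  simp only [smul_zero, add_zero] at hz
  exact ⟨z, hz0, hz, hzQ⟩

/-- One step of the iteration in `exists_compact_robust`: the gain from `δ` to `δ / 2` in time `τ`
leaves room `δ / 2` for the shadowing error. -/
theorem exists_flow_near_attractor [FiniteDimensional ℝ X] (hΩ : IsOpen Ω)
    (hF : LocallyLipschitzOn Ω F) (hA : IsCompact A) (hne : A.Nonempty) (hAΩ : A ⊆ Ω)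
    (hst : UniformlyAsymptoticallyStable Ω F A) :
    ∃ δ > 0, ∃ τ > 0, ∃ K, IsCompact K ∧ K ⊆ Ω ∧ ∀ z₀, Metric.infDist z₀ A < δ →
      ∃ w : ℝ → X, w 0 = z₀ ∧ SolvesOn (Ici 0) w (fun t => F (w t)) ∧ (∀ t, 0 ≤ t → w t ∈ K) ∧
        Metric.infDist (w τ) A < δ / 2 := by
  have : CompleteSpace X := FiniteDimensional.complete ℝ X
  have : ProperSpace X := FiniteDimensional.proper ℝ X
  obtain ⟨ρ, hρ, hρΩ⟩ := hA.exists_cthickening_subset_open hΩ hAΩ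
  have hKc : IsCompact (Metric.cthickening ρ A) := hA.cthickening
  obtain ⟨δ₀, hδ₀, hstab⟩ := hst.stable ρ hρ
  obtain ⟨r, hr, hattr⟩ := hst.attractive
  set δ := min (min δ₀ r) ρ with hδ
  have hδ0 : 0 < δ := lt_min (lt_min hδ₀ hr) hρ
  have hmemK : ∀ x, Metric.infDist x A < ρ → x ∈ Metric.cthickening ρ A := by
    intro x hx
    rw [Metric.mem_cthickening_iff, ← ENNReal.ofReal_toReal (Metric.infEDist_ne_top hne)]
    exact ENNReal.ofReal_le_ofReal hx.le
  obtain ⟨τ₀, hτ₀, hτ⟩ := hattr (δ / 2) (by positivity)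
  -- The iteration needs `τ > 0`, whereas the attraction time `τ₀` may be zero.
  refine ⟨δ, hδ0, τ₀ + 1, by positivity, _, hKc, hρΩ, fun z₀ hz₀ => ?_⟩
  obtain ⟨w, hw0, hw, hwK⟩ := exists_solvesOn_of_confined_autonomous hΩ hF hKc hρΩ
    (hmemK z₀ (hz₀.trans_le (min_le_right _ _))) (by
      intro s hs z hz0 hz t ht
      refine hmemK _ (hstab s hs z hz ?_ t ht)
      rw [hz0]
      exact hz₀.trans_le ((min_le_left _ _).trans (min_le_left _ _)))
  refine ⟨w, hw0, hw, hwK, ?_⟩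
  have hsol : IsSolution Ω F (Ico 0 (τ₀ + 2)) w :=
    (isSolution_iff_solvesOn hF.continuousOn fun t ht => hρΩ (hwK t ht.1)).2
      (hw.mono Ico_subset_Ici_self)
  refine hτ (τ₀ + 2) (by linarith) w hsol ?_ (τ₀ + 1) ⟨by linarith, by linarith⟩ (by linarith)
  rw [hw0]
  exact hz₀.trans_le ((min_le_left _ _).trans (min_le_right _ _))

/-- Robustness of the region of attraction: solutions from a compact part of it remain in a compact
set under perturbations with small integrals over time windows of bounded length. -/
theorem exists_compact_robust [FiniteDimensional ℝ X] (hΩ : IsOpen Ω)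
    (hF : LocallyLipschitzOn Ω F) (hA : IsCompact A) (hne : A.Nonempty) (hAΩ : A ⊆ Ω)
    (hst : UniformlyAsymptoticallyStable Ω F A) {S : Set X} (hS : IsCompact S)
    (hSR : S ⊆ regionOfAttraction Ω F A) :
    ∃ Q, IsCompact Q ∧ Q ⊆ Ω ∧ ∃ T > 0, ∃ η > 0, ∀ s : ℝ, ∀ z v : ℝ → X,
      SolvesOn (Ico 0 s) z v → (∀ t ∈ Ico 0 s, z t ∈ Ω) → z 0 ∈ S →
      (∀ a b, 0 ≤ a → a ≤ b → b < s → b - a ≤ T → ‖∫ q in a..b, (v q - F (z q))‖ ≤ η) →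
      ∀ t ∈ Ico 0 s, z t ∈ Q := by
  have : CompleteSpace X := FiniteDimensional.complete ℝ X
  obtain ⟨δ, hδ, τ, hτ, K, hK, hKΩ, hflow⟩ := exists_flow_near_attractor hΩ hF hA hne hAΩ hst
  obtain ⟨d, hd, Q₀, hQ₀, hQ₀Ω, hshadow⟩ :=
    exists_shadowing_constants hΩ hF hK hKΩ (τ + 1) (ρ := δ / 2) (by positivity)
  have hstep : ∀ s : ℝ, ∀ z v : ℝ → X, SolvesOn (Ico 0 s) z v → (∀ t ∈ Ico 0 s, z t ∈ Ω) →
      (∀ t ∈ Ico 0 s, t < τ + 1 → ‖∫ q in (0 : ℝ)..t, (v q - F (z q))‖ ≤ d) →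
      Metric.infDist (z 0) A < δ →
      (∀ t ∈ Ico 0 s, t ≤ τ → z t ∈ Q₀) ∧ (τ < s → Metric.infDist (z τ) A < δ) := by
    intro s z v hz hzΩ hdr h0
    obtain ⟨w, hw0, hw, hwK, hwτ⟩ := hflow _ h0
    have := hshadow s z v w hz hzΩ (hw.mono Ico_subset_Ici_self) (fun t ht => hwK t ht.1) hdr
      (by rw [hw0, sub_self, norm_zero]; exact hd.le)
    refine ⟨fun t ht htτ => (this t ht (by linarith)).1, fun hs => ?_⟩
    have h1 := (this τ ⟨hτ.le, hs⟩ (by linarith)).2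
    rw [← dist_eq_norm] at h1
    linarith [Metric.infDist_le_infDist_add_dist (s := A) (x := z τ) (y := w τ)]
  -- Before the iteration can start, a trajectory from `S` must come `δ`-close to `A`. Compactness
  -- of `S` makes `Q₁`, `T₁` and `η₁` uniform, while the arrival time `t₁` may still depend on the
  -- trajectory.
  have hlocal : ∃ Q₁, IsCompact Q₁ ∧ Q₁ ⊆ Ω ∧ ∃ T₁ > 0, ∃ η₁ > 0, ∀ s : ℝ, ∀ z v : ℝ → X,
      SolvesOn (Ico 0 s) z v → (∀ t ∈ Ico 0 s, z t ∈ Ω) → z 0 ∈ S →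
      (∀ t ∈ Ico 0 s, t < T₁ → ‖∫ q in (0 : ℝ)..t, (v q - F (z q))‖ ≤ η₁) →
      ∃ t₁, 0 ≤ t₁ ∧ (∀ t ∈ Ico 0 s, t ≤ t₁ → z t ∈ Q₁) ∧
        (t₁ < s → Metric.infDist (z t₁) A < δ) := by
    refine hS.induction_on (p := fun S => ∃ Q₁, IsCompact Q₁ ∧ Q₁ ⊆ Ω ∧ ∃ T₁ > 0, ∃ η₁ > 0,
      ∀ s : ℝ, ∀ z v : ℝ → X,
      SolvesOn (Ico 0 s) z v → (∀ t ∈ Ico 0 s, z t ∈ Ω) → z 0 ∈ S →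
      (∀ t ∈ Ico 0 s, t < T₁ → ‖∫ q in (0 : ℝ)..t, (v q - F (z q))‖ ≤ η₁) →
      ∃ t₁, 0 ≤ t₁ ∧ (∀ t ∈ Ico 0 s, t ≤ t₁ → z t ∈ Q₁) ∧
        (t₁ < s → Metric.infDist (z t₁) A < δ)) ?_ ?_ ?_ ?_
    · exact ⟨∅, isCompact_empty, empty_subset _, 1, one_pos, 1, one_pos,
        fun s z v _ _ h _ => absurd h (notMem_empty _)⟩
    · rintro S S' hSS' ⟨Q₁, h1, h2, T₁, h3, η₁, h4, h⟩
      exact ⟨Q₁, h1, h2, T₁, h3, η₁, h4, fun s z v a b c => h s z v a b (hSS' c)⟩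
    · rintro S S' ⟨Q₁, h1, h2, T₁, h3, η₁, h4, h⟩ ⟨Q₁', h1', h2', T₁', h3', η₁', h4', h'⟩
      refine ⟨Q₁ ∪ Q₁', h1.union h1', union_subset h2 h2', max T₁ T₁', lt_max_of_lt_left h3,
        min η₁ η₁', lt_min h4 h4', ?_⟩
      rintro s z v a b (c | c) e
      · obtain ⟨t₁, p1, p2, p3⟩ := h s z v a b c fun t ht ht' =>
          (e t ht (ht'.trans_le (le_max_left _ _))).trans (min_le_left _ _)
        exact ⟨t₁, p1, fun t ht ht' => Or.inl (p2 t ht ht'), p3⟩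
      · obtain ⟨t₁, p1, p2, p3⟩ := h' s z v a b c fun t ht ht' =>
          (e t ht (ht'.trans_le (le_max_right _ _))).trans (min_le_right _ _)
        exact ⟨t₁, p1, fun t ht ht' => Or.inr (p2 t ht ht'), p3⟩
    · intro x hx
      obtain ⟨w, hwsol, hw0, hwt⟩ := hSR hx
      obtain ⟨T₁, hT₁, hT₁0⟩ := ((hwt.eventually (gt_mem_nhds (half_pos hδ))).and
        (eventually_ge_atTop 0)).exists
      have hwIco : SolvesOn (Ico 0 (T₁ + 1)) w fun t => F (w t) :=
        (isSolution_iff_solvesOn hF.continuousOn fun t ht => hwsol.2 t ht.1).1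
          ⟨hwsol.1.mono Ico_subset_Ici_self, fun t ht => hwsol.2 t ht.1⟩
      have hK₁ : IsCompact (w '' Icc 0 (T₁ + 1)) :=
        isCompact_Icc.image_of_continuousOn (hwsol.1.continuousOn.mono Icc_subset_Ici_self)
      have hK₁Ω : w '' Icc 0 (T₁ + 1) ⊆ Ω := by
        rintro _ ⟨t, ht, rfl⟩; exact hwsol.2 t ht.1
      obtain ⟨d₁, hd₁, Q₁, hQ₁, hQ₁Ω, hsh⟩ :=
        exists_shadowing_constants hΩ hF hK₁ hK₁Ω (T₁ + 1) (ρ := δ / 2) (by positivity)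
      refine ⟨Metric.closedBall x d₁, mem_nhdsWithin_of_mem_nhds (Metric.closedBall_mem_nhds x hd₁),
        Q₁, hQ₁, hQ₁Ω, T₁ + 1, by positivity, d₁, hd₁, ?_⟩
      intro s z v hz hzΩ hz0 hdr
      have := hsh s z v w hz hzΩ hwIco (fun t ht => ⟨t, Ico_subset_Icc_self ht, rfl⟩) hdr
        (by rw [hw0, ← dist_eq_norm]; exact hz0)
      refine ⟨T₁, hT₁0, fun t ht htT => (this t ht (by linarith)).1, fun hs => ?_⟩
      have h1 := (this T₁ ⟨hT₁0, hs⟩ (by linarith)).2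
      rw [← dist_eq_norm] at h1
      linarith [Metric.infDist_le_infDist_add_dist (s := A) (x := z T₁) (y := w T₁)]
  obtain ⟨Q₁, hQ₁, hQ₁Ω, T₁, hT₁, η₁, hη₁, hloc⟩ := hlocal
  refine ⟨Q₁ ∪ Q₀, hQ₁.union hQ₀, union_subset hQ₁Ω hQ₀Ω, max T₁ (τ + 1), lt_max_of_lt_left hT₁,
    min η₁ d, lt_min hη₁ hd, ?_⟩
  intro s z v hz hzΩ hz0 hdr t ht
  obtain ⟨t₁, ht₁, hQt₁, hδt₁⟩ := hloc s z v hz hzΩ hz0 fun t ht htT =>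
    (hdr 0 t le_rfl ht.1 ht.2 (by rw [sub_zero]; exact htT.le.trans (le_max_left _ _))).trans
      (min_le_left _ _)
  rcases le_or_gt t t₁ with h1 | h1
  · exact Or.inl (hQt₁ t ht h1)
  right
  -- Each window of length `τ` starts and ends within `δ` of `A` and stays in `Q₀` between;
  -- shadowing restarts at every window, so errors do not accumulate.
  have hiter : ∀ k : ℕ, ∀ a, 0 ≤ a → a < s → Metric.infDist (z a) A < δ → ∀ t ∈ Ico a s,
      t ≤ a + k * τ → z t ∈ Q₀ := by
    intro k
    induction k with
    | zero =>
      intro a ha has haδ t ht htk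
      have hta : t = a := le_antisymm (by simpa using htk) ht.1
      rw [hta]
      have := (hstep (s - a) (fun t => z (a + t)) (fun t => v (a + t)) (hz.shift ha)
        (fun t ht => hzΩ _ ⟨by linarith [ht.1], by linarith [ht.2]⟩) ?_ (by simpa using haδ)).1 0
        ⟨le_rfl, by linarith⟩ hτ.le
      · simpa using this
      · intro t ht htτ
        rw [intervalIntegral.integral_comp_add_left (fun q => v q - F (z q)), add_zero]
        exact (hdr a (a + t) ha (by linarith [ht.1]) (by linarith [ht.2])
          (by rw [add_sub_cancel_left]; exact htτ.le.trans (le_max_right _ _))).trans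
          (min_le_right _ _)
    | succ k ih =>
      intro a ha has haδ t ht htk
      have hst := hstep (s - a) (fun t => z (a + t)) (fun t => v (a + t)) (hz.shift ha)
        (fun t ht => hzΩ _ ⟨by linarith [ht.1], by linarith [ht.2]⟩) (by
        intro t ht htτ
        rw [intervalIntegral.integral_comp_add_left (fun q => v q - F (z q)), add_zero]
        exact (hdr a (a + t) ha (by linarith [ht.1]) (by linarith [ht.2])
          (by rw [add_sub_cancel_left]; exact htτ.le.trans (le_max_right _ _))).trans
          (min_le_right _ _)) (by simpa using haδ)
      rcases le_or_gt t (a + τ) with h2 | h2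
      · have := hst.1 (t - a) ⟨by linarith [ht.1], by linarith [ht.2]⟩ (by linarith)
        simpa using this
      · refine ih (a + τ) (by linarith) (h2.trans ht.2) (hst.2 (by linarith [ht.2])) t
          ⟨h2.le, ht.2⟩ ?_
        push_cast at htk
        linarith
  obtain ⟨k, hk⟩ := exists_nat_ge ((t - t₁) / τ)
  rw [div_le_iff₀ hτ] at hk
  exact hiter k t₁ ht₁ (h1.trans ht.2) (hδt₁ (h1.trans ht.2)) t ⟨h1.le, ht.2⟩ (by linarith)

end Robustness

/-! ### Exponential decay of matrix exponentials -/

section ExponentialDecay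

/-- If the spectrum of `exp a` lies in the open unit disc, then `exp (t a)` decays exponentially. -/
theorem exists_norm_exp_smul_le {𝔸 : Type*} [NormedRing 𝔸] [NormOneClass 𝔸] [NormedAlgebra ℂ 𝔸]
    [NormedAlgebra ℚ 𝔸] [CompleteSpace 𝔸] [Nontrivial 𝔸] (a : 𝔸)
    (h : ∀ z ∈ spectrum ℂ (NormedSpace.exp a), ‖z‖ < 1) :
    ∃ K > 0, ∃ c > 0, ∀ t : ℝ, 0 ≤ t →
      ‖NormedSpace.exp ((t : ℂ) • a)‖ ≤ K * Real.exp (-(c * t)) := by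
  -- Gelfand's formula yields `m` with `‖exp a ^ m‖ < 1`. For `t = j m + s` with `0 ≤ s ≤ m`, the
  -- `j`-th power of `exp a ^ m` gives the decay and compactness bounds `exp (s a)`.
  have hr : spectralRadius ℂ (NormedSpace.exp a) < ((1 : NNReal) : ENNReal) :=
    spectrum.spectralRadius_lt_of_forall_lt _ fun z hz => by
      rw [← NNReal.coe_lt_coe]; simpa using h z hz
  have hev := (spectrum.pow_nnnorm_pow_one_div_tendsto_nhds_spectralRadius
    (NormedSpace.exp a)).eventually (gt_mem_nhds hr)
  obtain ⟨m, hm, hm1⟩ := (hev.and (eventually_ge_atTop 1)).exists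
  have hm0 : (0 : ℝ) < m := by exact_mod_cast hm1
  have hB : ‖NormedSpace.exp a ^ m‖ < 1 := by
    rw [ENNReal.coe_one, ← ENNReal.one_rpow (1 / (m : ℝ)),
      ENNReal.rpow_lt_rpow_iff (by positivity)] at hm
    rw [← coe_nnnorm]
    exact_mod_cast hm
  -- The maximum with `1 / 2` makes `q` positive, so that `Real.log q` can serve as a rate.
  set q : ℝ := max ‖NormedSpace.exp a ^ m‖ (1 / 2) with hq
  have hq0 : 0 < q := lt_max_of_lt_right (by norm_num)
  have hq1 : q < 1 := max_lt hB (by norm_num)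
  have hlog : Real.log q < 0 := Real.log_neg hq0 hq1
  have hcont : Continuous fun s : ℝ => NormedSpace.exp ((s : ℂ) • a) := by
    have h1 : Continuous fun s : ℂ => NormedSpace.exp (s • a) := by
      rw [continuous_iff_continuousAt]
      exact fun s => (hasDerivAt_exp_smul_const (𝕂 := ℂ) a s).continuousAt
    exact h1.comp Complex.continuous_ofReal
  obtain ⟨C, hC⟩ := isCompact_Icc.exists_bound_of_continuousOn
    (hcont.continuousOn (s := Icc (0 : ℝ) m))
  have hC0 : 0 < C := by
    have := hC 0 ⟨le_rfl, hm0.le⟩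
    simp only [Complex.ofReal_zero, zero_smul, NormedSpace.exp_zero, norm_one] at this
    linarith
  refine ⟨C * q⁻¹, by positivity, -Real.log q / m, div_pos (by linarith) hm0, fun t ht => ?_⟩
  set j : ℕ := ⌊t / m⌋₊ with hj
  set s : ℝ := t - j * m with hs
  have hj1 : (j : ℝ) ≤ t / m := Nat.floor_le (by positivity)
  have hj2 : t / m < j + 1 := Nat.lt_floor_add_one _
  have hs0 : 0 ≤ s := by
    rw [le_div_iff₀ hm0] at hj1; linarith
  have hs1 : s ≤ m := by
    rw [div_lt_iff₀ hm0] at hj2; linarith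
  have hsplit : NormedSpace.exp ((t : ℂ) • a)
      = (NormedSpace.exp a ^ m) ^ j * NormedSpace.exp ((s : ℂ) • a) := by
    have e : (t : ℂ) • a = (m * j) • a + (s : ℂ) • a := by
      rw [← Nat.cast_smul_eq_nsmul ℂ (m * j) a, ← add_smul]
      congr 1
      rw [hs]; push_cast; ring
    have hcomm : Commute ((m * j) • a) ((s : ℂ) • a) :=
      ((Commute.refl a).smul_right _).smul_left _
    rw [e, NormedSpace.exp_add_of_commute hcomm, NormedSpace.exp_nsmul, pow_mul]
  rw [hsplit]
  have h1 : ‖(NormedSpace.exp a ^ m) ^ j‖ ≤ q ^ j :=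
    (norm_pow_le _ _).trans (pow_le_pow_left₀ (norm_nonneg _) (le_max_left _ _) _)
  have h2 : q ^ j ≤ q⁻¹ * Real.exp (-(-Real.log q / m * t)) := by
    have e1 : q ^ j = Real.exp (Real.log q * j) := by
      rw [mul_comm, Real.exp_nat_mul, Real.exp_log hq0]
    have e2 : q⁻¹ = Real.exp (-Real.log q) := by rw [Real.exp_neg, Real.exp_log hq0]
    rw [e1, e2, ← Real.exp_add, Real.exp_le_exp]
    have : -Real.log q + -(-Real.log q / m * t) = Real.log q * (t / m - 1) := by
      field_simp; ring
    rw [this]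
    exact mul_le_mul_of_nonpos_left (by linarith) hlog.le
  calc ‖(NormedSpace.exp a ^ m) ^ j * NormedSpace.exp ((s : ℂ) • a)‖
      ≤ q ^ j * C := (norm_mul_le _ _).trans
        (mul_le_mul h1 (hC s ⟨hs0, hs1⟩) (norm_nonneg _) (by positivity))
    _ ≤ (q⁻¹ * Real.exp (-(-Real.log q / m * t))) * C := by gcongr
    _ = _ := by ring

open scoped Matrix.Norms.Operator in
theorem exp_mulVec_of_eigenvector {n : ℕ} {A : Matrix (Fin n) (Fin n) ℂ} {l : ℂ} {v : Fin n → ℂ}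
    (h : A *ᵥ v = l • v) : NormedSpace.exp A *ᵥ v = NormedSpace.exp l • v := by
  have h1 := NormedSpace.exp_series_hasSum_exp' (𝕂 := ℂ) A
  have h2 := NormedSpace.exp_series_hasSum_exp' (𝕂 := ℂ) l
  have hpow : ∀ k : ℕ, (A ^ k) *ᵥ v = l ^ k • v := by
    intro k
    induction k with
    | zero => simp
    | succ k ih => rw [pow_succ, ← Matrix.mulVec_mulVec, h, Matrix.mulVec_smul, ih, smul_smul,
        pow_succ, mul_comm]
  let Lc : Matrix (Fin n) (Fin n) ℂ →L[ℂ] (Fin n → ℂ) :=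
    LinearMap.toContinuousLinearMap ((Matrix.mulVecBilin ℂ ℂ).flip v)
  have hLc : ∀ M, Lc M = M *ᵥ v := fun M => rfl
  have h3 := h1.mapL Lc
  have h4 := h2.smul_const v
  simp only [hLc, Matrix.smul_mulVec, hpow] at h3
  simp only [smul_eq_mul, ← smul_smul] at h4
  exact h3.unique h4

open scoped Matrix.Norms.Operator in
-- The eigenspace of `exp A` for `z` is invariant under `A`, hence contains an eigenvector of `A`,
-- with eigenvalue `l` say. On it `exp A` acts as `exp l`, so `z = exp l` and `‖z‖ = exp (re l)`.
theorem norm_lt_one_of_mem_spectrum_exp {n : ℕ} {A : Matrix (Fin n) (Fin n) ℂ}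
    (hA : ∀ (l : ℂ) (v : Fin n → ℂ), v ≠ 0 → A *ᵥ v = l • v → l.re < 0) :
    ∀ z ∈ spectrum ℂ (NormedSpace.exp A), ‖z‖ < 1 := by
  intro z hz
  rw [← Matrix.spectrum_toLin', ← Module.End.hasEigenvalue_iff_mem_spectrum] at hz
  have hcomm : Commute (Matrix.toLin' (NormedSpace.exp A)) (Matrix.toLin' A) := by
    have h1 : Commute (NormedSpace.exp A) A := (Commute.refl A).exp_left
    have h2 := congrArg Matrix.toLin' h1.eq
    rw [Matrix.toLin'_mul, Matrix.toLin'_mul] at h2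
    exact h2
  set W := Module.End.eigenspace (Matrix.toLin' (NormedSpace.exp A)) z with hW
  have hmaps : ∀ x ∈ W, Matrix.toLin' A x ∈ W :=
    Module.End.mapsTo_genEigenspace_of_comm hcomm z 1
  have hWne : Nontrivial W := by
    rw [Submodule.nontrivial_iff_ne_bot]; exact hz
  obtain ⟨l, hl⟩ := Module.End.exists_eigenvalue ((Matrix.toLin' A).restrict hmaps)
  obtain ⟨w, hw⟩ := hl.exists_hasEigenvector
  have hw1 : A *ᵥ (w : Fin n → ℂ) = l • (w : Fin n → ℂ) := by
    have := congrArg Subtype.val hw.apply_eq_smul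
    simpa [Matrix.toLin'_apply] using this
  have hw0 : (w : Fin n → ℂ) ≠ 0 := fun h => hw.2 (Subtype.ext h)
  have hw2 : NormedSpace.exp A *ᵥ (w : Fin n → ℂ) = z • (w : Fin n → ℂ) := by
    have := Module.End.mem_eigenspace_iff.1 w.2
    rwa [Matrix.toLin'_apply] at this
  rw [exp_mulVec_of_eigenvector hw1] at hw2
  have hz : NormedSpace.exp l = z := smul_left_injective ℂ hw0 hw2
  rw [← hz, ← Complex.exp_eq_exp_ℂ, Complex.norm_exp, Real.exp_lt_one_iff]
  exact hA l w hw0 hw1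

end ExponentialDecay

/-! ### The observer error matrix is Hurwitz -/

section Observer

/-- The `k`-th coordinate (counted from zero) of a vector, and zero beyond its length. -/
def coord {R : Type*} [Zero R] {n : ℕ} (v : Fin n → R) (k : ℕ) : R :=
  if h : k < n then v ⟨k, h⟩ else 0

theorem coord_of_lt {R : Type*} [Zero R] {n : ℕ} (v : Fin n → R) (i : Fin n) :
    coord v i = v i := by simp [coord]

theorem sum_ite_mul_eq_coord {R : Type*} [NonAssocSemiring R] {n : ℕ} (v : Fin n → R) (k : ℕ) :
    ∑ j : Fin n, (if (j : ℕ) = k then 1 else 0) * v j = coord v k := by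
  unfold coord
  split_ifs with h
  · rw [Finset.sum_eq_single ⟨k, h⟩]
    · simp
    · intro j _ hj
      rw [if_neg fun hjk => hj (Fin.ext hjk), zero_mul]
    · simp
  · apply Finset.sum_eq_zero
    intro j _
    rw [if_neg (by have := j.2; omega), zero_mul]

theorem Cvec_dotProduct {n : ℕ} (v : Fin n → ℝ) : Cvec n ⬝ᵥ v = coord v 0 :=
  sum_ite_mul_eq_coord v 0

/-- The matrix `A - κ C` of the observer error with unit time scale. -/
def observerMatrix {n : ℕ} (κ : Fin n → ℝ) : Matrix (Fin n) (Fin n) ℝ :=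
  Amat n - Matrix.vecMulVec κ (Cvec n)

theorem Amat_mulVec {n : ℕ} (v : Fin n → ℝ) (i : Fin n) :
    (Amat n *ᵥ v) i = coord v (i + 1) := by
  rw [← sum_ite_mul_eq_coord]; rfl

theorem observerMatrix_mulVec {n : ℕ} (κ v : Fin n → ℝ) :
    observerMatrix κ *ᵥ v = Amat n *ᵥ v - coord v 0 • κ := by
  rw [observerMatrix, Matrix.sub_mulVec, Matrix.vecMulVec_mulVec, Cvec_dotProduct]
  simp

theorem observerMatrix_map_mulVec {n : ℕ} (κ : Fin n → ℝ) (v : Fin n → ℂ) (i : Fin n) :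
    ((observerMatrix κ).map Complex.ofReal *ᵥ v) i = coord v (i + 1) - κ i * coord v 0 := by
  rw [← sum_ite_mul_eq_coord v (i + 1), ← sum_ite_mul_eq_coord v 0, Finset.mul_sum,
    ← Finset.sum_sub_distrib]
  change ∑ j, (observerMatrix κ).map Complex.ofReal i j * v j = _
  refine Finset.sum_congr rfl fun j _ => ?_
  simp only [observerMatrix, Amat, Cvec, Matrix.map_apply, Matrix.sub_apply, Matrix.of_apply,
    Matrix.vecMulVec_apply]
  split_ifs <;> push_cast <;> ring

/-- The eigenvector equation is the recursion `v (k + 1) = l * v k + κ k * v 0`, so each `v k` is `v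
0` times a Horner partial sum of the characteristic polynomial at `l`. As `coord v n = 0` and `v 0 ≠
0`, the number `l` is a root; no determinant is computed. -/
theorem re_neg_of_eigenvector {n : ℕ} {κ : Fin n → ℝ} (hκ : HurwitzCoefficients κ) (l : ℂ)
    (v : Fin n → ℂ) (hv : v ≠ 0) (h : (observerMatrix κ).map Complex.ofReal *ᵥ v = l • v) :
    l.re < 0 := by
  have hstep : ∀ k (hk : k < n), coord v (k + 1) = l * coord v k + κ ⟨k, hk⟩ * coord v 0 := by
    intro k hk
    have h1 := congrFun h ⟨k, hk⟩
    rw [observerMatrix_map_mulVec, Pi.smul_apply, ← coord_of_lt v, smul_eq_mul] at h1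
    simp only at h1
    linear_combination h1
  set κ' : ℕ → ℂ := fun i => if h : i < n then (κ ⟨i, h⟩ : ℂ) else 0 with hκ'
  have hind : ∀ k, k ≤ n → coord v k
      = (l ^ k + ∑ i ∈ Finset.range k, κ' i * l ^ (k - 1 - i)) * coord v 0 := by
    intro k
    induction k with
    | zero => simp
    | succ k ih =>
      intro hk
      rw [hstep k hk, ih (by omega), Finset.sum_range_succ]
      have e : ∑ i ∈ Finset.range k, κ' i * l ^ (k + 1 - 1 - i)
          = l * ∑ i ∈ Finset.range k, κ' i * l ^ (k - 1 - i) := by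
        rw [Finset.mul_sum]
        apply Finset.sum_congr rfl
        intro i hi
        have hi' := Finset.mem_range.1 hi
        have : k + 1 - 1 - i = (k - 1 - i) + 1 := by omega
        rw [this, pow_succ]; ring
      have e2 : κ' k = κ ⟨k, hk⟩ := by rw [hκ']; simp [Nat.lt_of_succ_le hk]
      rw [e, e2]
      simp
      ring
  have hn := hind n le_rfl
  have hvn : coord v n = 0 := by simp [coord]
  rw [hvn] at hn
  have hv0 : coord v 0 ≠ 0 := by
    intro h0
    apply hv
    ext1 i
    rw [← coord_of_lt v, hind i i.2.le, h0, mul_zero, Pi.zero_apply]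
  apply hκ
  have hp := (mul_eq_zero.1 hn.symm).resolve_right hv0
  rw [← hp, ← Fin.sum_univ_eq_sum_range (fun i => κ' i * l ^ (n - 1 - i)) n]
  simp [hκ']

/-- The flow of a linear differential equation, as a one-parameter group of matrices. -/
structure IsMatrixFlow {n : ℕ} (A : Matrix (Fin n) (Fin n) ℝ)
    (Φ : ℝ → Matrix (Fin n) (Fin n) ℝ) : Prop where
  zero : Φ 0 = 1
  add : ∀ s t, Φ (s + t) = Φ s * Φ t
  comm : ∀ t, A * Φ t = Φ t * A
  hasDerivAt : ∀ t i j, HasDerivAt (fun t => Φ t i j) ((A * Φ t) i j) t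

open scoped Matrix.Norms.Operator in
theorem isMatrixFlow_exp {n : ℕ} (A : Matrix (Fin n) (Fin n) ℝ) :
    IsMatrixFlow A fun t => NormedSpace.exp (t • A) where
  zero := by simp
  add s t := by
    rw [add_smul]
    exact Matrix.exp_add_of_commute _ _ (((Commute.refl A).smul_right _).smul_left _)
  comm t := ((Commute.refl A).smul_right t).exp_right
  hasDerivAt t i j := by
    have h := hasDerivAt_exp_smul_const' (𝕂 := ℝ) A t
    let Lc : Matrix (Fin n) (Fin n) ℝ →L[ℝ] ℝ :=
      LinearMap.toContinuousLinearMap (Matrix.entryLinearMap ℝ ℝ i j)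
    exact Lc.hasFDerivAt.comp_hasDerivAt t h

open scoped Matrix.Norms.Operator in
-- The decay is proved over `ℂ`, where the spectrum is available, and carried back to real matrices
-- by this equality.
theorem norm_map_ofReal {n : ℕ} (M : Matrix (Fin n) (Fin n) ℝ) :
    ‖M.map Complex.ofReal‖ = ‖M‖ := by
  simp [Matrix.linfty_opNorm_def]

open scoped Matrix.Norms.Operator in
/-- The unit-time-scale observer error decays exponentially. -/
theorem exists_observer_flow {n : ℕ} (hn : 1 ≤ n) {κ : Fin n → ℝ} (hκ : HurwitzCoefficients κ) :
    ∃ Φ, IsMatrixFlow (observerMatrix κ) Φ ∧ ∃ K > 0, ∃ c > 0, ∀ t, 0 ≤ t → ∀ v,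
      ‖Φ t *ᵥ v‖ ≤ K * Real.exp (-(c * t)) * ‖v‖ := by
  have : Nonempty (Fin n) := ⟨⟨0, hn⟩⟩
  obtain ⟨K, hK, c, hc, h⟩ := exists_norm_exp_smul_le ((observerMatrix κ).map Complex.ofReal)
    (norm_lt_one_of_mem_spectrum_exp (re_neg_of_eigenvector hκ))
  refine ⟨_, isMatrixFlow_exp _, K, hK, c, hc, fun t ht v => ?_⟩
  refine (Matrix.linfty_opNorm_mulVec _ _).trans ?_
  gcongr
  refine le_trans (le_of_eq ?_) (h t ht)
  rw [← norm_map_ofReal]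
  congr 1
  have hcont : Continuous (Complex.ofRealHom.mapMatrix (m := Fin n)) :=
    Continuous.matrix_map continuous_id Complex.continuous_ofReal
  have := NormedSpace.map_exp (Complex.ofRealHom.mapMatrix (m := Fin n)) hcont
    (t • observerMatrix κ)
  refine this.trans ?_
  congr 1
  ext i j
  simp

end Observer

/-! ### Observability and high-gain scaling -/

section ScaledFlow

variable {n : ℕ}

theorem coord_sub (v w : Fin n → ℝ) (k : ℕ) : coord (v - w) k = coord v k - coord w k := by
  unfold coord; split_ifs <;> simp

theorem coord_smul (a : ℝ) (v : Fin n → ℝ) (k : ℕ) : coord (a • v) k = a * coord v k := by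
  unfold coord; split_ifs <;> simp

theorem abs_coord_le (v : Fin n → ℝ) (k : ℕ) : |coord v k| ≤ ‖v‖ := by
  unfold coord
  split_ifs with h
  · exact norm_le_pi_norm v _
  · simp

theorem continuous_coord (k : ℕ) : Continuous fun v : Fin n → ℝ => coord v k := by
  unfold coord
  split_ifs with h
  · exact continuous_apply _
  · exact continuous_const

theorem IsMatrixFlow.continuous {A : Matrix (Fin n) (Fin n) ℝ} {Φ : ℝ → Matrix (Fin n) (Fin n) ℝ}
    (h : IsMatrixFlow A Φ) : Continuous Φ :=
  continuous_matrix fun i j => continuous_iff_continuousAt.2 fun t => (h.hasDerivAt t i j).continuousAt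

theorem IsMatrixFlow.mul_neg {A : Matrix (Fin n) (Fin n) ℝ} {Φ : ℝ → Matrix (Fin n) (Fin n) ℝ}
    (h : IsMatrixFlow A Φ) (t : ℝ) : Φ t * Φ (-t) = 1 := by
  rw [← h.add, add_neg_cancel, h.zero]

theorem IsMatrixFlow.neg_mul {A : Matrix (Fin n) (Fin n) ℝ} {Φ : ℝ → Matrix (Fin n) (Fin n) ℝ}
    (h : IsMatrixFlow A Φ) (t : ℝ) : Φ (-t) * Φ t = 1 := by
  rw [← h.add, neg_add_cancel, h.zero]

theorem IsMatrixFlow.hasDerivAt_mulVec {A : Matrix (Fin n) (Fin n) ℝ}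
    {Φ : ℝ → Matrix (Fin n) (Fin n) ℝ} (h : IsMatrixFlow A Φ) (u : Fin n → ℝ) (t : ℝ) :
    HasDerivAt (fun t => Φ t *ᵥ u) (A *ᵥ (Φ t *ᵥ u)) t := by
  rw [hasDerivAt_pi]
  intro i
  rw [Matrix.mulVec_mulVec]
  change HasDerivAt (fun x => ∑ j, Φ x i j * u j) (∑ j, (A * Φ t) i j * u j) t
  exact HasDerivAt.fun_sum fun j _ => (h.hasDerivAt t i j).mul_const (u j)

/-- With zero output on an interval, the derivative of coordinate `k` is coordinate `k + 1`; hence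
all coordinates vanish there, and the flow is invertible. -/
theorem IsMatrixFlow.eq_zero_of_output_eq_zero {κ : Fin n → ℝ} {Φ : ℝ → Matrix (Fin n) (Fin n) ℝ}
    (h : IsMatrixFlow (observerMatrix κ) Φ) {u : Fin n → ℝ}
    (hu : ∀ s ∈ Ioo (0 : ℝ) 1, coord (Φ s *ᵥ u) 0 = 0) : u = 0 := by
  have hk : ∀ k, ∀ s ∈ Ioo (0 : ℝ) 1, coord (Φ s *ᵥ u) k = 0 := by
    intro k
    induction k with
    | zero => exact hu
    | succ k ih =>
      intro s hs
      by_cases hkn : k < n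
      · have h1 := hasDerivAt_pi.1 (h.hasDerivAt_mulVec u s) ⟨k, hkn⟩
        have h2 : (fun t => (Φ t *ᵥ u) ⟨k, hkn⟩) =ᶠ[𝓝 s] fun _ => 0 := by
          filter_upwards [Ioo_mem_nhds hs.1 hs.2] with t ht
          have := ih t ht
          simpa [coord, hkn] using this
        have h3 := (h1.congr_of_eventuallyEq h2.symm).unique (hasDerivAt_const s (0 : ℝ))
        rw [observerMatrix_mulVec, Pi.sub_apply, Amat_mulVec, hu s hs] at h3
        simpa using h3
      · rw [coord, dif_neg (by omega)]
  have h0 : Φ (1 / 2) *ᵥ u = 0 := by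
    ext1 i
    rw [← coord_of_lt (Φ (1 / 2) *ᵥ u)]
    exact hk i _ (by norm_num)
  rw [← Matrix.one_mulVec u, ← h.neg_mul (1 / 2), ← Matrix.mulVec_mulVec, h0, Matrix.mulVec_zero]

/-- The output energy is continuous in `u` and positive on the compact unit sphere by observability;
its minimum there extends to all `u` by homogeneity of degree two. -/
theorem exists_observability_bound (hn : 1 ≤ n) {κ : Fin n → ℝ}
    {Φ : ℝ → Matrix (Fin n) (Fin n) ℝ} (h : IsMatrixFlow (observerMatrix κ) Φ) :
    ∃ l > 0, ∀ u, l * ‖u‖ ^ 2 ≤ ∫ s in (0 : ℝ)..1, coord (Φ s *ᵥ u) 0 ^ 2 := by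
  have : Nonempty (Fin n) := ⟨⟨0, hn⟩⟩
  have hjoint : Continuous fun p : (Fin n → ℝ) × ℝ => coord (Φ p.2 *ᵥ p.1) 0 ^ 2 := by
    have h1 : Continuous fun p : (Fin n → ℝ) × ℝ => Φ p.2 *ᵥ p.1 :=
      (h.continuous.comp continuous_snd).matrix_mulVec continuous_fst
    exact ((continuous_coord 0).comp h1).pow 2
  have hqc : Continuous fun u => ∫ s in (0 : ℝ)..1, coord (Φ s *ᵥ u) 0 ^ 2 :=
    intervalIntegral.continuous_parametric_intervalIntegral_of_continuous' hjoint 0 1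
  obtain ⟨u₀, hu₀, hmin⟩ := (isCompact_sphere (0 : Fin n → ℝ) 1).exists_isMinOn
    (NormedSpace.sphere_nonempty.2 zero_le_one) hqc.continuousOn
  have hu₀n : ‖u₀‖ = 1 := by simpa using hu₀
  have hcont : ∀ u, Continuous fun s => coord (Φ s *ᵥ u) 0 ^ 2 := fun u =>
    hjoint.comp (continuous_const.prodMk continuous_id)
  have hpos : 0 < ∫ s in (0 : ℝ)..1, coord (Φ s *ᵥ u₀) 0 ^ 2 := by
    refine intervalIntegral.integral_pos one_pos (hcont u₀).continuousOn
      (fun s _ => sq_nonneg _) ?_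
    by_contra! hle
    have h0 : u₀ = 0 := h.eq_zero_of_output_eq_zero fun s hs =>
      pow_eq_zero_iff two_ne_zero |>.1 ((hle s (Ioo_subset_Icc_self hs)).antisymm (sq_nonneg _))
    rw [h0, norm_zero] at hu₀n
    exact zero_ne_one hu₀n
  refine ⟨_, hpos, fun u => ?_⟩
  rcases eq_or_ne u 0 with rfl | hu
  · simp [coord]
  · have hun : ‖u‖ ≠ 0 := norm_ne_zero_iff.2 hu
    have hmem : ‖u‖⁻¹ • u ∈ Metric.sphere (0 : Fin n → ℝ) 1 := by
      rw [mem_sphere_zero_iff_norm, norm_smul, norm_inv, norm_norm, inv_mul_cancel₀ hun]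
    have h1 : ∀ s, coord (Φ s *ᵥ (‖u‖⁻¹ • u)) 0 ^ 2 = (‖u‖⁻¹) ^ 2 * coord (Φ s *ᵥ u) 0 ^ 2 := by
      intro s
      rw [Matrix.mulVec_smul, coord_smul, mul_pow]
    have h2 := hmin hmem
    simp only [mem_ofPred_eq, h1, intervalIntegral.integral_const_mul] at h2
    calc _ ≤ ((‖u‖⁻¹) ^ 2 * ∫ s in (0 : ℝ)..1, coord (Φ s *ᵥ u) 0 ^ 2) * ‖u‖ ^ 2 := by gcongr
      _ = _ := by field_simp

/-- The weights `εⁱ` that balance the high-gain observer. -/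
def balance (ε : ℝ) (v : Fin n → ℝ) : Fin n → ℝ := fun i => ε ^ (i : ℕ) * v i

/-- The matrix `A - H C` of the observer error. -/
def gainMatrix (κ : Fin n → ℝ) (ε : ℝ) : Matrix (Fin n) (Fin n) ℝ :=
  Amat n - Matrix.vecMulVec (gainH κ ε) (Cvec n)

theorem gainMatrix_mulVec (κ : Fin n → ℝ) (ε : ℝ) (v : Fin n → ℝ) :
    gainMatrix κ ε *ᵥ v = Amat n *ᵥ v - coord v 0 • gainH κ ε := by
  rw [gainMatrix, Matrix.sub_mulVec, Matrix.vecMulVec_mulVec, Cvec_dotProduct]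
  simp

theorem norm_balance_le {ε : ℝ} (h0 : 0 ≤ ε) (h1 : ε ≤ 1) (v : Fin n → ℝ) :
    ‖balance ε v‖ ≤ ‖v‖ := by
  refine (pi_norm_le_iff_of_nonneg (norm_nonneg _)).2 fun i => ?_
  rw [balance, norm_mul, norm_pow, Real.norm_of_nonneg h0]
  exact (mul_le_of_le_one_left (norm_nonneg _) (pow_le_one₀ h0 h1)).trans (norm_le_pi_norm v i)

theorem balance_add (ε : ℝ) (v w : Fin n → ℝ) : balance ε (v + w) = balance ε v + balance ε w := by
  ext i; simp [balance, mul_add]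

/-- The flow of the high-gain observer error, with estimates that are uniform in `ε`. -/
structure IsHighGainFlow (κ : Fin n → ℝ) (ε K c l : ℝ) (Φ : ℝ → Matrix (Fin n) (Fin n) ℝ) :
    Prop where
  flow : IsMatrixFlow (gainMatrix κ ε) Φ
  bound : ∀ t, 0 ≤ t → ∀ v,
    ‖Φ t *ᵥ v‖ ≤ K * Real.exp (-(c / ε * t)) * ‖balance ε v‖ / ε ^ (n - 1)
  output_bound : ∀ t, 0 ≤ t → ∀ v,
    |coord (Φ t *ᵥ v) 0| ≤ K * Real.exp (-(c / ε * t)) * ‖balance ε v‖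
  observable : ∀ t, ε ≤ t → ∀ v,
    ε * l * ‖balance ε v‖ ^ 2 ≤ ∫ s in (0 : ℝ)..t, coord (Φ s *ᵥ v) 0 ^ 2

theorem exists_isHighGainFlow (hn : 1 ≤ n) {κ : Fin n → ℝ} (hκ : HurwitzCoefficients κ) :
    ∃ K > 0, ∃ c > 0, ∃ l > 0, ∀ ε, 0 < ε → ε ≤ 1 → ∃ Φ, IsHighGainFlow κ ε K c l Φ := by
  obtain ⟨Φ, hΦ, K, hK, c, hc, hb⟩ := exists_observer_flow hn hκ
  obtain ⟨l, hl, hobs⟩ := exists_observability_bound hn hΦ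
  refine ⟨K, hK, c, hc, l, hl, fun ε hε hε1 => ?_⟩
  -- With `S = diag (εⁱ)`, the matrix `A - H C` equals `ε⁻¹ S⁻¹ (A - κ C) S`, whence `Ψ t = S⁻¹ Φ (t
  -- / ε) S` and constants independent of `ε`. The factor `S⁻¹` costs `ε ^ (n - 1)` in the state
  -- bound but nothing in the output, the unscaled first coordinate.
  let Ψ : ℝ → Matrix (Fin n) (Fin n) ℝ := fun t =>
    Matrix.of fun i j => (ε ^ (i : ℕ))⁻¹ * Φ (t / ε) i j * ε ^ (j : ℕ)
  have hp : ∀ k : ℕ, ε ^ k ≠ 0 := fun k => pow_ne_zero k hε.ne'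
  have hΨv : ∀ t v i, (Ψ t *ᵥ v) i = (ε ^ (i : ℕ))⁻¹ * (Φ (t / ε) *ᵥ balance ε v) i := by
    intro t v i
    simp only [Matrix.mulVec, dotProduct, Ψ, Matrix.of_apply, balance, Finset.mul_sum]
    exact Finset.sum_congr rfl fun j _ => by ring
  have hAent : ∀ i j, gainMatrix κ ε i j
      = (ε ^ (i : ℕ))⁻¹ * observerMatrix κ i j * ε ^ (j : ℕ) * ε⁻¹ := by
    intro i j
    simp only [gainMatrix, observerMatrix, Amat, Cvec, gainH, Matrix.sub_apply, Matrix.of_apply,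
      Matrix.vecMulVec_apply]
    have hi := hp i
    by_cases h1 : (j : ℕ) = i + 1
    · have h2 : (j : ℕ) ≠ 0 := by omega
      rw [if_pos h1, if_neg h2, h1]
      field_simp
      ring
    · rw [if_neg h1]
      by_cases h2 : (j : ℕ) = 0
      · rw [if_pos h2, h2]
        field_simp
        ring
      · rw [if_neg h2]; simp
  have hmul : ∀ (M N : Matrix (Fin n) (Fin n) ℝ) (i j : Fin n),
      ∑ k : Fin n, ((ε ^ (i : ℕ))⁻¹ * M i k * ε ^ (k : ℕ)) * ((ε ^ (k : ℕ))⁻¹ * N k j * ε ^ (j : ℕ))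
        = (ε ^ (i : ℕ))⁻¹ * (M * N) i j * ε ^ (j : ℕ) := by
    intro M N i j
    rw [Matrix.mul_apply, Finset.mul_sum, Finset.sum_mul]
    refine Finset.sum_congr rfl fun k _ => ?_
    have := hp k
    field_simp
  have hAΨ : ∀ t i j, (gainMatrix κ ε * Ψ t) i j
      = (ε ^ (i : ℕ))⁻¹ * (observerMatrix κ * Φ (t / ε)) i j * ε ^ (j : ℕ) * ε⁻¹ := by
    intro t i j
    rw [← hmul, Matrix.mul_apply, Finset.sum_mul]
    refine Finset.sum_congr rfl fun k _ => ?_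
    rw [hAent]
    simp only [Ψ, Matrix.of_apply]
    ring
  have hflow : IsMatrixFlow (gainMatrix κ ε) Ψ := by
    refine ⟨?_, fun s t => ?_, fun t => ?_, fun t i j => ?_⟩
    · ext i j
      simp only [Ψ, Matrix.of_apply, zero_div, hΦ.zero, Matrix.one_apply]
      have := hp i
      split_ifs with hij
      · subst hij; field_simp
      · simp
    · ext i j
      rw [Matrix.mul_apply]
      simp only [Ψ, Matrix.of_apply]
      rw [hmul, add_div, hΦ.add]
    · ext i j
      rw [hAΨ, hΦ.comm, ← hmul, Matrix.mul_apply, Finset.sum_mul]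
      refine Finset.sum_congr rfl fun k _ => ?_
      rw [hAent]
      simp only [Ψ, Matrix.of_apply]
      ring
    · rw [hAΨ]
      have h1 := (hΦ.hasDerivAt (t / ε) i j).scomp t ((hasDerivAt_id t).div_const ε)
      have h2 := (h1.const_mul ((ε ^ (i : ℕ))⁻¹)).mul_const (ε ^ (j : ℕ))
      refine h2.congr_deriv ?_
      simp only [smul_eq_mul]
      ring
  have hout : ∀ t v, coord (Ψ t *ᵥ v) 0 = coord (Φ (t / ε) *ᵥ balance ε v) 0 := by
    intro t v
    have h0 : 0 < n := hn
    simp only [coord, h0, dif_pos, hΨv]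
    simp
  have hexp : ∀ t, Real.exp (-(c * (t / ε))) = Real.exp (-(c / ε * t)) := fun t => by
    congr 1; ring
  refine ⟨Ψ, hflow, fun t ht v => ?_, fun t ht v => ?_, fun t ht v => ?_⟩
  · have h1 := hb (t / ε) (by positivity) (balance ε v)
    rw [hexp] at h1
    refine (pi_norm_le_iff_of_nonneg (by positivity)).2 fun i => ?_
    rw [hΨv, norm_mul, norm_inv, norm_pow, Real.norm_of_nonneg hε.le, inv_mul_eq_div]
    refine div_le_div₀ (by positivity) ((norm_le_pi_norm _ i).trans h1) (by positivity) ?_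
    exact pow_le_pow_of_le_one hε.le hε1 (by have := i.2; omega)
  · have h1 := hb (t / ε) (by positivity) (balance ε v)
    rw [hexp] at h1
    rw [hout]
    exact (abs_coord_le _ _).trans h1
  · simp only [hout]
    rw [intervalIntegral.integral_comp_div (fun s => coord (Φ s *ᵥ balance ε v) 0 ^ 2) hε.ne',
      zero_div, smul_eq_mul, mul_assoc]
    refine mul_le_mul_of_nonneg_left ((hobs _).trans ?_) hε.le
    have hcont : Continuous fun s => coord (Φ s *ᵥ balance ε v) 0 ^ 2 :=
      ((continuous_coord 0).comp (hΦ.continuous.matrix_mulVec continuous_const)).pow 2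
    refine intervalIntegral.integral_mono_interval le_rfl zero_le_one ?_ ?_
      (hcont.intervalIntegrable _ _)
    · rwa [le_div_iff₀ hε, one_mul]
    · exact Eventually.of_forall fun s => sq_nonneg _

end ScaledFlow

/-! ### Variation of constants and the forced part of the error -/

section LinearEstimates

variable {n : ℕ}

theorem solvesOn_mulVec {m k : ℕ} {T : ℝ} {M M' : ℝ → Matrix (Fin m) (Fin k) ℝ}
    {z v : ℝ → Fin k → ℝ}
    (hM : ∀ i j, SolvesOn (Icc 0 T) (fun t => M t i j) (fun t => M' t i j))
    (hz : SolvesOn (Icc 0 T) z v) :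
    SolvesOn (Icc 0 T) (fun t => M t *ᵥ z t) (fun t => M' t *ᵥ z t + M t *ᵥ v t) := by
  refine solvesOn_pi fun i => ?_
  have := SolvesOn.sum Finset.univ fun j _ => (hM i j).mul (hz.apply j)
  simp only [Finset.sum_add_distrib] at this
  exact this

/-- Integrating factor: the product rule cancels the linear term, also when the forcing is merely
integrable. -/
theorem IsMatrixFlow.solvesOn_neg_mulVec {A : Matrix (Fin n) (Fin n) ℝ}
    {Φ : ℝ → Matrix (Fin n) (Fin n) ℝ} (h : IsMatrixFlow A Φ) {T : ℝ} {y r : ℝ → Fin n → ℝ}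
    (hy : SolvesOn (Icc 0 T) y fun t => A *ᵥ y t + r t) :
    SolvesOn (Icc 0 T) (fun t => Φ (-t) *ᵥ y t) fun t => Φ (-t) *ᵥ r t := by
  have hM : ∀ i j, SolvesOn (Icc 0 T) (fun t => Φ (-t) i j) (fun t => (-(Φ (-t) * A)) i j) := by
    intro i j
    apply solvesOn_of_hasDerivAt
    · intro t
      have h1 := (h.hasDerivAt (-t) i j).scomp t (hasDerivAt_neg t)
      refine h1.congr_deriv ?_
      rw [h.comm, Matrix.neg_apply, neg_one_smul]
    · exact (((h.continuous.comp continuous_neg).matrix_mul continuous_const).neg).matrix_elem i j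
  have := solvesOn_mulVec hM hy
  convert this using 2 with t
  rw [Matrix.neg_mulVec, Matrix.mulVec_add, Matrix.mulVec_mulVec]
  abel

theorem IsMatrixFlow.variation_of_constants {A : Matrix (Fin n) (Fin n) ℝ}
    {Φ : ℝ → Matrix (Fin n) (Fin n) ℝ} (h : IsMatrixFlow A Φ) {T : ℝ} (hT : 0 ≤ T)
    {y r : ℝ → Fin n → ℝ} (hy : SolvesOn (Icc 0 T) y fun t => A *ᵥ y t + r t) :
    y T - Φ T *ᵥ y 0 = ∫ s in (0 : ℝ)..T, Φ (T - s) *ᵥ r s := by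
  have h1 := h.solvesOn_neg_mulVec hy T ⟨hT, le_rfl⟩
  have h2 := congrArg (fun v => Φ T *ᵥ v) h1.2
  simp only [neg_zero, h.zero, Matrix.one_mulVec, Matrix.mulVec_mulVec, h.mul_neg,
    Matrix.mulVec_add] at h2
  let Lc : (Fin n → ℝ) →L[ℝ] (Fin n → ℝ) := LinearMap.toContinuousLinearMap (Φ T).mulVecLin
  have hLc : ∀ v, Lc v = Φ T *ᵥ v := fun v => rfl
  have h3 := Lc.intervalIntegral_comp_comm h1.1
  simp only [hLc, Matrix.mulVec_mulVec, ← h.add, ← sub_eq_add_neg] at h3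
  rw [h2, h3]
  abel

/-- The kernel `exp (-(c / ε) (T - s))` has integral at most `ε / c`, uniformly in `T`. -/
theorem IsHighGainFlow.norm_sub_le {κ : Fin n → ℝ} {ε K c l : ℝ}
    {Φ : ℝ → Matrix (Fin n) (Fin n) ℝ} (h : IsHighGainFlow κ ε K c l Φ) (hε : 0 < ε) (hK : 0 < K)
    (hc : 0 < c) {T R : ℝ} (hT : 0 ≤ T) {y r : ℝ → Fin n → ℝ}
    (hy : SolvesOn (Icc 0 T) y fun t => gainMatrix κ ε *ᵥ y t + r t) (hR0 : 0 ≤ R)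
    (hR : ∀ t ∈ Icc 0 T, ‖balance ε (r t)‖ ≤ R) :
    ‖y T - Φ T *ᵥ y 0‖ ≤ K * R * ε / (c * ε ^ (n - 1)) := by
  rw [h.flow.variation_of_constants hT hy]
  have h1 := norm_integral_le_exp (v := fun s => Φ (T - s) *ᵥ r s) (l := c / ε)
    (C := K * R / ε ^ (n - 1) * Real.exp (-(c / ε * T))) (by positivity) hT (by positivity) (by
      intro s hs
      refine (h.bound (T - s) (by linarith [hs.2]) (r s)).trans ?_
      have e : Real.exp (-(c / ε * (T - s)))
          = Real.exp (-(c / ε * T)) * Real.exp (c / ε * s) := by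
        rw [← Real.exp_add]; congr 1; ring
      rw [e]
      calc K * (Real.exp (-(c / ε * T)) * Real.exp (c / ε * s)) * ‖balance ε (r s)‖ / ε ^ (n - 1)
          ≤ K * (Real.exp (-(c / ε * T)) * Real.exp (c / ε * s)) * R / ε ^ (n - 1) := by
            gcongr; exact hR s hs
        _ = _ := by ring)
  refine h1.trans (le_of_eq ?_)
  have e : Real.exp (-(c / ε * T)) * Real.exp (c / ε * T) = 1 := by
    rw [← Real.exp_add]; simp
  calc _ = K * R / ε ^ (n - 1) / (c / ε) * (Real.exp (-(c / ε * T)) * Real.exp (c / ε * T)) := by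
        ring
    _ = _ := by rw [e]; field_simp

theorem integral_exp_neg_mul_le {l T : ℝ} (hl : 0 < l) :
    ∫ s in (0 : ℝ)..T, Real.exp (-(l * s)) ≤ 1 / l := by
  have h : ∫ s in (0 : ℝ)..T, Real.exp (-(l * s))
      = -Real.exp (-(l * T)) / l - -Real.exp (-(l * 0)) / l := by
    apply intervalIntegral.integral_eq_sub_of_hasDerivAt
    · intro x _
      have := (((hasDerivAt_id x).const_mul l).neg.exp.neg).div_const l
      refine this.congr_deriv ?_
      simp only [id, mul_one, Pi.neg_apply]
      field_simp
    · exact (by fun_prop : Continuous fun s : ℝ => Real.exp (-(l * s))).intervalIntegrable _ _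
  rw [h]
  have : 0 < Real.exp (-(l * T)) / l := by positivity
  simp only [mul_zero, neg_zero, Real.exp_zero, neg_div]
  linarith

theorem balance_gainH {κ : Fin n → ℝ} {ε : ℝ} (hε : 0 < ε) :
    balance ε (gainH κ ε) = ε⁻¹ • κ := by
  ext i
  simp only [balance, gainH, Pi.smul_apply, smul_eq_mul]
  field_simp
  ring

theorem balance_Bvec (ε : ℝ) : balance ε (Bvec n) = ε ^ (n - 1) • Bvec n := by
  ext i
  simp only [balance, Bvec, Pi.smul_apply, smul_eq_mul]
  split_ifs with h
  · have : n - 1 = i := by omega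
    rw [this]
  · simp

theorem balance_smul (ε a : ℝ) (v : Fin n → ℝ) : balance ε (a • v) = a • balance ε v := by
  ext i; simp [balance]; ring

theorem norm_Bvec_le : ‖Bvec n‖ ≤ 1 := by
  refine (pi_norm_le_iff_of_nonneg zero_le_one).2 fun i => ?_
  unfold Bvec
  split_ifs <;> simp

/-- The scaling acts oppositely on the two disturbances: the nonlinearity sits in the last
coordinate, with weight `ε ^ (n - 1)`, while the noise enters through the gain, which becomes `ε⁻¹
κ`. -/
theorem norm_balance_disturbance_le {κ : Fin n → ℝ} {ε φ ν cf νs : ℝ} (hε : 0 < ε)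
    (hφ : |φ| ≤ cf) (hν : |ν| ≤ νs) :
    ‖balance ε (φ • Bvec n - ν • gainH κ ε)‖ ≤ cf * ε ^ (n - 1) + νs * ‖κ‖ / ε := by
  have e : balance ε (φ • Bvec n - ν • gainH κ ε)
      = φ • (ε ^ (n - 1) • Bvec n) + (-ν) • (ε⁻¹ • κ) := by
    rw [sub_eq_add_neg, ← neg_smul, balance_add, balance_smul, balance_smul, balance_gainH hε,
      balance_Bvec]
  rw [e]
  refine (norm_add_le _ _).trans (add_le_add ?_ ?_)
  · rw [norm_smul, norm_smul, Real.norm_eq_abs, Real.norm_of_nonneg (by positivity)]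
    exact mul_le_mul hφ (mul_le_of_le_one_right (by positivity) norm_Bvec_le) (by positivity)
      ((abs_nonneg _).trans hφ)
  · rw [norm_smul, norm_smul, Real.norm_eq_abs, abs_neg, norm_inv, Real.norm_of_nonneg hε.le,
      inv_mul_eq_div, ← mul_div_assoc]
    gcongr

end LinearEstimates

/-! ### The covariance of the least-squares law and its inverse -/

section LeastSquares

variable {M : ℕ}

/-- The inverse `γ⁻¹ I + ∫ e eᵀ` of the covariance matrix of the least-squares law. -/
def information (γ : ℝ) (e : ℝ → Fin M → ℝ) (t : ℝ) : Matrix (Fin M) (Fin M) ℝ :=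
  Matrix.of fun i j => (γ⁻¹ • (1 : Matrix (Fin M) (Fin M) ℝ)) i j + ∫ s in (0 : ℝ)..t, e s i * e s j

theorem solvesOn_information (γ : ℝ) {e : ℝ → Fin M → ℝ} (he : Continuous e) (J : Set ℝ)
    (i j : Fin M) : SolvesOn J (fun t => information γ e t i j)
      (fun t => Matrix.vecMulVec (e t) (e t) i j) := by
  intro t _
  have hc : Continuous fun s => e s i * e s j := by fun_prop
  refine ⟨hc.intervalIntegrable _ _, ?_⟩
  simp [information, Matrix.vecMulVec_apply]

theorem information_zero (γ : ℝ) (e : ℝ → Fin M → ℝ) :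
    information γ e 0 = γ⁻¹ • (1 : Matrix (Fin M) (Fin M) ℝ) := by
  ext i j; simp [information]

theorem abs_dotProduct_le (v w : Fin M → ℝ) : |v ⬝ᵥ w| ≤ (∑ i, |v i|) * ‖w‖ := by
  rw [dotProduct, Finset.sum_mul]
  refine (Finset.abs_sum_le_sum_abs _ _).trans (Finset.sum_le_sum fun i _ => ?_)
  rw [abs_mul]
  exact mul_le_mul_of_nonneg_left (norm_le_pi_norm w i) (abs_nonneg _)

/-- With `Λ` the information matrix, `P Λ - 1` solves the homogeneous linear equation `X' = -P e eᵀ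
X` with `X(0) = 0`, so it vanishes. The uniqueness argument is run column by column. -/
theorem information_mul_covariance {γ T : ℝ} (hγ : 0 < γ) {e : ℝ → Fin M → ℝ} (he : Continuous e)
    {P : ℝ → Matrix (Fin M) (Fin M) ℝ} (hP0 : P 0 = γ • (1 : Matrix (Fin M) (Fin M) ℝ))
    (hP : ∀ i j, SolvesOn (Icc 0 T) (fun t => P t i j)
      fun t => -(P t * Matrix.vecMulVec (e t) (e t) * P t) i j) {t : ℝ} (ht : t ∈ Icc 0 T) :
    information γ e t * P t = 1 := by
  rw [mul_eq_one_comm]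
  obtain ⟨k, hk⟩ := isCompact_Icc.exists_bound_of_continuousOn (s := Icc 0 T)
    (f := fun t => (∑ i, |e t i|) • (P t *ᵥ e t)) (by
      apply ContinuousOn.fun_smul
      · fun_prop
      · apply continuousOn_pi.2
        intro i
        change ContinuousOn (fun t => ∑ j, P t i j * e t j) (Icc 0 T)
        refine continuousOn_finsetSum _ fun j _ => ?_
        exact (hP i j).continuousOn_Icc.mul (by fun_prop))
  have hk0 : 0 ≤ k := (norm_nonneg _).trans (hk t ht)
  ext i j
  set b : Fin M → ℝ := Pi.single j 1 with hb
  have hcol := solvesOn_pi fun i => solvesOn_information γ he (Icc 0 T) i j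
  have h1 := solvesOn_mulVec (M' := fun t => -(P t * Matrix.vecMulVec (e t) (e t) * P t)) hP hcol
  have hcst : SolvesOn (Icc 0 T) (fun _ : ℝ => b) (fun _ => 0) := fun t _ => ⟨by simp, by simp⟩
  have h2 := h1.sub hcst
  have h3 := h2.eq_zero hk0 ?_ ?_ t ht
  · have := congrFun (sub_eq_zero.1 h3) i
    rw [hb] at this
    rw [Matrix.one_apply]
    refine Eq.trans ?_ (this.trans (Pi.single_apply _ _ _))
    rfl
  · ext i
    simp only [Pi.sub_apply, Pi.zero_apply, hb, information_zero, hP0, Pi.single_apply,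
      Matrix.smul_mulVec, Matrix.one_mulVec, Pi.smul_apply, Matrix.smul_apply, Matrix.one_apply,
      smul_eq_mul]
    split_ifs <;> field_simp <;> simp
  · intro s hs
    set q : Fin M → ℝ := fun i => information γ e s i j with hq
    have e1 : (fun i => Matrix.vecMulVec (e s) (e s) i j) = e s j • e s := by
      ext i; simp [Matrix.vecMulVec_apply, mul_comm]
    have e2 : (-(P s * Matrix.vecMulVec (e s) (e s) * P s)) *ᵥ q + P s *ᵥ (e s j • e s) - 0
        = -(e s ⬝ᵥ (P s *ᵥ q - b)) • (P s *ᵥ e s) := by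
      rw [sub_zero, Matrix.neg_mulVec, ← Matrix.mulVec_mulVec, ← Matrix.mulVec_mulVec,
        Matrix.vecMulVec_mulVec, dotProduct_sub, hb, dotProduct_single]
      ext i
      simp [Matrix.mulVec_smul]
      ring
    rw [e1, e2, norm_smul, norm_neg, Real.norm_eq_abs]
    have h4 := hk s hs
    rw [norm_smul, Real.norm_of_nonneg (Finset.sum_nonneg fun i _ => abs_nonneg _)] at h4
    calc _ ≤ ((∑ i, |e s i|) * ‖P s *ᵥ q - b‖) * ‖P s *ᵥ e s‖ := by
          gcongr; exact abs_dotProduct_le _ _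
      _ = ((∑ i, |e s i|) * ‖P s *ᵥ e s‖) * ‖P s *ᵥ q - b‖ := by ring
      _ ≤ _ := by gcongr

/-- The integral part contributes `∫ (e · v)² ≥ 0`. This floor `γ⁻¹` is what later bounds the
entries of `P`. -/
theorem dotProduct_information_nonneg {γ t : ℝ} {e : ℝ → Fin M → ℝ} (he : Continuous e)
    (ht : 0 ≤ t) (v : Fin M → ℝ) :
    γ⁻¹ * (v ⬝ᵥ v) ≤ v ⬝ᵥ (information γ e t *ᵥ v) := by
  have hcst : SolvesOn (Icc 0 t) (fun _ : ℝ => v) (fun _ => 0) := fun t _ => ⟨by simp, by simp⟩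
  have h1 := solvesOn_mulVec (M' := fun t => Matrix.vecMulVec (e t) (e t))
    (solvesOn_information γ he (Icc 0 t)) hcst
  have h2 := h1.clm (LinearMap.toContinuousLinearMap (dotProductBilin ℝ ℝ v))
  have h3 := (h2 t ⟨ht, le_rfl⟩).2
  have hd : ∀ w, (LinearMap.toContinuousLinearMap (dotProductBilin ℝ ℝ v)) w = v ⬝ᵥ w :=
    fun w => rfl
  simp only [hd, information_zero, Matrix.smul_mulVec, Matrix.one_mulVec, dotProduct_smul,
    smul_eq_mul, Matrix.mulVec_zero, add_zero, Matrix.vecMulVec_mulVec, op_smul_eq_smul] at h3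
  rw [h3]
  have : 0 ≤ ∫ s in (0 : ℝ)..t, (e s ⬝ᵥ v) * (v ⬝ᵥ e s) := by
    refine intervalIntegral.integral_nonneg ht fun s _ => ?_
    rw [dotProduct_comm v]
    exact mul_self_nonneg _
  linarith

theorem sq_norm_le_dotProduct_self (v : Fin M → ℝ) : ‖v‖ ^ 2 ≤ v ⬝ᵥ v := by
  have h0 : 0 ≤ v ⬝ᵥ v := dotProduct_self_star_nonneg v
  rw [← Real.sqrt_le_sqrt_iff h0, Real.sqrt_sq (norm_nonneg _)]
  refine (pi_norm_le_iff_of_nonneg (Real.sqrt_nonneg _)).2 fun i => ?_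
  apply Real.le_sqrt_of_sq_le
  rw [Real.norm_eq_abs, sq_abs, sq]
  exact Finset.single_le_sum (f := fun i => v i * v i) (fun i _ => mul_self_nonneg _)
    (Finset.mem_univ i)

end LeastSquares

/-! ### Estimation error and bounds on the loop signals -/

section LoopEstimates

variable {n p M : ℕ}

theorem LoopState.estimate_eq (z : LoopState n p M) :
    z.estimate = z.xhat (Fin.last M) - z.Emat *ᵥ z.βbar := by
  ext k
  simp only [LoopState.estimate, LoopState.weights, Fin.sum_univ_castSucc, Fin.snoc_castSucc,
    Fin.snoc_last, Finset.sum_apply, Pi.smul_apply, Pi.sub_apply, smul_eq_mul,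
    Matrix.mulVec, dotProduct, LoopState.Emat, Matrix.of_apply]
  simp only [sub_mul, Finset.sum_sub_distrib, ← Finset.mul_sum, one_mul]
  rw [Finset.sum_congr rfl fun i _ => mul_comm (z.βbar i) (z.xhat i.castSucc k)]
  ring

variable {D : Set (Fin n → ℝ)} {Θ : Set (Fin p → ℝ)} {f : (Fin n → ℝ) → ℝ → ℝ}
  {g : (Fin n → ℝ) → (Fin p → ℝ) → ℝ} {h : (Fin n → ℝ) → (Fin p → ℝ) → (Fin p → ℝ)}
  {κ : Fin n → ℝ} {ε : ℝ} {ν : ℝ → ℝ} {T : ℝ} {z : ℝ → LoopState n p M}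

theorem IsLoopSolution.mono {J J' : Set ℝ} (hz : IsLoopSolution D Θ f g h κ ε ν J z)
    (hJ : J' ⊆ J) : IsLoopSolution D Θ f g h κ ε ν J' z where
  mem_domain t ht := hz.mem_domain t (hJ ht)
  plant := hz.plant.mono hJ
  controller := hz.controller.mono hJ
  observers i := (hz.observers i).mono hJ
  weights := hz.weights.mono hJ
  covariance i j := (hz.covariance i j).mono hJ

theorem IsLoopSolution.solvesOn_error (hz : IsLoopSolution D Θ f g h κ ε ν (Icc 0 T) z)
    (hT : 0 ≤ T) (i : Fin (M + 1)) :
    SolvesOn (Icc 0 T) (fun t => (z t).x - (z t).xhat i) fun t =>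
      gainMatrix κ ε *ᵥ ((z t).x - (z t).xhat i)
        + (f (z t).x (g (z t).estimate (z t).θ) • Bvec n - ν t • gainH κ ε) := by
  refine (hz.plant.sub (hz.observers i)).congr ⟨le_rfl, hT⟩ ordConnected_Icc (fun _ _ => rfl)
    fun t _ => ?_
  rw [gainMatrix_mulVec, Cvec_dotProduct, Cvec_dotProduct, coord_sub, Matrix.mulVec_sub]
  module

/-- All observers are driven by the same output, so plant, nonlinearity and noise cancel in their
differences. -/
theorem IsLoopSolution.Emat_eq (hz : IsLoopSolution D Θ f g h κ ε ν (Icc 0 T) z) (hT : 0 ≤ T)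
    {Φ : ℝ → Matrix (Fin n) (Fin n) ℝ} (hΦ : IsMatrixFlow (gainMatrix κ ε) Φ) :
    (z T).Emat = Φ T * (z 0).Emat := by
  ext k i
  have h1 : SolvesOn (Icc 0 T) (fun t => (z t).xhat (Fin.last M) - (z t).xhat i.castSucc) fun t =>
      gainMatrix κ ε *ᵥ ((z t).xhat (Fin.last M) - (z t).xhat i.castSucc) + 0 := by
    refine ((hz.observers (Fin.last M)).sub (hz.observers i.castSucc)).congr ⟨le_rfl, hT⟩
      ordConnected_Icc (fun _ _ => rfl) fun t _ => ?_
    rw [gainMatrix_mulVec, Cvec_dotProduct, Cvec_dotProduct, Cvec_dotProduct, coord_sub,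
      Matrix.mulVec_sub]
    module
  have h2 := hΦ.variation_of_constants hT h1
  simp only [Matrix.mulVec_zero, intervalIntegral.integral_zero, sub_eq_zero] at h2
  exact congrFun h2 k

/-- The bound on the observer error that is due to the plant nonlinearity (bounded by `cf`) and to
the noise (bounded by `νs`). -/
def disturbanceBound (κ : Fin n → ℝ) (ε K c cf νs : ℝ) : ℝ :=
  K * (cf * ε ^ (n - 1) + νs * ‖κ‖ / ε) * ε / (c * ε ^ (n - 1))

theorem disturbanceBound_eq {κ : Fin n → ℝ} {ε K c cf νs : ℝ} (hε : 0 < ε) :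
    disturbanceBound κ ε K c cf νs = K / c * (cf * ε + νs * ‖κ‖ / ε ^ (n - 1)) := by
  unfold disturbanceBound
  field_simp

variable {K c l cf νs γ : ℝ} {Φ : ℝ → Matrix (Fin n) (Fin n) ℝ}

theorem IsLoopSolution.norm_error_sub_le (hz : IsLoopSolution D Θ f g h κ ε ν (Icc 0 T) z)
    (hT : 0 ≤ T) (hΦ : IsHighGainFlow κ ε K c l Φ) (hε : 0 < ε) (hK : 0 < K) (hc : 0 < c)
    (hf : ∀ t ∈ Icc 0 T, |f (z t).x (g (z t).estimate (z t).θ)| ≤ cf)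
    (hν : ∀ t ∈ Icc 0 T, |ν t| ≤ νs) (i : Fin (M + 1)) :
    ‖(z T).x - (z T).xhat i - Φ T *ᵥ ((z 0).x - (z 0).xhat i)‖
      ≤ disturbanceBound κ ε K c cf νs := by
  have h0 : (0 : ℝ) ∈ Icc 0 T := ⟨le_rfl, hT⟩
  have hcf : 0 ≤ cf := (abs_nonneg _).trans (hf 0 h0)
  have hνs : 0 ≤ νs := (abs_nonneg _).trans (hν 0 h0)
  exact hΦ.norm_sub_le hε hK hc hT (hz.solvesOn_error hT i) (by positivity) fun t ht =>
    norm_balance_disturbance_le hε (hf t ht) (hν t ht)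

/-- Since `E(T) = Φ(T) E(0)`, a change of the weights acts like a change of the initial error; what
remains is the forced part of the last observer's error, free of weights. -/
theorem IsLoopSolution.error_estimate_eq (hz : IsLoopSolution D Θ f g h κ ε ν (Icc 0 T) z)
    (hT : 0 ≤ T) (hΦ : IsMatrixFlow (gainMatrix κ ε) Φ) :
    (z T).x - (z T).estimate - Φ T *ᵥ ((z 0).x - (z 0).estimate
        + (z 0).Emat *ᵥ ((z T).βbar - (z 0).βbar))
      = (z T).x - (z T).xhat (Fin.last M)
        - Φ T *ᵥ ((z 0).x - (z 0).xhat (Fin.last M)) := by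
  rw [LoopState.estimate_eq, LoopState.estimate_eq, hz.Emat_eq hT hΦ, ← Matrix.mulVec_mulVec]
  simp only [Matrix.mulVec_sub, Matrix.mulVec_add]
  abel

/-- The energy estimate for the least-squares law. -/
theorem IsLoopSolution.weights_energy_le (hz : IsLoopSolution D Θ f g h κ ε ν (Icc 0 T) z)
    (hT : 0 ≤ T) (hΦ : IsHighGainFlow κ ε K c l Φ) (hε : 0 < ε) (hε1 : ε ≤ 1) (hK : 0 < K)
    (hc : 0 < c) (hγ : 0 < γ) (hP : (z 0).P = γ • (1 : Matrix (Fin M) (Fin M) ℝ))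
    (hf : ∀ t ∈ Icc 0 T, |f (z t).x (g (z t).estimate (z t).θ)| ≤ cf)
    (hν : ∀ t ∈ Icc 0 T, |ν t| ≤ νs) {δ : Fin M → ℝ} (hδ : δ = (z T).βbar - (z 0).βbar)
    {u : Fin n → ℝ} (hu : u = (z 0).Emat *ᵥ δ) :
    γ⁻¹ * (δ ⬝ᵥ δ) + ∫ s in (0 : ℝ)..T, coord (Φ s *ᵥ u) 0 ^ 2
      ≤ (K * ‖(z 0).x - (z 0).estimate‖ + disturbanceBound κ ε K c cf νs + νs) * K
        * (ε / c) * ‖balance ε u‖ := by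
  have h0 : (0 : ℝ) ∈ Icc 0 T := ⟨le_rfl, hT⟩
  have hTT : T ∈ Icc 0 T := ⟨hT, le_rfl⟩
  set m := K * ‖(z 0).x - (z 0).estimate‖ + disturbanceBound κ ε K c cf νs + νs with hm
  have hsub : ∀ t ∈ Icc 0 T, Icc 0 t ⊆ Icc 0 T := fun t ht => Icc_subset_Icc_right ht.2
  set e : ℝ → Fin M → ℝ := fun s => (Cvec n ᵥ* Φ s) ᵥ* (z 0).Emat with he
  have hec : Continuous e :=
    ((continuous_const.matrix_vecMul hΦ.flow.continuous).matrix_vecMul continuous_const)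
  have hedot : ∀ s v, e s ⬝ᵥ v = coord (Φ s *ᵥ ((z 0).Emat *ᵥ v)) 0 := by
    intro s v
    rw [he, ← Matrix.dotProduct_mulVec, ← Matrix.dotProduct_mulVec, Cvec_dotProduct]
  have hCE : ∀ t ∈ Icc 0 T, (z t).CE = e t := by
    intro t ht
    rw [LoopState.CE, (hz.mono (hsub t ht)).Emat_eq ht.1 hΦ.flow, ← Matrix.vecMul_vecMul]
  have hinv : ∀ t ∈ Icc 0 T, information γ e t * (z t).P = 1 := by
    intro t ht
    refine information_mul_covariance (P := fun t => (z t).P) (T := T) hγ hec hP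
      (fun i j => ?_) ht
    refine (hz.covariance i j).congr h0 ordConnected_Icc (fun _ _ => rfl) fun s hs => ?_
    rw [hCE s hs]
  set Y : ℝ → ℝ := fun t =>
    (Cvec n ⬝ᵥ (z t).x + ν t) - Cvec n ⬝ᵥ (z t).xhat (Fin.last M) with hY
  -- With `Λ` the information matrix, `(Λ β̄)' = e eᵀ β̄ - (Y + eᵀ β̄) Λ P e`, which collapses to
  -- `-Y e` because `Λ P = 1`.
  have h1 : SolvesOn (Icc 0 T) (fun t => information γ e t *ᵥ (z t).βbar)
      (fun t => -(Y t • e t)) := by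
    refine (solvesOn_mulVec (M' := fun t => Matrix.vecMulVec (e t) (e t))
      (solvesOn_information γ hec (Icc 0 T)) hz.weights).congr h0 ordConnected_Icc
      (fun _ _ => rfl) fun t ht => ?_
    rw [hCE t ht, Matrix.mulVec_neg, Matrix.mulVec_smul, Matrix.mulVec_mulVec, hinv t ht,
      Matrix.one_mulVec, Matrix.vecMulVec_mulVec, op_smul_eq_smul]
    module
  -- Comparison with the frozen final weights: `Λ(t) (β̄(T) - β̄(t))` is zero at `T` and `γ⁻¹ δ` at
  -- `0`. Pairing with `δ` gives the energy identity.
  have hcst : SolvesOn (Icc 0 T) (fun _ : ℝ => (z T).βbar) (fun _ => 0) :=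
    fun t _ => ⟨by simp, by simp⟩
  have h2 := solvesOn_mulVec (M' := fun t => Matrix.vecMulVec (e t) (e t))
    (solvesOn_information γ hec (Icc 0 T)) hcst
  have h3 := ((h2.sub h1).clm (LinearMap.toContinuousLinearMap (dotProductBilin ℝ ℝ δ))) T hTT
  have hd : ∀ w, (LinearMap.toContinuousLinearMap (dotProductBilin ℝ ℝ δ)) w = δ ⬝ᵥ w :=
    fun w => rfl
  set a : ℝ → ℝ := fun s => coord (Φ s *ᵥ u) 0 with ha
  have hac : Continuous a :=
    (continuous_coord 0).comp (hΦ.flow.continuous.matrix_mulVec continuous_const)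
  have haδ : ∀ s, δ ⬝ᵥ e s = a s := fun s => by rw [dotProduct_comm, hedot, ha, hu]
  simp only [hd, Matrix.mulVec_zero, add_zero, Matrix.vecMulVec_mulVec, op_smul_eq_smul,
    sub_neg_eq_add, ← add_smul, dotProduct_smul, smul_eq_mul, haδ, sub_self, dotProduct_zero,
    information_zero, Matrix.smul_mulVec, Matrix.one_mulVec, ← smul_sub, ← hδ] at h3
  -- Subtracting `a` exchanges the final weights for the initial ones. The residual of the latter
  -- involves only the initial combined error, the forced part and the noise, not the single
  -- observers.
  have hξ : ∀ s ∈ Icc 0 T, |(e s ⬝ᵥ (z T).βbar + Y s) - a s| ≤ m := by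
    intro s hs
    have e1 : (e s ⬝ᵥ (z T).βbar + Y s) - a s
        = coord (Φ s *ᵥ ((z 0).x - (z 0).estimate)) 0
          + coord ((z s).x - (z s).xhat (Fin.last M)
            - Φ s *ᵥ ((z 0).x - (z 0).xhat (Fin.last M))) 0 + ν s := by
      rw [← haδ, dotProduct_comm δ, hδ, dotProduct_sub, hedot s (z 0).βbar, LoopState.estimate_eq,
        hY]
      simp only [Cvec_dotProduct, coord_sub, Matrix.mulVec_sub]
      ring
    rw [e1, hm]
    refine (abs_add_le _ _).trans (add_le_add ((abs_add_le _ _).trans (add_le_add ?_ ?_)) (hν s hs))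
    · refine (hΦ.output_bound s hs.1 _).trans ?_
      have : Real.exp (-(c / ε * s)) ≤ 1 :=
        Real.exp_le_one_iff.2 (neg_nonpos.2 (mul_nonneg (by positivity) hs.1))
      calc _ ≤ K * 1 * ‖(z 0).x - (z 0).estimate‖ := by
            gcongr
            exact norm_balance_le hε.le hε1 _
        _ = _ := by ring
    · exact (abs_coord_le _ _).trans ((hz.mono (hsub s hs)).norm_error_sub_le hs.1 hΦ hε hK hc
        (fun t ht => hf t (hsub s hs ht)) (fun t ht => hν t (hsub s hs ht)) _)
  have ha2 : IntervalIntegrable (fun s => a s ^ 2) volume 0 T :=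
    (hac.pow 2).intervalIntegrable _ _
  have h4 : γ⁻¹ * (δ ⬝ᵥ δ) + ∫ s in (0 : ℝ)..T, a s ^ 2
      = -∫ s in (0 : ℝ)..T, ((e s ⬝ᵥ (z T).βbar + Y s) * a s - a s ^ 2) := by
    rw [intervalIntegral.integral_sub h3.1 ha2]
    linarith [h3.2]
  rw [h4]
  have h5 : ‖∫ s in (0 : ℝ)..T, ((e s ⬝ᵥ (z T).βbar + Y s) * a s - a s ^ 2)‖
      ≤ ∫ s in (0 : ℝ)..T, m * K * ‖balance ε u‖ * Real.exp (-(c / ε * s)) := by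
    refine intervalIntegral.norm_integral_le_of_norm_le hT (Eventually.of_forall fun s hs => ?_)
      ((by fun_prop : Continuous fun s : ℝ =>
        m * K * ‖balance ε u‖ * Real.exp (-(c / ε * s))).intervalIntegrable _ _)
    have hs' : s ∈ Icc 0 T := Ioc_subset_Icc_self hs
    have e2 : (e s ⬝ᵥ (z T).βbar + Y s) * a s - a s ^ 2
        = ((e s ⬝ᵥ (z T).βbar + Y s) - a s) * a s := by ring
    rw [e2, Real.norm_eq_abs, abs_mul]
    calc _ ≤ m * (K * Real.exp (-(c / ε * s)) * ‖balance ε u‖) :=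
          mul_le_mul (hξ s hs') (hΦ.output_bound s hs'.1 u) (abs_nonneg _)
            ((abs_nonneg _).trans (hξ s hs'))
      _ = _ := by ring
  have hm0 : 0 ≤ m := (abs_nonneg _).trans (hξ 0 h0)
  rw [intervalIntegral.integral_const_mul] at h5
  have h6 := integral_exp_neg_mul_le (T := T) (show 0 < c / ε by positivity)
  calc _ ≤ ‖∫ s in (0 : ℝ)..T, ((e s ⬝ᵥ (z T).βbar + Y s) * a s - a s ^ 2)‖ := neg_le_abs _
    _ ≤ _ := h5
    _ ≤ m * K * ‖balance ε u‖ * (1 / (c / ε)) := by gcongr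
    _ = _ := by rw [one_div_div]; ring

/-- After time `ε`, the error of the combined estimate is governed by the exponential decay of the
high-gain observer, uniformly in the initial states of the single observers. -/
theorem IsLoopSolution.norm_error_estimate_le (hz : IsLoopSolution D Θ f g h κ ε ν (Icc 0 T) z)
    (hΦ : IsHighGainFlow κ ε K c l Φ) (hε : 0 < ε) (hε1 : ε ≤ 1) (hεT : ε ≤ T) (hK : 0 < K)
    (hc : 0 < c) (hl : 0 < l) (hγ : 0 < γ) (hP : (z 0).P = γ • (1 : Matrix (Fin M) (Fin M) ℝ))
    (hf : ∀ t ∈ Icc 0 T, |f (z t).x (g (z t).estimate (z t).θ)| ≤ cf)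
    (hν : ∀ t ∈ Icc 0 T, |ν t| ≤ νs) :
    ‖(z T).x - (z T).estimate‖
      ≤ K * Real.exp (-(c / ε * T)) / ε ^ (n - 1) * (‖(z 0).x - (z 0).estimate‖
        + (K * ‖(z 0).x - (z 0).estimate‖ + disturbanceBound κ ε K c cf νs + νs) * K / (c * l))
        + disturbanceBound κ ε K c cf νs := by
  have hT : 0 ≤ T := hε.le.trans hεT
  set δ := (z T).βbar - (z 0).βbar with hδ
  set u := (z 0).Emat *ᵥ δ with hu
  have h1 := hz.weights_energy_le hT hΦ hε hε1 hK hc hγ hP hf hν hδ hu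
  set m := K * ‖(z 0).x - (z 0).estimate‖ + disturbanceBound κ ε K c cf νs + νs with hm
  have h2 := hΦ.observable T hεT u
  have h3 : 0 ≤ γ⁻¹ * (δ ⬝ᵥ δ) := mul_nonneg (by positivity) (dotProduct_self_star_nonneg δ)
  have hW := hz.norm_error_sub_le hT hΦ hε hK hc hf hν (Fin.last M)
  have hW0 : 0 ≤ disturbanceBound κ ε K c cf νs := (norm_nonneg _).trans hW
  have hνs : 0 ≤ νs := (abs_nonneg _).trans (hν 0 ⟨le_rfl, hT⟩)
  -- Observability, available since `ε ≤ T`, turns the energy estimate into a quadratic-below-linear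
  -- inequality; the factor `ε` cancels, and neither `γ` nor `E(0)` survives in the bound.
  have hub : ‖balance ε u‖ ≤ m * K / (c * l) := by
    rcases eq_or_lt_of_le (norm_nonneg (balance ε u)) with h0 | h0
    · rw [← h0]; positivity
    · have h4 : ε * l * ‖balance ε u‖ * ‖balance ε u‖ ≤ m * K * (ε / c) * ‖balance ε u‖ := by
        nlinarith
      have h5 := le_of_mul_le_mul_right h4 h0
      rw [le_div_iff₀ (by positivity)]
      have h6 : ε * (‖balance ε u‖ * (c * l)) ≤ ε * (m * K) := by
        calc _ = c * (ε * l * ‖balance ε u‖) := by ring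
          _ ≤ c * (m * K * (ε / c)) := by gcongr
          _ = _ := by field_simp
      exact le_of_mul_le_mul_left h6 hε
  have h7 := hz.error_estimate_eq hT hΦ.flow
  rw [← hδ, ← hu] at h7
  rw [← h7] at hW
  have h8 := hΦ.bound T hT ((z 0).x - (z 0).estimate + u)
  rw [balance_add] at h8
  calc ‖(z T).x - (z T).estimate‖
      ≤ ‖Φ T *ᵥ ((z 0).x - (z 0).estimate + u)‖
        + ‖(z T).x - (z T).estimate - Φ T *ᵥ ((z 0).x - (z 0).estimate + u)‖ :=
        norm_le_norm_add_norm_sub' _ _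
    _ ≤ K * Real.exp (-(c / ε * T)) * (‖(z 0).x - (z 0).estimate‖ + m * K / (c * l)) / ε ^ (n - 1)
        + disturbanceBound κ ε K c cf νs := by
        refine add_le_add (h8.trans ?_) hW
        gcongr
        exact (norm_add_le _ _).trans (add_le_add (norm_balance_le hε.le hε1 _) hub)
    _ = _ := by ring

theorem exists_norm_mulVec_le {m k : ℕ} (E : Matrix (Fin m) (Fin k) ℝ) :
    ∃ c > 0, ∀ v, ‖E *ᵥ v‖ ≤ c * ‖v‖ := by
  let L : (Fin k → ℝ) →L[ℝ] (Fin m → ℝ) := LinearMap.toContinuousLinearMap E.mulVecLin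
  refine ⟨‖L‖ + 1, by positivity, fun v => (L.le_opNorm v).trans ?_⟩
  gcongr
  linarith

/-- All the signals of the loop other than `x` and `θ` are bounded by constants that depend on the
initial values and on bounds on `f` and the noise only. -/
theorem exists_loop_bounds (hn : IsHighGainFlow κ ε K c l Φ) (hε : 0 < ε) (hε1 : ε ≤ 1)
    (hK : 0 < K) (hc : 0 < c) (hγ : 0 < γ) (hcf : 0 ≤ cf) (hνs : 0 ≤ νs) (z₀ : LoopState n p M)
    (hP : z₀.P = γ • (1 : Matrix (Fin M) (Fin M) ℝ)) (rx : ℝ) :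
    ∃ R, ∀ T, 0 ≤ T → ∀ z : ℝ → LoopState n p M, z 0 = z₀ →
      IsLoopSolution D Θ f g h κ ε ν (Icc 0 T) z →
      (∀ t ∈ Icc 0 T, |f (z t).x (g (z t).estimate (z t).θ)| ≤ cf) →
      (∀ t ∈ Icc 0 T, |ν t| ≤ νs) → ‖(z T).x‖ ≤ rx →
      ‖(z T).xhat‖ ≤ R ∧ ‖(z T).βbar‖ ≤ R ∧ ∀ i j, |(z T).P i j| ≤ R := by
  obtain ⟨E, hE, hE'⟩ := exists_norm_mulVec_le z₀.Emat
  set W := disturbanceBound κ ε K c cf νs with hW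
  have hW0 : 0 ≤ W := by unfold W disturbanceBound; positivity
  set m := K * ‖z₀.x - z₀.estimate‖ + W + νs with hm
  have hm0 : 0 ≤ m := by positivity
  set Rx := |rx| + (K * (‖z₀.x‖ + ‖z₀.xhat‖) / ε ^ (n - 1) + W) with hRx
  set Rβ := ‖z₀.βbar‖ + γ * (m * K * (ε / c) * E) with hRβ
  refine ⟨max Rx (max Rβ (γ * M)), fun T hT z hz0 hz hf hν hx => ⟨?_, ?_, fun i j => ?_⟩⟩
  · refine le_trans ((pi_norm_le_iff_of_nonneg (by positivity)).2 fun i => ?_) (le_max_left _ _)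
    have h1 := hz.norm_error_sub_le hT hn hε hK hc hf hν i
    have h2 := hn.bound T hT ((z 0).x - (z 0).xhat i)
    have h3 : ‖balance ε ((z 0).x - (z 0).xhat i)‖ ≤ ‖z₀.x‖ + ‖z₀.xhat‖ := by
      rw [hz0]
      exact (norm_balance_le hε.le hε1 _).trans ((norm_sub_le _ _).trans
        (add_le_add le_rfl (norm_le_pi_norm _ i)))
    have h4 : Real.exp (-(c / ε * T)) ≤ 1 :=
      Real.exp_le_one_iff.2 (neg_nonpos.2 (mul_nonneg (by positivity) hT))
    have h5 : ‖Φ T *ᵥ ((z 0).x - (z 0).xhat i)‖ ≤ K * (‖z₀.x‖ + ‖z₀.xhat‖) / ε ^ (n - 1) := by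
      refine h2.trans ?_
      calc _ ≤ K * 1 * (‖z₀.x‖ + ‖z₀.xhat‖) / ε ^ (n - 1) := by gcongr
        _ = _ := by ring
    have e : (z T).xhat i = (z T).x - (Φ T *ᵥ ((z 0).x - (z 0).xhat i)
        + ((z T).x - (z T).xhat i - Φ T *ᵥ ((z 0).x - (z 0).xhat i))) := by abel
    rw [e]
    exact (norm_sub_le _ _).trans (add_le_add (hx.trans (le_abs_self _))
      ((norm_add_le _ _).trans (add_le_add h5 h1)))
  · refine le_trans ?_ ((le_max_left _ _).trans (le_max_right _ _))
    set δ := (z T).βbar - (z 0).βbar with hδ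
    have h1 := hz.weights_energy_le hT hn hε hε1 hK hc hγ (by rw [hz0, hP]) hf hν hδ rfl
    rw [hz0] at h1
    have h2 : 0 ≤ ∫ s in (0 : ℝ)..T, coord (Φ s *ᵥ (z₀.Emat *ᵥ δ)) 0 ^ 2 :=
      intervalIntegral.integral_nonneg hT fun s _ => sq_nonneg _
    -- The integral controls only `E(0) δ`, so the weights themselves are bounded through the `γ⁻¹`
    -- term, at the price of a constant that depends on `E(0)`.
    have h3 : γ⁻¹ * ‖δ‖ ^ 2 ≤ m * K * (ε / c) * (E * ‖δ‖) := by
      calc γ⁻¹ * ‖δ‖ ^ 2 ≤ γ⁻¹ * (δ ⬝ᵥ δ) := by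
            gcongr; exact sq_norm_le_dotProduct_self δ
        _ ≤ m * K * (ε / c) * ‖balance ε (z₀.Emat *ᵥ δ)‖ := by linarith
        _ ≤ _ := by
            gcongr
            exact (norm_balance_le hε.le hε1 _).trans (hE' δ)
    have h4 : ‖δ‖ ≤ γ * (m * K * (ε / c) * E) := by
      rcases eq_or_lt_of_le (norm_nonneg δ) with h0 | h0
      · rw [← h0]; positivity
      · have h5 : (γ⁻¹ * ‖δ‖) * ‖δ‖ ≤ (m * K * (ε / c) * E) * ‖δ‖ := by linarith
        have h6 := le_of_mul_le_mul_right h5 h0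
        rwa [inv_mul_le_iff₀ hγ] at h6
    have e : (z T).βbar = z₀.βbar + δ := by rw [hδ, hz0]; abel
    rw [e]
    exact (norm_add_le _ _).trans (add_le_add le_rfl h4)
  · refine le_trans ?_ ((le_max_right _ _).trans (le_max_right _ _))
    set e : ℝ → Fin M → ℝ := fun s => (Cvec n ᵥ* Φ s) ᵥ* (z 0).Emat with he
    have hec : Continuous e :=
      ((continuous_const.matrix_vecMul hn.flow.continuous).matrix_vecMul continuous_const)
    have hinv : information γ e T * (z T).P = 1 := by
      refine information_mul_covariance (P := fun t => (z t).P) (T := T) hγ hec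
        (by simp only [hz0, hP]) (fun i j => ?_) ⟨hT, le_rfl⟩
      refine (hz.covariance i j).congr ⟨le_rfl, hT⟩ ordConnected_Icc (fun _ _ => rfl)
        fun s hs => ?_
      rw [LoopState.CE, (hz.mono (Icc_subset_Icc_right hs.2)).Emat_eq hs.1 hn.flow,
        ← Matrix.vecMul_vecMul]
    set b : Fin M → ℝ := Pi.single j 1 with hb
    -- For a column `y = P b` one has `Λ y = b`, hence `γ⁻¹ ‖y‖² ≤ y · Λ y = y j ≤ ‖y‖` and `‖y‖ ≤
    -- γ`.
    set y := (z T).P *ᵥ b with hy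
    have hyi : (z T).P i j = y i := by rw [hy, hb, Matrix.mulVec_single_one]; rfl
    have h1 := dotProduct_information_nonneg (γ := γ) hec hT y
    have h2 : information γ e T *ᵥ y = b := by
      rw [hy, Matrix.mulVec_mulVec, hinv, Matrix.one_mulVec]
    rw [h2] at h1
    have h3 : y ⬝ᵥ b ≤ ‖y‖ := by
      rw [hb, dotProduct_single, mul_one]
      exact (le_abs_self _).trans (norm_le_pi_norm y j)
    have h4 := sq_norm_le_dotProduct_self y
    have h5 : ‖y‖ ≤ γ := by
      rcases eq_or_lt_of_le (norm_nonneg y) with h0 | h0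
      · rw [← h0]; exact hγ.le
      · have h6 : γ⁻¹ * ‖y‖ ^ 2 ≤ ‖y‖ :=
          (mul_le_mul_of_nonneg_left h4 (by positivity)).trans (h1.trans h3)
        have h7 : (γ⁻¹ * ‖y‖) * ‖y‖ ≤ 1 * ‖y‖ := by linarith
        have h8 := le_of_mul_le_mul_right h7 h0
        rwa [inv_mul_le_iff₀ hγ, mul_one] at h8
    rw [hyi]
    have hM : (1 : ℝ) ≤ M := by exact_mod_cast (Nat.one_le_of_lt i.2)
    exact (norm_le_pi_norm y i).trans (h5.trans (le_mul_of_one_le_right hγ.le hM))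

end LoopEstimates

/-! ### Local Lipschitz continuity of composites -/

section LocallyLipschitz

theorem locallyLipschitzOn_comp {α β γ : Type*} [PseudoEMetricSpace α] [PseudoEMetricSpace β]
    [PseudoEMetricSpace γ] {f : β → γ} {g : α → β} {s : Set α} {t : Set β}
    (hf : LocallyLipschitzOn t f) (hg : LocallyLipschitzOn s g) (hst : MapsTo g s t) :
    LocallyLipschitzOn s (fun x => f (g x)) := by
  intro x hx
  obtain ⟨K, u, hu, hK⟩ := hf (hst hx)
  obtain ⟨K', v, hv, hK'⟩ := hg hx
  have h1 : Tendsto g (𝓝[s] x) (𝓝[t] (g x)) := (hg.continuousOn x hx).tendsto_nhdsWithin hst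
  exact ⟨K * K', v ∩ g ⁻¹' u, inter_mem hv (h1 hu), (hK.comp (hK'.mono inter_subset_left)
    fun y hy => hy.2)⟩

theorem locallyLipschitzOn_prodMk {α β γ : Type*} [PseudoEMetricSpace α] [PseudoEMetricSpace β]
    [PseudoEMetricSpace γ] {f : α → β} {g : α → γ} {s : Set α}
    (hf : LocallyLipschitzOn s f) (hg : LocallyLipschitzOn s g) :
    LocallyLipschitzOn s (fun x => (f x, g x)) := by
  intro x hx
  obtain ⟨K, u, hu, hK⟩ := hf hx
  obtain ⟨K', v, hv, hK'⟩ := hg hx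
  exact ⟨max K K', u ∩ v, inter_mem hu hv,
    (hK.mono inter_subset_left).prodMk (hK'.mono inter_subset_right)⟩

theorem locallyLipschitzOn_of_contDiff {E F : Type*} [NormedAddCommGroup E] [NormedSpace ℝ E]
    [NormedAddCommGroup F] [NormedSpace ℝ F] {f : E → F} (hf : ContDiff ℝ 1 f) (s : Set E) :
    LocallyLipschitzOn s f := hf.locallyLipschitz.locallyLipschitzOn

end LocallyLipschitz

/-! ### The loop as a differential equation in a normed space -/

section StateSpace

/-- The normed space of the states of the output feedback loop. -/
abbrev LoopSpace (n p M : ℕ) : Type :=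
  ((Fin n → ℝ) × (Fin p → ℝ)) × ((Fin (M + 1) → Fin n → ℝ) × (Fin M → ℝ) × (Fin M → Fin M → ℝ))

variable {n p M : ℕ}

/-- The loop state as a point of the normed space `LoopSpace`. -/
def LoopState.toSpace (z : LoopState n p M) : LoopSpace n p M :=
  ((z.x, z.θ), (z.xhat, z.βbar, fun i j => z.P i j))

/-- The loop state that corresponds to a point of `LoopSpace`. -/
def LoopState.ofSpace (y : LoopSpace n p M) : LoopState n p M :=
  ⟨y.1.1, y.1.2, y.2.1, y.2.2.1, Matrix.of y.2.2.2⟩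

theorem LoopState.ofSpace_toSpace (z : LoopState n p M) : ofSpace z.toSpace = z := rfl

theorem LoopState.contDiff_estimate :
    ContDiff ℝ 1 fun y : LoopSpace n p M => (ofSpace y).estimate := by
  simp only [LoopState.estimate, LoopState.weights, Fin.sum_univ_castSucc, Fin.snoc_castSucc,
    Fin.snoc_last, LoopState.ofSpace]
  fun_prop

theorem LoopState.contDiff_CE : ContDiff ℝ 1 fun y : LoopSpace n p M => (ofSpace y).CE := by
  rw [contDiff_pi]
  intro i
  simp only [LoopState.CE, LoopState.Emat, LoopState.ofSpace, Matrix.vecMul, dotProduct,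
    Matrix.of_apply]
  fun_prop

theorem LoopState.contDiff_P_mulVec_CE :
    ContDiff ℝ 1 fun y : LoopSpace n p M => (ofSpace y).P *ᵥ (ofSpace y).CE := by
  rw [contDiff_pi]
  intro i
  have h := contDiff_pi.1 (LoopState.contDiff_CE (n := n) (p := p) (M := M))
  simp only [Matrix.mulVec, dotProduct]
  refine ContDiff.sum fun j _ => ContDiff.mul ?_ (h j)
  simp only [LoopState.ofSpace, Matrix.of_apply]
  fun_prop

theorem LoopState.continuous_weights :
    Continuous fun y : LoopSpace n p M => (ofSpace y).weights := by
  refine continuous_pi fun i => ?_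
  refine Fin.lastCases ?_ (fun i => ?_) i
  · simp only [LoopState.weights, Fin.snoc_last, LoopState.ofSpace]
    fun_prop
  · simp only [LoopState.weights, Fin.snoc_castSucc, LoopState.ofSpace]
    fun_prop

/-- The noise-free part of the vector field of the observers and of the least-squares law. -/
def observerField (κ : Fin n → ℝ) (ε : ℝ) (y : LoopSpace n p M) :
    (Fin (M + 1) → Fin n → ℝ) × (Fin M → ℝ) × (Fin M → Fin M → ℝ) :=
  let z := LoopState.ofSpace y
  (fun i => Amat n *ᵥ z.xhat i + (Cvec n ⬝ᵥ z.x - Cvec n ⬝ᵥ z.xhat i) • gainH κ ε,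
    -((Cvec n ⬝ᵥ z.x - Cvec n ⬝ᵥ z.xhat (Fin.last M) + z.CE ⬝ᵥ z.βbar) • (z.P *ᵥ z.CE)),
    fun i j => -(z.P * Matrix.vecMulVec z.CE z.CE * z.P) i j)

/-- The noise-free part of the vector field of the loop. -/
def loopField (f : (Fin n → ℝ) → ℝ → ℝ) (g : (Fin n → ℝ) → (Fin p → ℝ) → ℝ)
    (h : (Fin n → ℝ) → (Fin p → ℝ) → (Fin p → ℝ)) (κ : Fin n → ℝ) (ε : ℝ)
    (y : LoopSpace n p M) : LoopSpace n p M :=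
  let z := LoopState.ofSpace y
  ((Amat n *ᵥ z.x + f z.x (g z.estimate z.θ) • Bvec n, h z.estimate z.θ), observerField κ ε y)

/-- The vector field that multiplies the noise. -/
def noiseField (κ : Fin n → ℝ) (ε : ℝ) (y : LoopSpace n p M) : LoopSpace n p M :=
  (0, (fun _ => gainH κ ε, -((LoopState.ofSpace y).P *ᵥ (LoopState.ofSpace y).CE), 0))

theorem contDiff_mulVec {E : Type*} [NormedAddCommGroup E] [NormedSpace ℝ E] {m k : ℕ}
    (A : Matrix (Fin m) (Fin k) ℝ) {v : E → Fin k → ℝ} (hv : ContDiff ℝ 1 v) :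
    ContDiff ℝ 1 fun y => A *ᵥ v y :=
  (LinearMap.toContinuousLinearMap A.mulVecLin).contDiff.comp hv

theorem contDiff_dotProduct {E : Type*} [NormedAddCommGroup E] [NormedSpace ℝ E] {m : ℕ}
    {v w : E → Fin m → ℝ} (hv : ContDiff ℝ 1 v) (hw : ContDiff ℝ 1 w) :
    ContDiff ℝ 1 fun y => v y ⬝ᵥ w y :=
  ContDiff.sum fun i _ => (contDiff_pi.1 hv i).mul (contDiff_pi.1 hw i)

theorem contDiff_observerField (κ : Fin n → ℝ) (ε : ℝ) :
    ContDiff ℝ 1 (observerField (p := p) (M := M) κ ε) := by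
  have hx : ContDiff ℝ 1 fun y : LoopSpace n p M => (LoopState.ofSpace y).x := by
    simp only [LoopState.ofSpace]; fun_prop
  have hxh : ∀ i, ContDiff ℝ 1 fun y : LoopSpace n p M => (LoopState.ofSpace y).xhat i := by
    intro i; simp only [LoopState.ofSpace]; fun_prop
  have hβ : ContDiff ℝ 1 fun y : LoopSpace n p M => (LoopState.ofSpace y).βbar := by
    simp only [LoopState.ofSpace]; fun_prop
  have hP : ∀ i j, ContDiff ℝ 1 fun y : LoopSpace n p M => (LoopState.ofSpace y).P i j := by
    intro i j; simp only [LoopState.ofSpace, Matrix.of_apply]; fun_prop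
  have hCE := LoopState.contDiff_CE (n := n) (p := p) (M := M)
  have hC : ∀ {v : LoopSpace n p M → Fin n → ℝ}, ContDiff ℝ 1 v →
      ContDiff ℝ 1 fun y => Cvec n ⬝ᵥ v y := fun hv => contDiff_dotProduct contDiff_const hv
  refine ContDiff.prodMk ?_ (ContDiff.prodMk ?_ ?_)
  · refine contDiff_pi.2 fun i => ?_
    exact (contDiff_mulVec _ (hxh i)).add (((hC hx).sub (hC (hxh i))).smul contDiff_const)
  · exact ((((hC hx).sub (hC (hxh _))).add (contDiff_dotProduct hCE hβ)).smul
      LoopState.contDiff_P_mulVec_CE).neg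
  · refine contDiff_pi.2 fun i => contDiff_pi.2 fun j => ContDiff.neg ?_
    simp only [Matrix.mul_apply, Matrix.vecMulVec_apply]
    exact ContDiff.sum fun k _ => (ContDiff.sum fun k' _ => (hP _ _).mul
      ((contDiff_pi.1 hCE _).mul (contDiff_pi.1 hCE _))).mul (hP _ _)

theorem contDiff_noiseField (κ : Fin n → ℝ) (ε : ℝ) :
    ContDiff ℝ 1 (noiseField (p := p) (M := M) κ ε) :=
  contDiff_const.prodMk (contDiff_const.prodMk
    (LoopState.contDiff_P_mulVec_CE.neg.prodMk contDiff_const))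

variable {D : Set (Fin n → ℝ)} {Θ : Set (Fin p → ℝ)} {f : (Fin n → ℝ) → ℝ → ℝ}
  {g : (Fin n → ℝ) → (Fin p → ℝ) → ℝ} {h : (Fin n → ℝ) → (Fin p → ℝ) → (Fin p → ℝ)}

/-- The vector field of the plant and the controller when the controller is fed with the estimate
`q.2` of the plant state. -/
def feedbackField (f : (Fin n → ℝ) → ℝ → ℝ) (g : (Fin n → ℝ) → (Fin p → ℝ) → ℝ)
    (h : (Fin n → ℝ) → (Fin p → ℝ) → (Fin p → ℝ)) (q : ((Fin n → ℝ) × (Fin p → ℝ)) × (Fin n → ℝ)) :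
    (Fin n → ℝ) × (Fin p → ℝ) :=
  (Amat n *ᵥ q.1.1 + f q.1.1 (g q.2 q.1.2) • Bvec n, h q.2 q.1.2)

theorem locallyLipschitzOn_feedbackField
    (hf : LocallyLipschitzOn (D ×ˢ Set.univ) (fun q : (Fin n → ℝ) × ℝ => f q.1 q.2))
    (hg : LocallyLipschitzOn (Set.univ ×ˢ Θ) (fun q : (Fin n → ℝ) × (Fin p → ℝ) => g q.1 q.2))
    (hh : LocallyLipschitzOn (Set.univ ×ˢ Θ) (fun q : (Fin n → ℝ) × (Fin p → ℝ) => h q.1 q.2)) :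
    LocallyLipschitzOn ((D ×ˢ Θ) ×ˢ Set.univ) (feedbackField f g h) := by
  have h1 : LocallyLipschitzOn ((D ×ˢ Θ) ×ˢ (Set.univ : Set (Fin n → ℝ)))
      fun q : ((Fin n → ℝ) × (Fin p → ℝ)) × (Fin n → ℝ) => (q.2, q.1.2) :=
    locallyLipschitzOn_of_contDiff (by fun_prop) _
  have hmaps : MapsTo (fun q : ((Fin n → ℝ) × (Fin p → ℝ)) × (Fin n → ℝ) => (q.2, q.1.2))
      ((D ×ˢ Θ) ×ˢ Set.univ) (Set.univ ×ˢ Θ) := fun q hq => ⟨mem_univ _, hq.1.2⟩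
  have hg' : LocallyLipschitzOn ((D ×ˢ Θ) ×ˢ (Set.univ : Set (Fin n → ℝ)))
      fun q : ((Fin n → ℝ) × (Fin p → ℝ)) × (Fin n → ℝ) => g q.2 q.1.2 :=
    locallyLipschitzOn_comp hg h1 hmaps
  have hh' : LocallyLipschitzOn ((D ×ˢ Θ) ×ˢ (Set.univ : Set (Fin n → ℝ)))
      fun q : ((Fin n → ℝ) × (Fin p → ℝ)) × (Fin n → ℝ) => h q.2 q.1.2 :=
    locallyLipschitzOn_comp hh h1 hmaps
  have h2 : LocallyLipschitzOn ((D ×ˢ Θ) ×ˢ (Set.univ : Set (Fin n → ℝ)))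
      fun q : ((Fin n → ℝ) × (Fin p → ℝ)) × (Fin n → ℝ) => q.1.1 :=
    locallyLipschitzOn_of_contDiff (by fun_prop) _
  have h3 := locallyLipschitzOn_prodMk h2 hg'
  have hf' : LocallyLipschitzOn ((D ×ˢ Θ) ×ˢ (Set.univ : Set (Fin n → ℝ)))
      fun q : ((Fin n → ℝ) × (Fin p → ℝ)) × (Fin n → ℝ) => f q.1.1 (g q.2 q.1.2) :=
    locallyLipschitzOn_comp hf h3 fun q hq => ⟨hq.1.1, mem_univ _⟩
  have hA : ContDiff ℝ 1 fun q : (Fin n → ℝ) × ℝ => Amat n *ᵥ q.1 + q.2 • Bvec n :=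
    (contDiff_mulVec _ contDiff_fst).add (contDiff_snd.smul contDiff_const)
  have h4 := locallyLipschitzOn_of_contDiff hA Set.univ
  have h5 := locallyLipschitzOn_prodMk h2 hf'
  have h6 := locallyLipschitzOn_comp h4 h5 (mapsTo_univ _ _)
  have h7 := locallyLipschitzOn_prodMk h6 hh'
  have e : feedbackField f g h = fun q : ((Fin n → ℝ) × (Fin p → ℝ)) × (Fin n → ℝ) =>
    (Amat n *ᵥ q.1.1 + f q.1.1 (g q.2 q.1.2) • Bvec n, h q.2 q.1.2) := rfl
  rw [e]
  exact h7

theorem locallyLipschitzOn_stateFeedbackField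
    (hf : LocallyLipschitzOn (D ×ˢ Set.univ) (fun q : (Fin n → ℝ) × ℝ => f q.1 q.2))
    (hg : LocallyLipschitzOn (Set.univ ×ˢ Θ) (fun q : (Fin n → ℝ) × (Fin p → ℝ) => g q.1 q.2))
    (hh : LocallyLipschitzOn (Set.univ ×ˢ Θ) (fun q : (Fin n → ℝ) × (Fin p → ℝ) => h q.1 q.2)) :
    LocallyLipschitzOn (D ×ˢ Θ) (stateFeedbackField f g h) :=
  locallyLipschitzOn_comp (locallyLipschitzOn_feedbackField hf hg hh)
    (g := fun q : (Fin n → ℝ) × (Fin p → ℝ) => (q, q.1))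
    (locallyLipschitzOn_of_contDiff (by fun_prop) _) fun q hq => ⟨hq, mem_univ _⟩

theorem locallyLipschitzOn_loopField
    (hf : LocallyLipschitzOn (D ×ˢ Set.univ) (fun q : (Fin n → ℝ) × ℝ => f q.1 q.2))
    (hg : LocallyLipschitzOn (Set.univ ×ˢ Θ) (fun q : (Fin n → ℝ) × (Fin p → ℝ) => g q.1 q.2))
    (hh : LocallyLipschitzOn (Set.univ ×ˢ Θ) (fun q : (Fin n → ℝ) × (Fin p → ℝ) => h q.1 q.2))
    (κ : Fin n → ℝ) (ε : ℝ) :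
    LocallyLipschitzOn ((D ×ˢ Θ) ×ˢ Set.univ) (loopField (M := M) f g h κ ε) := by
  have h1 : ContDiff ℝ 1 fun y : LoopSpace n p M => (y.1, (LoopState.ofSpace y).estimate) :=
    contDiff_fst.prodMk LoopState.contDiff_estimate
  have h2 := locallyLipschitzOn_of_contDiff h1 ((D ×ˢ Θ) ×ˢ Set.univ)
  have h3 := locallyLipschitzOn_comp (locallyLipschitzOn_feedbackField hf hg hh) h2
    fun y hy => ⟨hy.1, mem_univ _⟩
  have h4 := locallyLipschitzOn_prodMk h3
    (locallyLipschitzOn_of_contDiff (contDiff_observerField κ ε) ((D ×ˢ Θ) ×ˢ Set.univ))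
  have e : loopField (M := M) f g h κ ε = fun y =>
    (feedbackField f g h (y.1, (LoopState.ofSpace y).estimate), observerField κ ε y) := rfl
  rw [e]
  exact h4

variable {κ : Fin n → ℝ} {ε : ℝ} {ν : ℝ → ℝ} {J : Set ℝ} {z : ℝ → LoopState n p M}

/-- The noise enters affinely, so the loop has the form `ż = G z + ν(t) b z` to which the existence
and uniqueness results apply. -/
theorem isLoopSolution_iff (h0 : (0 : ℝ) ∈ J) (hJ : J.OrdConnected) :
    IsLoopSolution D Θ f g h κ ε ν J z ↔
      (∀ t ∈ J, (z t).toSpace ∈ (D ×ˢ Θ) ×ˢ Set.univ) ∧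
      SolvesOn J (fun t => (z t).toSpace) fun t =>
        loopField f g h κ ε (z t).toSpace + ν t • noiseField κ ε (z t).toSpace := by
  constructor
  · intro hz
    refine ⟨fun t ht => ⟨hz.mem_domain t ht, mem_univ _⟩, ?_⟩
    have h1 := (hz.plant.prodMk hz.controller).prodMk
      ((solvesOn_pi (z := fun t => (z t).xhat)
        (v := fun t i => Amat n *ᵥ (z t).xhat i
      + ((Cvec n ⬝ᵥ (z t).x + ν t) - Cvec n ⬝ᵥ (z t).xhat i) • gainH κ ε) hz.observers).prodMk
        (hz.weights.prodMk (solvesOn_pi (z := fun t i j => (z t).P i j)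
        (v := fun t i j =>  -((z t).P * Matrix.vecMulVec (z t).CE (z t).CE * (z t).P) i j) fun i =>
          solvesOn_pi fun j => hz.covariance i j)))
    refine h1.congr h0 hJ (fun _ _ => rfl) fun t _ => ?_
    simp only [loopField, noiseField, observerField, LoopState.ofSpace_toSpace]
    refine Prod.ext ?_ (Prod.ext ?_ (Prod.ext ?_ ?_))
    · simp
    · ext1 i
      simp only [Prod.smul_mk, Prod.mk_add_mk, Pi.add_apply, Pi.smul_apply]
      module
    · simp only [Prod.smul_mk, Prod.mk_add_mk]
      module
    · simp
  · rintro ⟨hΩ, hz⟩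
    have hfst := hz.clm (ContinuousLinearMap.fst ℝ _ _)
    have hsnd := hz.clm (ContinuousLinearMap.snd ℝ _ _)
    have hsnd2 := hsnd.clm (ContinuousLinearMap.snd ℝ _ _)
    refine ⟨fun t ht => (hΩ t ht).1, ?_, ?_, fun i => ?_, ?_, fun i j => ?_⟩
    · refine (hfst.clm (ContinuousLinearMap.fst ℝ _ _)).congr h0 hJ (fun _ _ => rfl) fun t _ => ?_
      simp [loopField, noiseField, LoopState.ofSpace_toSpace]
    · refine (hfst.clm (ContinuousLinearMap.snd ℝ _ _)).congr h0 hJ (fun _ _ => rfl) fun t _ => ?_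
      simp [loopField, noiseField, LoopState.ofSpace_toSpace]
    · refine ((hsnd.clm (ContinuousLinearMap.fst ℝ _ _)).apply i).congr h0 hJ (fun _ _ => rfl)
        fun t _ => ?_
      simp only [loopField, noiseField, observerField, LoopState.ofSpace_toSpace,
        ContinuousLinearMap.coe_fst', ContinuousLinearMap.coe_snd', Prod.smul_mk, Prod.mk_add_mk,
        Pi.add_apply, Pi.smul_apply]
      module
    · refine (hsnd2.clm (ContinuousLinearMap.fst ℝ _ _)).congr h0 hJ (fun _ _ => rfl)
        fun t _ => ?_
      simp only [loopField, noiseField, observerField, LoopState.ofSpace_toSpace,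
        ContinuousLinearMap.coe_fst', ContinuousLinearMap.coe_snd', Prod.smul_mk, Prod.mk_add_mk]
      module
    · refine (((hsnd2.clm (ContinuousLinearMap.snd ℝ _ _)).apply i).apply j).congr h0 hJ
        (fun _ _ => rfl) fun t _ => ?_
      simp [loopField, noiseField, observerField, LoopState.ofSpace_toSpace]

end StateSpace

/-! ### Trapping of the plant state and choice of constants -/

section Main

variable {n p M : ℕ} {D : Set (Fin n → ℝ)} {Θ : Set (Fin p → ℝ)} {f : (Fin n → ℝ) → ℝ → ℝ}
  {g : (Fin n → ℝ) → (Fin p → ℝ) → ℝ} {h : (Fin n → ℝ) → (Fin p → ℝ) → (Fin p → ℝ)}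

/-- The bounds are uniform over all estimates `w`: global boundedness keeps `g w θ` in a compact
interval, so a peaking estimate produces only a bounded perturbation. -/
theorem exists_feedback_bounds
    (hf : LocallyLipschitzOn (D ×ˢ Set.univ) (fun q : (Fin n → ℝ) × ℝ => f q.1 q.2))
    (hbdd : ∀ K : Set (Fin p → ℝ), IsCompact K → K ⊆ Θ →
      ∃ c : ℝ, ∀ x : Fin n → ℝ, ∀ θ ∈ K, |g x θ| ≤ c ∧ ‖h x θ‖ ≤ c)
    {Q : Set ((Fin n → ℝ) × (Fin p → ℝ))} (hQ : IsCompact Q) (hQΩ : Q ⊆ D ×ˢ Θ) :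
    ∃ cf ≥ 0, ∃ c₁ ≥ 0, ∀ q ∈ Q, ∀ w, |f q.1 (g w q.2)| ≤ cf ∧
      ‖feedbackField f g h (q, w) - stateFeedbackField f g h q‖ ≤ c₁ := by
  have hK : IsCompact (Prod.snd '' Q) := hQ.image continuous_snd
  have hK' : IsCompact (Prod.fst '' Q) := hQ.image continuous_fst
  obtain ⟨c, hc⟩ := hbdd _ hK (by rintro _ ⟨q, hq, rfl⟩; exact (hQΩ hq).2)
  obtain ⟨cf, hcf⟩ := (hK'.prod (isCompact_Icc (a := -c) (b := c))).exists_bound_of_continuousOn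
    (hf.continuousOn.mono (by
      rintro ⟨_, r⟩ ⟨⟨q, hq, rfl⟩, -⟩
      exact ⟨(hQΩ hq).1, mem_univ _⟩))
  have hfb : ∀ q ∈ Q, ∀ w, |f q.1 (g w q.2)| ≤ cf := fun q hq w =>
    hcf (q.1, g w q.2) ⟨⟨q, hq, rfl⟩, abs_le.1 (hc w q.2 ⟨q, hq, rfl⟩).1⟩
  refine ⟨max cf 0, le_max_right _ _, max (cf + cf) (max (c + c) 0),
    (le_max_right _ _).trans (le_max_right _ _), fun q hq w =>
    ⟨(hfb q hq w).trans (le_max_left _ _), ?_⟩⟩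
  have e : feedbackField f g h (q, w) - stateFeedbackField f g h q
      = ((f q.1 (g w q.2) - f q.1 (g q.1 q.2)) • Bvec n, h w q.2 - h q.1 q.2) := by
    simp only [feedbackField, stateFeedbackField, Prod.mk_sub_mk, sub_smul, add_sub_add_left_eq_sub]
  rw [e, Prod.norm_def]
  refine max_le_max ?_ (le_trans ?_ (le_max_left _ _))
  · rw [norm_smul]
    refine (mul_le_of_le_one_right (norm_nonneg _) norm_Bvec_le).trans ?_
    exact (norm_sub_le _ _).trans (add_le_add (hfb q hq w) (hfb q hq q.1))
  · exact (norm_sub_le _ _).trans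
      (add_le_add (hc w q.2 ⟨q, hq, rfl⟩).2 (hc q.1 q.2 ⟨q, hq, rfl⟩).2)

theorem exists_feedback_modulus
    (hF : ContinuousOn (feedbackField f g h) ((D ×ˢ Θ) ×ˢ Set.univ))
    {Q : Set ((Fin n → ℝ) × (Fin p → ℝ))} (hQ : IsCompact Q) (hQΩ : Q ⊆ D ×ˢ Θ) {μ : ℝ}
    (hμ : 0 < μ) :
    ∃ δ > 0, ∀ q ∈ Q, ∀ w, ‖q.1 - w‖ ≤ δ →
      ‖feedbackField f g h (q, w) - stateFeedbackField f g h q‖ ≤ μ := by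
  have hcomp : IsCompact (Q ×ˢ Metric.closedBall (0 : Fin n → ℝ) 1) :=
    hQ.prod (isCompact_closedBall _ _)
  -- Using the error `q.1 - w` as the parameter places all relevant pairs in a compact set, where
  -- continuity is uniform.
  have hcont : ContinuousOn (fun r : ((Fin n → ℝ) × (Fin p → ℝ)) × (Fin n → ℝ) =>
      feedbackField f g h (r.1, r.1.1 - r.2)) (Q ×ˢ Metric.closedBall (0 : Fin n → ℝ) 1) :=
    hF.comp (by fun_prop) fun r hr => ⟨hQΩ hr.1, mem_univ _⟩
  obtain ⟨δ, hδ, hδ'⟩ := Metric.uniformContinuousOn_iff.1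
    (hcomp.uniformContinuousOn_of_continuous hcont) μ hμ
  refine ⟨min (δ / 2) 1, by positivity, fun q hq w hw => ?_⟩
  have h1 := hδ' (q, q.1 - w) ⟨hq, by
      rw [mem_closedBall_zero_iff]; exact hw.trans (min_le_right _ _)⟩ (q, 0)
    ⟨hq, by simp⟩ (by
      rw [dist_eq_norm, Prod.mk_sub_mk, sub_self, sub_zero, Prod.norm_def, norm_zero]
      exact max_lt hδ ((hw.trans (min_le_left _ _)).trans_lt (half_lt_self hδ)))
  simp only [sub_sub_cancel, sub_zero, dist_eq_norm] at h1
  exact h1.le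

/-- Wherever the window lies, it meets `[0, T₀]` in length at most `T₀`, so the transient costs at
most `c₁ * T₀`. -/
theorem norm_integral_le_of_transient {X : Type*} [NormedAddCommGroup X] [NormedSpace ℝ X]
    {v : ℝ → X} {a b c₁ μ T₀ T : ℝ} (ha : 0 ≤ a) (hab : a ≤ b) (hbT : b - a ≤ T) (hc₁ : 0 ≤ c₁)
    (hμ : 0 ≤ μ) (hT₀ : 0 ≤ T₀) (h₁ : ∀ q ∈ Icc a b, q ≤ T₀ → ‖v q‖ ≤ c₁)
    (h₂ : ∀ q ∈ Icc a b, T₀ ≤ q → ‖v q‖ ≤ μ) :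
    ‖∫ q in a..b, v q‖ ≤ c₁ * T₀ + μ * T := by
  have hi₁ : IntervalIntegrable ((Iic T₀).indicator fun _ => c₁) volume a b := by
    rw [intervalIntegrable_iff, IntegrableOn, uIoc_of_le hab]
    exact (integrable_const c₁).indicator measurableSet_Iic
  have hi₂ : IntervalIntegrable (fun _ : ℝ => μ) volume a b := intervalIntegrable_const
  have h3 : ‖∫ q in a..b, v q‖ ≤ ∫ q in a..b, ((Iic T₀).indicator (fun _ => c₁) q + μ) := by
    refine intervalIntegral.norm_integral_le_of_norm_le hab (Eventually.of_forall fun q hq => ?_)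
      (hi₁.add hi₂)
    by_cases hqT : q ≤ T₀
    · rw [indicator_of_mem (show q ∈ Iic T₀ from hqT)]
      exact (h₁ q (Ioc_subset_Icc_self hq) hqT).trans (le_add_of_nonneg_right hμ)
    · rw [indicator_of_notMem (show q ∉ Iic T₀ from hqT), zero_add]
      exact h₂ q (Ioc_subset_Icc_self hq) (le_of_not_ge hqT)
  refine h3.trans ?_
  rw [intervalIntegral.integral_add hi₁ hi₂]
  refine add_le_add ?_ ?_
  · rw [intervalIntegral.integral_of_le hab, setIntegral_indicator measurableSet_Iic,
      setIntegral_const, smul_eq_mul, mul_comm]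
    refine mul_le_mul_of_nonneg_left ?_ hc₁
    calc volume.real (Ioc a b ∩ Iic T₀) ≤ volume.real (Ioc 0 T₀) :=
          measureReal_mono (fun q hq => ⟨ha.trans_lt hq.1.1, hq.2⟩) (by simp)
      _ = T₀ := by simp [hT₀]
  · rw [intervalIntegral.integral_const, smul_eq_mul, mul_comm]
    exact mul_le_mul_of_nonneg_left hbT hμ

/-- Substituting `x = c * T₀ / ε`, the claim is `x ^ m * exp (-x) → 0`: the decay reached at time
`T₀` beats the peaking factor `ε ^ (-m)`. -/
theorem exists_gain_threshold {c C W δ T₀ : ℝ} (hc : 0 < c) (hT₀ : 0 < T₀) (hδ : 0 < δ) (m : ℕ) :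
    ∃ ε₂ > 0, ε₂ ≤ 1 ∧ ε₂ ≤ T₀ ∧ ∀ ε, 0 < ε → ε ≤ ε₂ →
      C * Real.exp (-(c / ε * T₀)) / ε ^ m + W * ε ≤ δ := by
  have hx : Tendsto (fun ε : ℝ => c * T₀ * ε⁻¹) (𝓝[>] 0) atTop :=
    tendsto_inv_nhdsGT_zero.const_mul_atTop (by positivity)
  have h1 := ((Real.tendsto_pow_mul_exp_neg_atTop_nhds_zero m).comp hx).const_mul
    (C / (c * T₀) ^ m)
  have h2 : Tendsto (fun ε : ℝ => W * ε) (𝓝[>] 0) (𝓝 0) := by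
    have : Tendsto (fun ε : ℝ => W * ε) (𝓝 0) (𝓝 (W * 0)) := (continuous_const_mul W).tendsto 0
    rw [mul_zero] at this
    exact this.mono_left nhdsWithin_le_nhds
  have h3 := h1.add h2
  simp only [mul_zero, add_zero] at h3
  have h4 := h3.eventually (gt_mem_nhds hδ)
  obtain ⟨e, he, hsub⟩ := mem_nhdsGT_iff_exists_Ioc_subset.1 h4
  have he0 : (0 : ℝ) < e := he
  refine ⟨min e (min 1 T₀), by positivity, (min_le_right _ _).trans (min_le_left _ _),
    (min_le_right _ _).trans (min_le_right _ _), fun ε hε hε₂ => ?_⟩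
  have h5 := hsub ⟨hε, hε₂.trans (min_le_left _ _)⟩
  simp only [Function.comp, mem_ofPred_eq] at h5
  refine le_trans (le_of_eq ?_) h5.le
  have e1 : c / ε * T₀ = c * T₀ * ε⁻¹ := by field_simp
  rw [e1, mul_pow (c * T₀), inv_pow]
  field_simp

variable {κ : Fin n → ℝ} {ε : ℝ} {ν : ℝ → ℝ} {z : ℝ → LoopState n p M}

/-- The plant and controller states remain in `Q` when the estimate is accurate after `T₀`. -/
theorem IsLoopSolution.mem_of_robust {s T₀ T η c₁ cf μ δ : ℝ}
    {Q Q' : Set ((Fin n → ℝ) × (Fin p → ℝ))}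
    (hQ : IsCompact Q) (hQQ' : Q ⊆ interior Q')
    (hz : IsLoopSolution D Θ f g h κ ε ν (Ico 0 s) z) (h0 : ((z 0).x, (z 0).θ) ∈ Q)
    (hrob : ∀ s : ℝ, ∀ q v : ℝ → (Fin n → ℝ) × (Fin p → ℝ), q 0 = ((z 0).x, (z 0).θ) →
      SolvesOn (Ico 0 s) q v → (∀ t ∈ Ico 0 s, q t ∈ D ×ˢ Θ) →
      (∀ a b, 0 ≤ a → a ≤ b → b < s → b - a ≤ T →
        ‖∫ r in a..b, (v r - stateFeedbackField f g h (q r))‖ ≤ η) → ∀ t ∈ Ico 0 s, q t ∈ Q)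
    (hc₁ : 0 ≤ c₁) (hμ : 0 ≤ μ) (hT₀ : 0 ≤ T₀) (hη : c₁ * T₀ + μ * T ≤ η)
    (hbound : ∀ q ∈ Q', ∀ w, |f q.1 (g w q.2)| ≤ cf ∧
      ‖feedbackField f g h (q, w) - stateFeedbackField f g h q‖ ≤ c₁)
    (hmod : ∀ q ∈ Q', ∀ w, ‖q.1 - w‖ ≤ δ →
      ‖feedbackField f g h (q, w) - stateFeedbackField f g h q‖ ≤ μ)
    (hest : ∀ t ∈ Ico 0 s, T₀ ≤ t →
      (∀ r ∈ Icc 0 t, |f (z r).x (g (z r).estimate (z r).θ)| ≤ cf) →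
      ‖(z t).x - (z t).estimate‖ ≤ δ) :
    ∀ t ∈ Ico 0 s, ((z t).x, (z t).θ) ∈ Q := by
  have hq := hz.plant.prodMk hz.controller
  have hqc := hq.continuousOn_Ico
  -- Bootstrap: inside `Q'` the bound on `f` holds, so the estimate is accurate after `T₀`, the
  -- perturbation has integrals at most `η`, and `hrob` returns the trajectory to the smaller set
  -- `Q`.
  refine forall_mem_of_trapped hqc hQ.isClosed isOpen_interior hQQ' h0 fun t ht hN => ?_
  have hN' : ∀ r ∈ Icc 0 t, ((z r).x, (z r).θ) ∈ Q' := fun r hr => interior_subset (hN r hr)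
  have hsub : Ico 0 t ⊆ Ico 0 s := Ico_subset_Ico_right ht.2.le
  have hfb : ∀ r ∈ Icc 0 t, |f (z r).x (g (z r).estimate (z r).θ)| ≤ cf := fun r hr =>
    (hbound _ (hN' r hr) _).1
  have hmain : ∀ r ∈ Ico 0 t, ((z r).x, (z r).θ) ∈ Q := by
    refine hrob t _ _ rfl (hq.mono hsub) (fun r hr => hz.mem_domain r (hsub hr)) ?_
    intro a b ha hab hbt hT
    refine (norm_integral_le_of_transient ha hab hT hc₁ hμ hT₀ (fun r hr _ => ?_)
      fun r hr hr' => ?_).trans hη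
    · exact (hbound _ (hN' r ⟨ha.trans hr.1, hr.2.trans hbt.le⟩) _).2
    · have hr0 : r ∈ Icc 0 t := ⟨ha.trans hr.1, hr.2.trans hbt.le⟩
      exact hmod _ (hN' r hr0) _ (hest r ⟨hr0.1, hr0.2.trans_lt ht.2⟩ hr'
        fun r' hr'' => hfb r' ⟨hr''.1, hr''.2.trans hr0.2⟩)
  intro r hr
  rcases eq_or_lt_of_le (hr.1.trans hr.2) with h1 | h1
  · have : r = 0 := le_antisymm (h1 ▸ hr.2) hr.1
    rw [this]; exact h0
  · have hcl : r ∈ closure (Ico 0 t) := by rw [closure_Ico h1.ne]; exact hr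
    have hw := (hqc r ⟨hr.1, hr.2.trans_lt ht.2⟩).mono hsub
    have := hw.mem_closure hcl (t := Q) hmain
    rwa [hQ.isClosed.closure_eq] at this

theorem boundedForward_of_mem_compact {Y Z : Type*} [TopologicalSpace Y] [NormedAddCommGroup Z]
    {F : Y → Z} (hF : Continuous F) {Q : Set Y} (hQ : IsCompact Q) {y : ℝ → Y}
    (hy : ∀ t, 0 ≤ t → y t ∈ Q) : BoundedForward fun t => F (y t) := by
  obtain ⟨R, hR⟩ := hQ.exists_bound_of_continuousOn hF.continuousOn
  exact ⟨R, fun t ht => hR _ (hy t ht)⟩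

end Main

end MHGO

end

theorem theorem1 {n p M : ℕ} (hn : 1 ≤ n) (hM : n + 1 ≤ M + 1)
    -- the open domain of interest of the plant state and of the controller state
    (D : Set (Fin n → ℝ)) (hD : IsOpen D) (Θ : Set (Fin p → ℝ)) (hΘ : IsOpen Θ)
    -- the plant and the state feedback controller
    (f : (Fin n → ℝ) → ℝ → ℝ) (g : (Fin n → ℝ) → (Fin p → ℝ) → ℝ)
    (h : (Fin n → ℝ) → (Fin p → ℝ) → (Fin p → ℝ))
    (hf : LocallyLipschitzOn (D ×ˢ Set.univ) (fun q : (Fin n → ℝ) × ℝ => f q.1 q.2))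
    (hg : LocallyLipschitzOn (Set.univ ×ˢ Θ) (fun q : (Fin n → ℝ) × (Fin p → ℝ) => g q.1 q.2))
    (hh : LocallyLipschitzOn (Set.univ ×ˢ Θ) (fun q : (Fin n → ℝ) × (Fin p → ℝ) => h q.1 q.2))
    -- `g` and `h` are globally bounded in `x`, locally uniformly in `θ`
    (hbdd : ∀ K : Set (Fin p → ℝ), IsCompact K → K ⊆ Θ →
      ∃ c : ℝ, ∀ x : Fin n → ℝ, ∀ θ ∈ K, |g x θ| ≤ c ∧ ‖h x θ‖ ≤ c)
    -- the set that the state feedback controller stabilizes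
    (Sig : Set ((Fin n → ℝ) × (Fin p → ℝ))) (hSig : IsCompact Sig) (hSigne : Sig.Nonempty)
    (hSigD : Sig ⊆ D ×ˢ Θ)
    (hinv : MHGO.PositivelyInvariant (D ×ˢ Θ) (MHGO.stateFeedbackField f g h) Sig)
    (hstab : MHGO.UniformlyAsymptoticallyStable (D ×ˢ Θ) (MHGO.stateFeedbackField f g h) Sig)
    -- the parameters of the observers and of the least-squares law
    (κ : Fin n → ℝ) (hκ : MHGO.HurwitzCoefficients κ) (γ : ℝ) (hγ : 0 < γ)
    -- the sets of initial conditions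
    (S₁ : Set ((Fin n → ℝ) × (Fin p → ℝ))) (hS₁ : IsCompact S₁)
    (hS₁R : S₁ ⊆ MHGO.regionOfAttraction (D ×ˢ Θ) (MHGO.stateFeedbackField f g h) Sig)
    (S₂ : Set (Fin n → ℝ)) (hS₂ : IsCompact S₂) :
    ∃ νs ε₁ ε₂ : ℝ, 0 < νs ∧ 0 < ε₁ ∧ ε₁ < ε₂ ∧ ε₂ ≤ 1 ∧
      ∀ ε ∈ Set.Icc ε₁ ε₂, ∀ ν : ℝ → ℝ, Measurable ν → (∀ t, 0 ≤ t → |ν t| ≤ νs) →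
      ∀ z₀ : MHGO.LoopState n p M, (z₀.x, z₀.θ) ∈ S₁ → z₀.estimate ∈ S₂ →
        z₀.P = γ • (1 : Matrix (Fin M) (Fin M) ℝ) →
      ∃ z : ℝ → MHGO.LoopState n p M,
        -- `z` is the solution that starts in `z₀`; it exists for all `t ≥ 0` and is unique
        z 0 = z₀ ∧ MHGO.IsLoopSolution D Θ f g h κ ε ν (Set.Ici 0) z ∧
        (∀ T : ℝ, 0 < T → ∀ z' : ℝ → MHGO.LoopState n p M, z' 0 = z₀ →
          MHGO.IsLoopSolution D Θ f g h κ ε ν (Set.Ico 0 T) z' → ∀ t ∈ Set.Ico 0 T, z' t = z t) ∧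
        -- all its signals are bounded
        MHGO.BoundedForward (fun t => (z t).x) ∧
        MHGO.BoundedForward (fun t => (z t).θ) ∧
        MHGO.BoundedForward (fun t => (z t).estimate) ∧
        MHGO.BoundedForward (fun t => (z t).weights) ∧
        ∀ i, MHGO.BoundedForward (fun t => (z t).xhat i) := by
  have hΩ : IsOpen (D ×ˢ Θ) := hD.prod hΘ
  have hFlip := MHGO.locallyLipschitzOn_feedbackField hf hg hh
  have hSlip := MHGO.locallyLipschitzOn_stateFeedbackField hf hg hh
  obtain ⟨Q, hQ, hQΩ, T, hT, η, hη, hrob⟩ :=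
    MHGO.exists_compact_robust hΩ hSlip hSig hSigne hSigD hstab hS₁ hS₁R
  -- The unperturbed solution is admissible in `hrob`, evaluated here at time zero.
  have hS₁Q : S₁ ⊆ Q := by
    intro q hq
    obtain ⟨w, hw, hw0, -⟩ := hS₁R hq
    have hwΩ : ∀ t ∈ Ico (0 : ℝ) 1, w t ∈ D ×ˢ Θ := fun t ht => hw.2 t ht.1
    have hws : MHGO.SolvesOn (Ico 0 1) w fun t => MHGO.stateFeedbackField f g h (w t) :=
      (MHGO.isSolution_iff_solvesOn hSlip.continuousOn hwΩ).1
        ⟨hw.1.mono Ico_subset_Ici_self, hwΩ⟩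
    have := hrob 1 w _ hws hwΩ (by rw [hw0]; exact hq)
      (fun a b _ _ _ _ => by simp [hη.le]) 0 ⟨le_rfl, one_pos⟩
    rwa [hw0] at this
  obtain ⟨Q', hQ', hQQ', hQ'Ω⟩ := exists_compact_between hQ hΩ hQΩ
  obtain ⟨cf, hcf, c₁, hc₁, hbound⟩ := MHGO.exists_feedback_bounds hf hbdd hQ' hQ'Ω
  obtain ⟨δ, hδ, hmod⟩ := MHGO.exists_feedback_modulus hFlip.continuousOn hQ' hQ'Ω
    (μ := η / 2 / T) (by positivity)
  obtain ⟨K, hK, c, hc, l, hl, hflow⟩ := MHGO.exists_isHighGainFlow hn hκ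
  obtain ⟨c₀, hc₀⟩ : ∃ c₀ : ℝ, ∀ q ∈ S₁, ∀ w ∈ S₂, ‖q.1 - w‖ ≤ c₀ := by
    obtain ⟨R, hR⟩ := (hS₁.prod hS₂).exists_bound_of_continuousOn
      (f := fun r : ((Fin n → ℝ) × (Fin p → ℝ)) × (Fin n → ℝ) => r.1.1 - r.2) (by fun_prop)
    exact ⟨R, fun q hq w hw => hR (q, w) ⟨hq, hw⟩⟩
  -- Half of the budget `η` pays for the transient `c₁ * T₀`, the other half for the accuracy level
  -- `η / 2 / T` over a window. Adding one keeps the denominator positive.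
  set T₀ : ℝ := η / 2 / (c₁ + 1) with hT₀
  have hT₀0 : 0 < T₀ := by positivity
  have hηT : c₁ * T₀ + η / 2 / T * T ≤ η := by
    have h1 : c₁ * T₀ ≤ (c₁ + 1) * T₀ := by gcongr; linarith
    have h2 : (c₁ + 1) * T₀ = η / 2 := by rw [hT₀]; field_simp
    have h3 : η / 2 / T * T = η / 2 := by field_simp
    linarith
  -- `W * ε` will dominate the forced error; `C` collects the factors of the decaying term once the
  -- disturbance bound is replaced by `W` and the noise bound by `1`.
  set W : ℝ := K / c * (cf + ‖κ‖) with hW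
  set C : ℝ := K * (|c₀| + (K * |c₀| + W + 1) * K / (c * l)) with hC
  obtain ⟨ε₂, hε₂, hε₂1, hε₂T, hthr⟩ :=
    MHGO.exists_gain_threshold (C := C) (W := W) hc hT₀0 hδ (n - 1)
  -- For `ε ≥ ε₂ / 2` this noise level is at most `ε ^ n`, so the amplified noise `νs / ε ^ (n - 1)`
  -- is at most `ε`.
  refine ⟨(ε₂ / 2) ^ n, ε₂ / 2, ε₂, by positivity, by positivity, by linarith, hε₂1, ?_⟩
  intro ε hε ν hν hνb z₀ hz₀ hest₀ hP₀
  have hε0 : 0 < ε := lt_of_lt_of_le (by positivity) hε.1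
  have hε1 : ε ≤ 1 := hε.2.trans hε₂1
  set νs : ℝ := (ε₂ / 2) ^ n with hνs
  have hνs0 : 0 ≤ νs := by positivity
  have hνs1 : νs ≤ 1 := pow_le_one₀ (by positivity) (by linarith)
  have hWε : MHGO.disturbanceBound κ ε K c cf νs ≤ W * ε := by
    rw [MHGO.disturbanceBound_eq hε0, hW, mul_assoc]
    refine mul_le_mul_of_nonneg_left ?_ (by positivity)
    have h1 : νs / ε ^ (n - 1) ≤ ε := by
      rw [div_le_iff₀ (by positivity), ← pow_succ', Nat.sub_add_cancel hn]
      exact pow_le_pow_left₀ (by positivity) hε.1 n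
    calc cf * ε + νs * ‖κ‖ / ε ^ (n - 1) = cf * ε + νs / ε ^ (n - 1) * ‖κ‖ := by ring
      _ ≤ cf * ε + ε * ‖κ‖ := by gcongr
      _ = _ := by ring
  obtain ⟨Φ, hΦ⟩ := hflow ε hε0 hε1
  have hW0 : 0 ≤ W := by positivity
  have hcover : ∀ s : ℝ, ∀ z : ℝ → MHGO.LoopState n p M, z 0 = z₀ →
      MHGO.IsLoopSolution D Θ f g h κ ε ν (Ico 0 s) z →
      ∀ t ∈ Ico 0 s, ((z t).x, (z t).θ) ∈ Q := by
    intro s z hz0 hz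
    refine hz.mem_of_robust hQ hQQ' (by rw [hz0]; exact hS₁Q hz₀)
      (fun s q v hq0 hq hqΩ hdr => hrob s q v hq hqΩ (by rw [hq0, hz0]; exact hz₀) hdr)
      hc₁ (by positivity) hT₀0.le hηT hbound hmod fun t ht htT hfb => ?_
    have hzt := hz.mono (Icc_subset_Ico_right ht.2)
    have h1 := hzt.norm_error_estimate_le hΦ hε0 hε1 ((hε.2.trans hε₂T).trans htT) hK hc hl hγ
      (by rw [hz0, hP₀]) hfb (fun r hr => hνb r hr.1)
    rw [hz0] at h1
    have h2 : ‖z₀.x - z₀.estimate‖ ≤ |c₀| := (hc₀ _ hz₀ _ hest₀).trans (le_abs_self _)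
    have h3 : MHGO.disturbanceBound κ ε K c cf νs ≤ W :=
      hWε.trans (mul_le_of_le_one_right hW0 hε1)
    have h4 : Real.exp (-(c / ε * t)) ≤ Real.exp (-(c / ε * T₀)) := by
      rw [Real.exp_le_exp, neg_le_neg_iff]; gcongr
    refine (h1.trans (add_le_add ?_ hWε)).trans (hthr ε hε0 hε.2)
    have h5 : 0 ≤ MHGO.disturbanceBound κ ε K c cf νs := by
      unfold MHGO.disturbanceBound; positivity
    calc _ ≤ K * Real.exp (-(c / ε * T₀)) / ε ^ (n - 1)
          * (|c₀| + (K * |c₀| + W + 1) * K / (c * l)) := by gcongr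
      _ = _ := by rw [hC]; ring
  obtain ⟨rx, hrx⟩ := (hQ.image continuous_fst).isBounded.exists_norm_le
  -- `R` depends on `z₀`, as it must: the single observer states and weights are not confined to a
  -- fixed compact set initially.
  obtain ⟨R, hR⟩ := MHGO.exists_loop_bounds (D := D) (Θ := Θ) (f := f) (g := g) (h := h) (ν := ν)
    hΦ hε0 hε1 hK hc hγ hcf hνs0 z₀ hP₀ rx
  set Y : Set (MHGO.LoopSpace n p M) := Q ×ˢ Metric.closedBall 0 |R| with hY
  have hYc : IsCompact Y := hQ.prod (isCompact_closedBall _ _)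
  have hconf : ∀ s : ℝ, ∀ z : ℝ → MHGO.LoopState n p M, z 0 = z₀ →
      MHGO.IsLoopSolution D Θ f g h κ ε ν (Ico 0 s) z → ∀ t ∈ Ico 0 s, (z t).toSpace ∈ Y := by
    intro s z hz0 hz t ht
    have hzQ := hcover s z hz0 hz
    obtain ⟨h1, h2, h3⟩ := hR t ht.1 z hz0 (hz.mono (Icc_subset_Ico_right ht.2))
      (fun r hr => (hbound _ (interior_subset (hQQ' (hzQ r ⟨hr.1, hr.2.trans_lt ht.2⟩))) _).1)
      (fun r hr => hνb r hr.1) (hrx _ ⟨_, hzQ t ht, rfl⟩)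
    refine ⟨hzQ t ht, ?_⟩
    rw [mem_closedBall_zero_iff]
    refine norm_prod_le_iff.2 ⟨h1.trans (le_abs_self _), norm_prod_le_iff.2
      ⟨h2.trans (le_abs_self _), ?_⟩⟩
    exact (pi_norm_le_iff_of_nonneg (abs_nonneg _)).2 fun i =>
      (pi_norm_le_iff_of_nonneg (abs_nonneg _)).2 fun j => (h3 i j).trans (le_abs_self _)
  have hLlip := MHGO.locallyLipschitzOn_loopField (M := M) hf hg hh κ ε
  have hNlip := MHGO.locallyLipschitzOn_of_contDiff
    (MHGO.contDiff_noiseField (n := n) (p := p) (M := M) κ ε) ((D ×ˢ Θ) ×ˢ Set.univ)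
  -- The bounds in `hR` concern solutions; the constant curve on the degenerate interval `[0, 0]` is
  -- one, which makes them available at `z₀`.
  have hz₀Y : z₀.toSpace ∈ Y := by
    have h0 : MHGO.IsLoopSolution D Θ f g h κ ε ν (Icc 0 0) fun _ => z₀ := by
      rw [MHGO.isLoopSolution_iff (by simp) ordConnected_Icc]
      refine ⟨fun t _ => ⟨hQΩ (hS₁Q hz₀), mem_univ _⟩, fun t ht => ?_⟩
      rw [Icc_self, mem_singleton_iff] at ht
      subst ht
      simp
    obtain ⟨h1, h2, h3⟩ := hR 0 le_rfl _ rfl h0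
      (fun r hr => (hbound _ (interior_subset (hQQ' (hS₁Q hz₀))) _).1)
      (fun r hr => hνb r hr.1) (hrx _ ⟨_, hS₁Q hz₀, rfl⟩)
    refine ⟨hS₁Q hz₀, ?_⟩
    rw [mem_closedBall_zero_iff]
    refine norm_prod_le_iff.2 ⟨h1.trans (le_abs_self _), norm_prod_le_iff.2
      ⟨h2.trans (le_abs_self _), ?_⟩⟩
    exact (pi_norm_le_iff_of_nonneg (abs_nonneg _)).2 fun i =>
      (pi_norm_le_iff_of_nonneg (abs_nonneg _)).2 fun j => (h3 i j).trans (le_abs_self _)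
  obtain ⟨y, hy0, -, hy, hyY⟩ := MHGO.exists_solvesOn_of_confined (hΩ.prod isOpen_univ) hLlip
    hNlip hν hνb hYc (fun y hy => ⟨hQΩ hy.1, mem_univ _⟩) hz₀Y (by
      intro s hs y hy0 hy hyΩ t ht
      exact hconf s (fun t => MHGO.LoopState.ofSpace (y t)) (congrArg MHGO.LoopState.ofSpace hy0)
        ((MHGO.isLoopSolution_iff (J := Ico 0 s) ⟨le_rfl, hs⟩ ordConnected_Ico).2 ⟨hyΩ, hy⟩) t ht)
  have hsol : MHGO.IsLoopSolution D Θ f g h κ ε ν (Ici 0)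
      fun t => MHGO.LoopState.ofSpace (y t) :=
    (MHGO.isLoopSolution_iff self_mem_Ici ordConnected_Ici).2
      ⟨fun t ht => ⟨hQΩ (hyY t ht).1, mem_univ _⟩, hy⟩
  refine ⟨fun t => MHGO.LoopState.ofSpace (y t), congrArg MHGO.LoopState.ofSpace hy0, hsol, ?_, ?_, ?_, ?_, ?_,
    fun i => ?_⟩
  · intro s hs z' hz'0 hz' t ht
    obtain ⟨h1, h2⟩ := (MHGO.isLoopSolution_iff (J := Ico 0 s) ⟨le_rfl, hs⟩ ordConnected_Ico).1 hz'
    have := MHGO.SolvesOn.eqOn_of_locallyLipschitzOn hLlip hNlip hνb h2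
      (hy.mono Ico_subset_Ici_self) h1 (fun t ht => ⟨hQΩ (hyY t ht.1).1, mem_univ _⟩)
      (by rw [hz'0, hy0]) t ht
    exact congrArg MHGO.LoopState.ofSpace this
  · exact MHGO.boundedForward_of_mem_compact (F := fun y : MHGO.LoopSpace n p M => y.1.1)
      (by fun_prop) hYc hyY
  · exact MHGO.boundedForward_of_mem_compact (F := fun y : MHGO.LoopSpace n p M => y.1.2)
      (by fun_prop) hYc hyY
  · exact MHGO.boundedForward_of_mem_compact MHGO.LoopState.contDiff_estimate.continuous hYc hyY
  · exact MHGO.boundedForward_of_mem_compact MHGO.LoopState.continuous_weights hYc hyY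
  · exact MHGO.boundedForward_of_mem_compact (F := fun y : MHGO.LoopSpace n p M => y.2.1 i)
      (by fun_prop) hYc hyY
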